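/- Let $p$ be a prime and $k$ an algebraic closure of $\mathbf F_p$. Let $n_1,\dots,n_r\ge 1$ be integers, $n=n_1+\dots+n_r$, and let $\sigma$ be the permutation of $\{1,\dots,n\}$ which maps each block $R_m=\{N_{m-1}+1,\dots,N_m\}$, $N_m=n_1+\dots+n_m$, to itself by the cycle $a\mapsto a-1$ (and $N_{m-1}+1\mapsto N_m$). Let $G=\prod_{m=1}^r \mathrm{Res}_{\mathbf F_{p^{n_m}}/\mathbf F_p}\mathrm{SL}_2$, so that $G_k=\mathrm{SL}_{2,k}^n$ with Frobenius $\varphi(x_1,\dots,x_n)=(x_{\sigma(1)}^{(p)},\dots,x_{\sigma(n)}^{(p)})$. Let $B,B_-,T\subset G_k$ be the subgroups of tuples of lower triangular, upper triangular and diagonal matrices; identify $X^*(T)=\mathbf Z^n$ by letting $\lambda=(\lambda_i)$ correspond to $(\mathrm{diag}(t_i,t_i^{-1}))_i\mapsto\prod_i t_i^{\lambda_i}$. Let $$E=\{(x,y)\in B\times B_- : \varphi(\bar x)=\bar y\}$$ ($\bar x,\bar y\in T$ the diagonal parts) act on $G_k$ by $(x,y)\cdot g=xgy^{-1}$, and let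 $\mathcal X=[E\backslash G_k]$ be the stack of $G$-zips for the Borel-type zip datum $(G,B,T,B_-,T,\varphi)$. For $S\subset\{1,\dots,n\}$ let $G_S\subset G_k$ be the set of tuples $(g_i)$ whose upper left entry $(g_i)_{11}$ is non-zero exactly for $i\in S$, let $\mathcal X_S=[E\backslash G_S]$, and let $\mathcal X_S^*$ be its Zariski closure with the reduced structure. A character $\lambda\in X^*(T)$ gives, through the first projection $E\to B\to T$, a line bundle $\mathscr L(\lambda)$ on $\mathcal X$. Let $X$ be a non-empty $k$-scheme with a morphism $\zeta:X\to\mathcal X$. Let $X_S=\zeta^{-1}(\mathcal X_S)$, and let $X_S^*$ be its Zariski closure with the reduced structure. Define the cones $$C_X=\{\lambda : H^0(X,\zeta^*\mathscr L(m\lambda))\ne0\text{ for some }m\ge1\},\quad C_{X,S}=\{\lambda : H^0(X_S^*,\zeta^*\mathscr L(m\lambda))\neq 0\text{ for some }m\ge1\},$$ and similarly $C_{\mathcal X}$ and $C_{\mathcal X,S}$, with $\mathcal X$ and $\mathcal X_S^*$ in place of $X$ and $X_S^*$. Assume that * $\zeta$ is smooth, and its restriction to each connected component of $X$ is surjective onto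 $\mathcal X$; * for every $S\subset\{1,\dots,n\}$ the reduced scheme $X_S^*$ is pseudo-complete, that is, every $h\in H^0(X_S^*,\mathcal O)$ is locally constant. Call a pair $(S',j)$ with $j\in S'\subset R_m$ *admissible* if, after a cyclic translation of $R_m\cong\mathbf Z/n_m\mathbf Z$, it has the form $S'=\{x_1<\dots<x_s\}$ with all differences $x_{i+1}-x_i$ odd and $j=x_s$. Call $S\subset\{1,\dots,n\}$ *$G$-admissible* if for every $m$ and every $j\in S\cap R_m$ the pair $(S\cap R_m,j)$ is admissible. Then: 1. For every $G$-admissible $S$ such that $\zeta$ maps each connected component of $X_S^*$ onto $\mathcal X_S^*$, one has $C_{X,S}=C_{\mathcal X,S}$. (For $S=\{1,\dots,n\}$, where $X_S^*=X$, the condition on components is part of the hypotheses.) 2. In particular, $C_X=C_{\mathcal X}$. 3. If $G$ is $\mathbf F_p$-split, i.e. $n_1=\dots=n_r=1$, then every $S\subset\{1,\dots,n\}$ is $G$-admissible. -/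

import Mathlib

universe u

open AlgebraicGeometry CategoryTheory

noncomputable section

namespace ZipCone

/-! ### The group, the zip group and characters, on points -/

/-- The index set `{1, …, n}`, cut into `r` blocks; block `m` has `d m` consecutive elements. -/
abbrev Idx {r : ℕ} (d : Fin r → ℕ) : Type := Σ m : Fin r, Fin (d m)

/-- The permutation `σ`: on each block it is the cycle `a ↦ a - 1`. -/
def frobPerm {r : ℕ} (d : Fin r → ℕ) : Equiv.Perm (Idx d) :=
  Equiv.sigmaCongrRight fun m => (finRotate (d m)).symm

/-- The `A`-points of `G_k = SL_2 × ⋯ × SL_2` (one factor for each `i : ι`). -/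
abbrev GPts (ι : Type) (A : Type u) [CommRing A] : Type u :=
  ι → Matrix.SpecialLinearGroup (Fin 2) A

/-- The `A`-points of the zip group `E`: pairs `(x, y)` with every `x i` lower triangular, every
`y i` upper triangular, and the torus part of `y` equal to the Frobenius of the torus part of `x`.
The Frobenius of `G` is `(x_i)_i ↦ (x_{σ i}^{(p)})_i`. -/
def zipGroup {ι : Type} (p : ℕ) (σ : Equiv.Perm ι) (A : Type u) [CommRing A] :
    Subgroup (GPts ι A × GPts ι A) where
  carrier := {e | ∀ i, e.1 i 0 1 = 0 ∧ e.2 i 1 0 = 0 ∧ e.2 i 0 0 = e.1 (σ i) 0 0 ^ p}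
  mul_mem' := by
    intro a b ha hb i
    obtain ⟨h1, h2, h3⟩ := ha i
    obtain ⟨h1', h2', h3'⟩ := hb i
    obtain ⟨k1, -, -⟩ := ha (σ i)
    simp [Matrix.mul_apply, Fin.sum_univ_two, h1, h2, h3, h1', h2', h3', k1, mul_pow]
  one_mem' := by
    intro i
    simp
  inv_mem' := by
    intro a ha i
    obtain ⟨h1, h2, h3⟩ := ha i
    obtain ⟨k1, -, -⟩ := ha (σ i)
    have hd : a.2 i 0 0 * a.2 i 1 1 = 1 := by
      have := (a.2 i).det_coe
      rw [Matrix.det_fin_two, h2] at this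
      simpa using this
    have hd' : a.1 (σ i) 0 0 * a.1 (σ i) 1 1 = 1 := by
      have := (a.1 (σ i)).det_coe
      rw [Matrix.det_fin_two, k1] at this
      simpa using this
    refine ⟨?_, ?_, ?_⟩
    · simp [Matrix.SpecialLinearGroup.coe_inv, Matrix.adjugate_fin_two, h1]
    · simp [Matrix.SpecialLinearGroup.coe_inv, Matrix.adjugate_fin_two, h2]
    · simp only [Prod.fst_inv, Prod.snd_inv, Pi.inv_apply, Matrix.SpecialLinearGroup.coe_inv,
        Matrix.adjugate_fin_two]
      have e : (a.1 (σ i) 0 0 * a.1 (σ i) 1 1) ^ p = 1 := by rw [hd', one_pow]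
      rw [mul_pow, ← h3] at e
      simp
      calc a.2 i 1 1 = a.2 i 1 1 * (a.2 i 0 0 * a.1 (σ i) 1 1 ^ p) := by rw [e, mul_one]
        _ = (a.2 i 0 0 * a.2 i 1 1) * a.1 (σ i) 1 1 ^ p := by ring
        _ = a.1 (σ i) 1 1 ^ p := by rw [hd, one_mul]

/-- Functoriality of the points of `E` in the ring. -/
def zipGroupMap {ι : Type} {p : ℕ} {σ : Equiv.Perm ι} {A B : Type u} [CommRing A] [CommRing B]
    (f : A →+* B) (e : zipGroup p σ A) : zipGroup p σ B :=
  ⟨(fun i => Matrix.SpecialLinearGroup.map f (e.1.1 i),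
    fun i => Matrix.SpecialLinearGroup.map f (e.1.2 i)), by
    intro i
    obtain ⟨h1, h2, h3⟩ := e.2 i
    simp [Matrix.SpecialLinearGroup.map_apply_coe, h1, h2, h3]⟩

/-- The `i`-th coordinate of the torus part of the first component of a point of `E`. -/
def torusCoord {ι : Type} {p : ℕ} {σ : Equiv.Perm ι} {A : Type u} [CommRing A]
    (e : zipGroup p σ A) (i : ι) : Aˣ where
  val := e.1.1 i 0 0
  inv := e.1.1 i 1 1
  val_inv := by
    have := (e.1.1 i).det_coe
    rw [Matrix.det_fin_two, (e.2 i).1] at this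
    simpa using this
  inv_val := by
    have := (e.1.1 i).det_coe
    rw [Matrix.det_fin_two, (e.2 i).1] at this
    rw [mul_comm]
    simpa using this

/-- The character `lam ∈ X^*(T) = ℤ^n`, as a character of `E` through the first projection. -/
def character {ι : Type} [Fintype ι] {p : ℕ} {σ : Equiv.Perm ι} {A : Type u} [CommRing A]
    (lam : ι → ℤ) (e : zipGroup p σ A) : Aˣ :=
  ∏ i, torusCoord e i ^ lam i

/-! ### The scheme `G_k` -/

/-- The coordinate ring of `SL_2 × ⋯ × SL_2` over `k`. -/
abbrev CoordRing (k : Type u) [Field k] (ι : Type) : Type u :=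
  MvPolynomial (ι × Fin 2 × Fin 2) k ⧸
    Ideal.span (Set.range fun i : ι =>
      (MvPolynomial.X (i, 0, 0) * MvPolynomial.X (i, 1, 1) -
        MvPolynomial.X (i, 0, 1) * MvPolynomial.X (i, 1, 0) - 1 :
          MvPolynomial (ι × Fin 2 × Fin 2) k))

/-- The universal point of `SL_2 × ⋯ × SL_2`. -/
def genericPt (k : Type u) [Field k] (ι : Type) : GPts ι (CoordRing k ι) := fun i =>
  ⟨Matrix.of fun a b => Ideal.Quotient.mk _ (MvPolynomial.X (i, a, b)), by
    rw [Matrix.det_fin_two]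
    simp only [Matrix.of_apply]
    rw [← map_mul, ← map_mul, ← map_sub, ← map_one (Ideal.Quotient.mk _), Ideal.Quotient.eq]
    exact Ideal.subset_span ⟨i, rfl⟩⟩

/-- `k`-schemes. -/
abbrev KSch (k : Type u) [Field k] : Type (u + 1) := Over (Spec (CommRingCat.of k))

/-- Global functions on a `k`-scheme. -/
abbrev Fn {k : Type u} [Field k] (Y : KSch k) : Type u := Γ(Y.left, ⊤)

/-- Pullback of global functions. -/
abbrev pull {k : Type u} [Field k] {Y Z : KSch k} (f : Y ⟶ Z) : Fn Z →+* Fn Y :=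
  f.left.appTop.hom

/-- The constant functions on a `k`-scheme. -/
def const {k : Type u} [Field k] (Y : KSch k) (c : k) : Fn Y :=
  Y.hom.appTop.hom ((Scheme.ΓSpecIso (CommRingCat.of k)).inv.hom c)

/-- The `k`-scheme `G_k = SL_2 × ⋯ × SL_2`. -/
def GSch (k : Type u) [Field k] (ι : Type) : KSch k :=
  Over.mk (Spec.map (CommRingCat.ofHom (algebraMap k (CoordRing k ι))))

/-- The tuple of matrices of a `T`-point of `G_k`. -/
def mat {k : Type u} [Field k] {ι : Type} {T : KSch k} (g : T ⟶ GSch k ι) : GPts ι (Fn T) :=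
  fun i => Matrix.SpecialLinearGroup.map
    ((pull g).comp (Scheme.ΓSpecIso (CommRingCat.of (CoordRing k ι))).inv.hom) (genericPt k ι i)

/-! ### Morphisms to the stack of `G`-zips -/

/-- A morphism `ζ : X ⟶ [E \ G]`: an `E`-torsor `π : I ⟶ X` (for the fppf topology) with an
`E`-equivariant morphism `q : I ⟶ G`, where `(x, y) ∈ E` acts on `G` by `g ↦ x g y⁻¹`.
The action of the group scheme `E` on `I` is given on `T`-points, naturally in `T`. -/
structure ZipMorphism {k : Type u} [Field k] {ι : Type} (p : ℕ) (σ : Equiv.Perm ι)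
    (X : KSch k) where
  I : KSch k
  π : I ⟶ X
  q : I ⟶ GSch k ι
  act : ∀ {T : KSch k}, zipGroup p σ (Fn T) → (T ⟶ I) → (T ⟶ I)
  act_one : ∀ {T : KSch k} (z : T ⟶ I), act 1 z = z
  act_mul : ∀ {T : KSch k} (e e' : zipGroup p σ (Fn T)) (z : T ⟶ I),
    act (e * e') z = act e (act e' z)
  act_natural : ∀ {T T' : KSch k} (f : T' ⟶ T) (e : zipGroup p σ (Fn T)) (z : T ⟶ I),
    f ≫ act e z = act (zipGroupMap (pull f) e) (f ≫ z)
  act_π : ∀ {T : KSch k} (e : zipGroup p σ (Fn T)) (z : T ⟶ I), act e z ≫ π = z ≫ π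
  act_q : ∀ {T : KSch k} (e : zipGroup p σ (Fn T)) (z : T ⟶ I),
    mat (act e z ≫ q) = e.1.1 * mat (z ≫ q) * e.1.2⁻¹
  simply_transitive : ∀ {T : KSch k} (z z' : T ⟶ I), z ≫ π = z' ≫ π →
    ∃! e : zipGroup p σ (Fn T), act e z = z'
  flat : Flat π.left
  surjective : Surjective π.left
  locallyOfFinitePresentation : LocallyOfFinitePresentation π.left

/-! ### Strata -/

/-- For `g : Y ⟶ G`, the preimage in `Y` of `G_S = ∏ G_{S,i}`, where `G_{S,i}` is the
non-vanishing locus of the upper left entry if `i ∈ S`, and its zero locus if `i ∉ S`. -/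
def preStratum {k : Type u} [Field k] {ι : Type} {Y : KSch k} (g : Y ⟶ GSch k ι)
    (S : Finset ι) : Set Y.left :=
  {y | ∀ i, y ∈ Y.left.basicOpen (mat g i 0 0 : Γ(Y.left, ⊤)) ↔ i ∈ S}

/-- The subset `G_S` of `G`. -/
def groupStratum (k : Type u) [Field k] {ι : Type} (S : Finset ι) : Set (GSch k ι).left :=
  preStratum (𝟙 (GSch k ι)) S

/-- The Zariski closure of a subset, with the reduced structure. -/
def redClosure {k : Type u} [Field k] (Y : KSch k) (s : Set Y.left) : KSch k :=
  Over.mk ((Scheme.IdealSheafData.vanishingIdeal ⟨closure s, isClosed_closure⟩).subschemeι ≫ Y.hom)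

/-- The inclusion of the Zariski closure. -/
def redClosureι {k : Type u} [Field k] (Y : KSch k) (s : Set Y.left) : redClosure Y s ⟶ Y :=
  Over.homMk (Scheme.IdealSheafData.vanishingIdeal ⟨closure s, isClosed_closure⟩).subschemeι rfl

/-- A reduced `k`-scheme is pseudo-complete if all its global functions are locally constant. -/
def PseudoComplete {k : Type u} [Field k] (Y : KSch k) : Prop :=
  IsReduced Y.left ∧ ∀ (h : Γ(Y.left, ⊤)) (y : Y.left), ∃ (U : Y.left.Opens) (c : k), y ∈ U ∧
    Y.left.presheaf.map (homOfLE (le_top : U ≤ ⊤)).op h =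
      Y.left.presheaf.map (homOfLE (le_top : U ≤ ⊤)).op (const Y c)

namespace ZipMorphism

variable {k : Type u} [Field k] {ι : Type} {p : ℕ} {σ : Equiv.Perm ι} {X : KSch k}

/-- The stratum `X_S = ζ⁻¹([E \ G_S])`. -/
def stratum (ζ : ZipMorphism p σ X) (S : Finset ι) : Set X.left :=
  ζ.π.left '' preStratum ζ.q S

/-- The stratum closure `X_S^*`, with the reduced structure. -/
def stratumClosure (ζ : ZipMorphism p σ X) (S : Finset ι) : KSch k :=
  redClosure X (ζ.stratum S)

/-- `ζ` is smooth: its base change along the atlas `G ⟶ [E \ G]`, which is `q`, is smooth. -/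
def IsSmooth (ζ : ZipMorphism p σ X) : Prop := Smooth ζ.q.left

/-- `ζ` maps the subset `Z` of `X` onto the substack `[E \ V]`, for `V` an `E`-stable subset of `G`
that contains the image of `Z` (tested after base change to the atlas `G`). -/
def MapsOnto (ζ : ZipMorphism p σ X) (Z : Set X.left) (V : Set (GSch k ι).left) : Prop :=
  ∀ g ∈ V, ∃ z : ζ.I.left, ζ.π.left z ∈ Z ∧ ζ.q.left z = g

/-- The restriction of the torsor `I` to the stratum closure `X_S^*`. -/
def torsorOver (ζ : ZipMorphism p σ X) (S : Finset ι) : KSch k :=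
  Over.mk (Limits.pullback.fst ζ.π.left (redClosureι X (ζ.stratum S)).left ≫ ζ.I.hom)

/-- The projection of the restricted torsor to `I`. -/
def torsorOverι (ζ : ZipMorphism p σ X) (S : Finset ι) : ζ.torsorOver S ⟶ ζ.I :=
  Over.homMk (Limits.pullback.fst ζ.π.left (redClosureι X (ζ.stratum S)).left) rfl

end ZipMorphism

/-! ### Sections of automorphic line bundles and their cones -/

section Cones

variable {k : Type u} [Field k] {ι : Type} [Fintype ι]

/-- Let `E` act on `J`, with graph `rel` on `T`-points: `rel e z z'` says `e · z = z'`.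
The global sections of the line bundle attached to `lam` on the quotient `[E \ J]` are the functions
`f` on `J` with `f (e · z) = lam(e) f(z)`. -/
def IsSection (p : ℕ) (σ : Equiv.Perm ι) (J : KSch k)
    (rel : ∀ T : KSch k, zipGroup p σ (Fn T) → (T ⟶ J) → (T ⟶ J) → Prop)
    (lam : ι → ℤ) (f : Fn J) : Prop :=
  ∀ (T : KSch k) (e : zipGroup p σ (Fn T)) (z z' : T ⟶ J), rel T e z z' →
    pull z' f = (character lam e : Fn T) * pull z f

/-- The characters `lam` such that some multiple `m • lam`, `m ≥ 1`, has a nonzero global section. -/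
def sectionCone (p : ℕ) (σ : Equiv.Perm ι) (J : KSch k)
    (rel : ∀ T : KSch k, zipGroup p σ (Fn T) → (T ⟶ J) → (T ⟶ J) → Prop) : Set (ι → ℤ) :=
  {lam | ∃ m : ℕ, 1 ≤ m ∧ ∃ f : Fn J, f ≠ 0 ∧ IsSection p σ J rel (m • lam) f}

/-- The cone of `X`. -/
def ZipMorphism.cone {p : ℕ} {σ : Equiv.Perm ι} {X : KSch k} (ζ : ZipMorphism p σ X) :
    Set (ι → ℤ) :=
  sectionCone p σ ζ.I fun _ e z z' => ζ.act e z = z'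

/-- The cone of the stratum closure `X_S^*`. -/
def ZipMorphism.stratumCone {p : ℕ} {σ : Equiv.Perm ι} {X : KSch k} (ζ : ZipMorphism p σ X)
    (S : Finset ι) : Set (ι → ℤ) :=
  sectionCone p σ (ζ.torsorOver S) fun _ e z z' =>
    ζ.act e (z ≫ ζ.torsorOverι S) = z' ≫ ζ.torsorOverι S

variable (k)

/-- The cone of the stack `[E \ G]`. -/
def stackCone (p : ℕ) (σ : Equiv.Perm ι) : Set (ι → ℤ) :=
  sectionCone p σ (GSch k ι) fun _ e z z' => mat z' = e.1.1 * mat z * e.1.2⁻¹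

/-- The cone of the closed substack `[E \ G_S^*]`, where `G_S^*` is the closure of `G_S` with the
reduced structure. -/
def stackStratumCone (p : ℕ) (σ : Equiv.Perm ι) (S : Finset ι) : Set (ι → ℤ) :=
  sectionCone p σ (redClosure (GSch k ι) (groupStratum k S)) fun _ e z z' =>
    mat (z' ≫ redClosureι _ _) = e.1.1 * mat (z ≫ redClosureι _ _) * e.1.2⁻¹

end Cones

/-! ### Admissible subsets -/

/-- `S = {x_1 < ⋯ < x_s}` with all `x_{i+1} - x_i` odd, and `j = x_s`. -/
def IsNormalizedAdmissiblePair {d : ℕ} (S : Finset (Fin d)) (j : Fin d) : Prop :=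
  j ∈ S ∧ (∀ x ∈ S, x ≤ j) ∧
    ∀ x ∈ S, ∀ y ∈ S, x < y → (∀ z ∈ S, ¬ (x < z ∧ z < y)) → Odd ((y : ℤ) - (x : ℤ))

/-- Some cyclic translate of `(S, j)` is a normalized admissible pair. -/
def IsAdmissiblePair {d : ℕ} (S : Finset (Fin d)) (j : Fin d) : Prop :=
  ∃ c : ℕ, IsNormalizedAdmissiblePair (S.map (finRotate d ^ c).toEmbedding) ((finRotate d ^ c) j)

/-- The part of `S` in the block `m`. -/
def block {r : ℕ} {d : Fin r → ℕ} (S : Finset (Idx d)) (m : Fin r) : Finset (Fin (d m)) :=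
  Finset.univ.filter fun a => (⟨m, a⟩ : Idx d) ∈ S

/-- `S` is `G`-admissible if for every `j ∈ S`, say in the block `m`, the pair `(S_m, j)` is
admissible. -/
def IsGAdmissible {r : ℕ} {d : Fin r → ℕ} (S : Finset (Idx d)) : Prop :=
  ∀ j ∈ S, IsAdmissiblePair (block S j.1) j.2

end ZipCone

end

/-! The rational weights have the basis e_i − p e_{σ i} (i ∈ S), e_i + p e_{σ i} (i ∉ S). On the
closed stratum of S the i-th upper left entry is a section of weight e_i − p e_{σ i}, a partial
Hasse invariant. For i ∉ S it vanishes, and then the upper right entry is an invertible section of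
weight e_i + p e_{σ i}. Hence every weight with non-negative coordinates on S lies in the cone of
the stack (`IsCompatible.mem_sectionCone`). The cone of the stack lies in that of X, since sections
pull back injectively along a surjection onto a reduced scheme. What remains is that a non-zero
section on X_S^* has a weight with non-negative coordinates on S.

This is an induction on S. Dividing by a monomial in the Hasse invariants of maximal degree lowers
the coordinates on S and leaves a section that is non-zero on X_{S∖i}^* for every i ∈ S
(`ZipMorphism.exists_sub_mem_cutWeights`). If S = {j} and the coordinate were negative, a power of
the section times an explicit section would be an invariant function divisible by the Hasse
invariant. By pseudo-completeness it descends to a locally constant function; it vanishes on X_∅,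
hence is zero (`ZipMorphism.coord_nonneg_of_mem_cutWeights_singleton`). The induction step is linear
algebra (`coord_nonneg_of_isSignAdmissible`). Admissibility says that a sign κ attached to the gaps
of S is constant; it persists, up to a change of κ, when suitable elements are removed. The
resulting inequalities combine to (q − κ)² (−b_j) ≤ 0, where q is p to the length of the cycle and
b_j is the coordinate after division.

The geometric input is that the upper left entries define a smooth map from the torsor to affine
space (`smoothCoordinates_mat`). So their common zero loci are locally integral and the remaining
entries are regular there (`smooth_cut`), and the torsor over X_S^* is exactly such a locus
(`ZipMorphism.IsSmooth.isCut_torsorOverι`). Components of the smaller stratum closures need not meet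
X_∅, although both the division and the base case need a point there. Therefore the open and closed
saturated parts that avoid X_∅ are removed first (`ZipMorphism.goodOpen`); the hypothesis on the
components of X_S^* ensures that no section is lost (`ZipMorphism.mem_cutWeights_of_isCut`). -/

noncomputable section

namespace ZipCone

/-! ### Weights of sections and their coordinates -/

section Coordinates

variable {ι : Type}

/-- The `(n + 1)`-st successor of `j` in its `σ⁻¹`-cycle. -/
def cyc (σ : Equiv.Perm ι) (j : ι) (n : ℕ) : ι := σ.symm^[n + 1] j

/-- The length of the cycle of `j`. -/
def per (σ : Equiv.Perm ι) (j : ι) : ℕ := Function.minimalPeriod σ.symm j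

lemma period_pos [Finite ι] (σ : Equiv.Perm ι) (j : ι) : 0 < per σ j :=
  Function.minimalPeriod_pos_of_mem_periodicPts
    ((Function.Injective.mem_periodicPts σ.symm.injective j))

lemma iterate_succ_injOn (σ : Equiv.Perm ι) (j : ι) {a b : ℕ}
    (ha : a < per σ j) (hb : b < per σ j)
    (h : cyc σ j a = cyc σ j b) : a = b := by
  rw [cyc, cyc, Function.iterate_succ_apply', Function.iterate_succ_apply'] at h
  exact Function.iterate_injOn_Iio_minimalPeriod ha hb (σ.symm.injective h)

lemma iterate_period_sub_one_succ [Finite ι] (σ : Equiv.Perm ι) (j : ι) :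
    cyc σ j (per σ j - 1) = j := by
  rw [cyc, Nat.sub_add_cancel (period_pos σ j)]
  exact Function.iterate_minimalPeriod

lemma two_le_pow_period [Finite ι] {p : ℕ} (hp : 2 ≤ p) (σ : Equiv.Perm ι) (j : ι) :
    (2 : ℚ) ≤ p ^ per σ j := by
  have : 2 ≤ p ^ per σ j :=
    hp.trans (Nat.le_self_pow (period_pos σ j).ne' p)
  exact_mod_cast this

lemma cyc_ne_self [Finite ι] (σ : Equiv.Perm ι) (j : ι) {x : ℕ} (hx : x + 1 < per σ j) :
    j ≠ cyc σ j x := by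
  intro e
  nth_rewrite 1 [← iterate_period_sub_one_succ σ j] at e
  have := iterate_succ_injOn σ j (by omega) (by omega) e
  omega

variable [DecidableEq ι]

/-- The sign `+1` on `S` and `-1` off `S`. -/
def sgn (S : Finset ι) (i : ι) : ℚ := if i ∈ S then 1 else -1

/-- The weight `e_i - p e_{σ i}` of the upper left entry of the `i`-th matrix. -/
def hasseWeight (p : ℕ) (σ : Equiv.Perm ι) (i : ι) : ι → ℤ :=
  Pi.single i 1 - (p : ℤ) • Pi.single (σ i) 1

/-- `c` are the coordinates of `lam` in the basis `e_i - p e_{σ i}` (`i ∈ S`),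
`e_i + p e_{σ i}` (`i ∉ S`). -/
def IsCoord (p : ℕ) (σ : Equiv.Perm ι) (S : Finset ι) (lam : ι → ℤ) (c : ι → ℚ) : Prop :=
  ∀ i, (lam i : ℚ) = c i - p * sgn S (σ.symm i) * c (σ.symm i)

lemma sgn_of_mem {S : Finset ι} {i : ι} (h : i ∈ S) : sgn S i = 1 := if_pos h

lemma sgn_eq (S : Finset ι) (i : ι) : sgn S i = 1 ∨ sgn S i = -1 := by
  unfold sgn; split_ifs <;> simp

lemma abs_sgn (S : Finset ι) (i : ι) : |sgn S i| = 1 := by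
  rcases sgn_eq S i with h | h <;> simp [h]

lemma hasseWeight_apply (p : ℕ) (σ : Equiv.Perm ι) (l i : ι) :
    hasseWeight p σ l i = (if i = l then 1 else 0) - p * (if σ.symm i = l then 1 else 0) := by
  have : (i = σ l) ↔ (σ.symm i = l) := by rw [Equiv.symm_apply_eq]
  simp [hasseWeight, Pi.single_apply, this]

/-- For a kernel vector, |c (σ i)| = p |c i|, so its entry of largest absolute value is zero.
Injectivity suffices in finite dimension. -/
lemma exists_isCoord [Fintype ι] {p : ℕ} (hp : 2 ≤ p) (σ : Equiv.Perm ι) (S : Finset ι) (lam : ι → ℤ) :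
    ∃ c, IsCoord p σ S lam c := by
  let M : (ι → ℚ) →ₗ[ℚ] (ι → ℚ) :=
    { toFun := fun c i => c i - p * sgn S (σ.symm i) * c (σ.symm i)
      map_add' := fun c c' => by ext i; simp; ring
      map_smul' := fun a c => by ext i; simp; ring }
  have hinj : Function.Injective M := by
    rw [← LinearMap.ker_eq_bot, LinearMap.ker_eq_bot']
    intro c hc
    have h1 : ∀ i, |c (σ i)| = p * |c i| := by
      intro i
      have := congrFun hc (σ i)
      simp only [M, LinearMap.coe_mk, AddHom.coe_mk, Equiv.symm_apply_apply, Pi.zero_apply] at this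
      rw [sub_eq_zero.mp this, abs_mul, abs_mul, abs_sgn, mul_one, Nat.abs_cast]
    rcases isEmpty_or_nonempty ι with h | h
    · exact Subsingleton.elim _ _
    obtain ⟨i, hi⟩ := Finite.exists_max fun i => |c i|
    have h2 := hi (σ i)
    rw [h1] at h2
    have h3 : (2 : ℚ) ≤ p := by exact_mod_cast hp
    have h4 : |c i| = 0 := by nlinarith [abs_nonneg (c i)]
    ext l
    have := hi l
    rw [h4] at this
    exact abs_nonpos_iff.mp this
  obtain ⟨c, hc⟩ := (LinearMap.injective_iff_surjective.mp hinj) fun i => (lam i : ℚ)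
  exact ⟨c, fun i => (congrFun hc i).symm⟩

/-- The Hasse weights with index in `S` are basis vectors, so dividing by them lowers the
coordinates by the exponents and only on `S`. -/
lemma IsCoord.sub_hasseWeight {p : ℕ} {σ : Equiv.Perm ι} {S : Finset ι} {lam : ι → ℤ} {c : ι → ℚ}
    (h : IsCoord p σ S lam c) (a : ι → ℕ) :
    IsCoord p σ S (lam - ∑ l ∈ S, a l • hasseWeight p σ l)
      (fun i => c i - if i ∈ S then (a i : ℚ) else 0) := by
  intro i
  have h1 : (∑ l ∈ S, a l • hasseWeight p σ l) i =
      (if i ∈ S then (a i : ℤ) else 0) - p * (if σ.symm i ∈ S then (a (σ.symm i) : ℤ) else 0) := by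
    simp [Finset.sum_apply, hasseWeight_apply, mul_sub, Finset.sum_sub_distrib,
      mul_comm, Finset.sum_ite_eq]
  rw [Pi.sub_apply, h1]
  push_cast
  rw [h i]
  by_cases h2 : σ.symm i ∈ S
  · simp [h2, sgn]; ring
  · simp [h2, sgn]; ring

/-- Going `N` steps along the cycle of `j`, the change of the coordinates when `S` is replaced
by a subset `S'`. -/
lemma coord_sub_eq {p : ℕ} {σ : Equiv.Perm ι} {S S' : Finset ι} (hS : S' ⊆ S) {lam : ι → ℤ}
    {c c' : ι → ℚ} (h : IsCoord p σ S lam c) (h' : IsCoord p σ S' lam c') (j : ι) (N : ℕ) :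
    c' j - c j = p ^ N * (∏ y ∈ Finset.range N, sgn S' (cyc σ j y)) *
        (c' (σ.symm^[N] j) - c (σ.symm^[N] j)) -
      2 * ∑ n ∈ Finset.range N, if cyc σ j n ∈ S \ S' then
        p ^ (n + 1) * (∏ y ∈ Finset.range n, sgn S' (cyc σ j y)) * c (cyc σ j n)
        else 0 := by
  induction N with
  | zero => simp
  | succ N ih =>
    rw [ih, Finset.sum_range_succ, Finset.prod_range_succ]
    have e1 := h (σ.symm^[N] j)
    have e2 := h' (σ.symm^[N] j)
    rw [← Function.iterate_succ_apply' σ.symm N j] at e1 e2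
    change _ = _ - _ * sgn S (cyc σ j N) * c (cyc σ j N) at e1
    change _ = _ - _ * sgn S' (cyc σ j N) * c' (cyc σ j N) at e2
    change _ = _ * (c' (cyc σ j N) - c (cyc σ j N)) - _
    set i := cyc σ j N
    -- The two signs differ only on `S \ S'`, and there by 2; this produces the source term.
    have e3 : c' (σ.symm^[N] j) - c (σ.symm^[N] j) =
        p * sgn S' i * (c' i - c i) - p * (sgn S i - sgn S' i) * c i := by
      rw [e1] at e2
      linear_combination -e2
    rw [e3]
    by_cases hi : i ∈ S
    · by_cases hi' : i ∈ S'
      · simp [sgn, hi, hi']; ring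
      · simp [sgn, hi, hi']; ring
    · have hi' : i ∉ S' := fun h => hi (hS h)
      simp [sgn, hi, hi']; ring

/-- The sign of the part of the cycle of `j` strictly between `j` and `i` is the same for all
`i ∈ S` in the cycle of `j`. -/
def IsSignAdmissible (σ : Equiv.Perm ι) (S : Finset ι) (j : ι) (κ : ℚ) : Prop :=
  j ∈ S ∧ (κ = 1 ∨ κ = -1) ∧ ∀ n < per σ j, cyc σ j n ∈ S →
    ∏ y ∈ Finset.range n, sgn S (cyc σ j y) = κ

lemma prod_sgn_erase (σ : Equiv.Perm ι) (S : Finset ι) (j : ι) {x n : ℕ}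
    (hx : x < per σ j) (hn : n ≤ per σ j)
    (hxS : cyc σ j x ∈ S) :
    ∏ y ∈ Finset.range n, sgn (S.erase (cyc σ j x)) (cyc σ j y) =
      (if x < n then -1 else 1) * ∏ y ∈ Finset.range n, sgn S (cyc σ j y) := by
  induction n with
  | zero => simp
  | succ n ih =>
    rw [Finset.prod_range_succ, Finset.prod_range_succ, ih (by omega)]
    rcases eq_or_ne n x with rfl | h
    · simp [sgn, hxS]
    · have h1 : cyc σ j n ≠ cyc σ j x :=
        fun e => h (iterate_succ_injOn σ j (by omega) hx e)
      have h2 : sgn (S.erase (cyc σ j x)) (cyc σ j n) =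
          sgn S (cyc σ j n) := by simp [sgn, h1]
      have h3 : (x < n + 1) ↔ x < n := by omega
      rw [h2, if_congr h3 rfl rfl, mul_assoc]

lemma IsSignAdmissible.prod_period [Finite ι] {σ : Equiv.Perm ι} {S : Finset ι} {j : ι} {κ : ℚ}
    (h : IsSignAdmissible σ S j κ) :
    ∏ y ∈ Finset.range (per σ j), sgn S (cyc σ j y) = κ := by
  have hd := period_pos σ j
  have e := iterate_period_sub_one_succ σ j
  obtain ⟨d, hd'⟩ : ∃ d, per σ j = d + 1 := ⟨_, (Nat.succ_pred hd.ne').symm⟩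
  rw [hd', Nat.add_sub_cancel] at e
  rw [hd', Finset.prod_range_succ, h.2.2 d (by omega) (e.symm ▸ h.1), e, sgn_of_mem h.1, mul_one]

/-- After one full turn the difference `c' j - c j` reappears on the right, so the recursion can be
solved for it. -/
lemma coord_sub_eq_period {p : ℕ} {σ : Equiv.Perm ι} {S S' : Finset ι} (hS : S' ⊆ S)
    {lam : ι → ℤ} {c c' : ι → ℚ} (h : IsCoord p σ S lam c) (h' : IsCoord p σ S' lam c') (j : ι) :
    (1 - p ^ per σ j *
      ∏ y ∈ Finset.range (per σ j), sgn S' (cyc σ j y)) *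
        (c' j - c j) =
      - 2 * ∑ n ∈ Finset.range (per σ j),
        if cyc σ j n ∈ S \ S' then
        p ^ (n + 1) * (∏ y ∈ Finset.range n, sgn S' (cyc σ j y)) * c (cyc σ j n)
        else 0 := by
  have := coord_sub_eq hS h h' j (per σ j)
  rw [show σ.symm^[per σ j] j = j from Function.iterate_minimalPeriod] at this
  linear_combination this

/-- Removing an element outside the cycle of `j`. -/
lemma IsSignAdmissible.erase_of_forall_ne [Finite ι] {p : ℕ} (hp : 2 ≤ p) {σ : Equiv.Perm ι}
    {S : Finset ι} {j i : ι} {κ : ℚ} (h : IsSignAdmissible σ S j κ) (hi : ∀ n, cyc σ j n ≠ i) (hij : j ≠ i) :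
    IsSignAdmissible σ (S.erase i) j κ ∧
      ∀ {lam : ι → ℤ} {c c' : ι → ℚ}, IsCoord p σ S lam c → IsCoord p σ (S.erase i) lam c' →
        c' j = c j := by
  have hs : ∀ n, sgn (S.erase i) (cyc σ j n) = sgn S (cyc σ j n) := fun n => by
    simp [sgn, hi n]
  have hA : IsSignAdmissible σ (S.erase i) j κ := by
    refine ⟨Finset.mem_erase.mpr ⟨hij, h.1⟩, h.2.1, fun n hn hnS => ?_⟩
    simp only [hs]
    exact h.2.2 n hn (Finset.mem_of_mem_erase hnS)
  refine ⟨hA, fun {lam c c'} hc hc' => ?_⟩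
  have := coord_sub_eq_period (Finset.erase_subset i S) hc hc' j
  rw [hA.prod_period, Finset.sum_eq_zero, mul_zero, mul_eq_zero] at this
  · have h2 := two_le_pow_period hp σ j
    rcases this with h3 | h3
    · rcases h.2.1 with rfl | rfl <;> linarith
    · linarith
  · intro n _
    rw [if_neg]
    simp [hi n]

/-- Removing the element of `S` next to `j` in its cycle. -/
lemma IsSignAdmissible.erase_first [Finite ι] {p : ℕ} {σ : Equiv.Perm ι}
    {S : Finset ι} {j : ι} {κ : ℚ} (h : IsSignAdmissible σ S j κ) {x : ℕ}
    (hx : x + 1 < per σ j) (hxS : cyc σ j x ∈ S)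
    (hmin : ∀ n < x, cyc σ j n ∉ S) :
    IsSignAdmissible σ (S.erase (cyc σ j x)) j (-κ) ∧
      ∀ {lam : ι → ℤ} {c c' : ι → ℚ}, IsCoord p σ S lam c →
        IsCoord p σ (S.erase (cyc σ j x)) lam c' →
        (p ^ per σ j + κ) * (c' j - c j) =
          -2 * p ^ (x + 1) * c (cyc σ j x) := by
  have hj : j ≠ cyc σ j x := by
    intro e
    nth_rewrite 1 [← iterate_period_sub_one_succ σ j] at e
    have := iterate_succ_injOn σ j (by omega) (by omega) e
    omega
  have hA : IsSignAdmissible σ (S.erase (cyc σ j x)) j (-κ) := by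
    refine ⟨Finset.mem_erase.mpr ⟨hj, h.1⟩, by rcases h.2.1 with rfl | rfl <;> simp,
      fun n hn hnS => ?_⟩
    -- The removed element comes first, so every remaining one lies beyond it and all gap signs
    -- flip.
    rw [prod_sgn_erase σ S j (by omega) (by omega) hxS,
      h.2.2 n hn (Finset.mem_of_mem_erase hnS), if_pos, neg_one_mul]
    by_contra hlt
    rcases eq_or_ne n x with rfl | hne
    · simp at hnS
    · exact hmin n (by omega) (Finset.mem_of_mem_erase hnS)
  refine ⟨hA, fun {lam c c'} hc hc' => ?_⟩
  have := coord_sub_eq_period (Finset.erase_subset _ S) hc hc' j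
  rw [hA.prod_period, Finset.sum_eq_single x] at this
  · rw [if_pos (by simp [hxS]), prod_sgn_erase σ S j (by omega) (by omega) hxS,
      h.2.2 x (by omega) hxS, if_neg (lt_irrefl _)] at this
    have hκ : κ * κ = 1 := by rcases h.2.1 with rfl | rfl <;> norm_num
    linear_combination κ * this + (- p ^ per σ j * (c' j - c j) -
      2 * p ^ (x + 1) * c (cyc σ j x)) * hκ
  · intro n hn hne
    rw [if_neg]
    simp only [Finset.mem_sdiff, Finset.mem_erase, not_and]
    intro h1
    exact fun hh => hh (fun e => hne (iterate_succ_injOn σ j (Finset.mem_range.mp hn) (by omega) e)) h1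
  · simp; omega

/-- Removing two elements of `S` that follow each other in the cycle of `j`. -/
lemma IsSignAdmissible.erase_pair [Finite ι] {p : ℕ} {σ : Equiv.Perm ι}
    {S : Finset ι} {j : ι} {κ : ℚ} (h : IsSignAdmissible σ S j κ) {x y : ℕ} (hyx : y < x)
    (hx : x + 1 < per σ j) (hxS : cyc σ j x ∈ S) (hyS : cyc σ j y ∈ S)
    (hmin : ∀ n, y < n → n < x → cyc σ j n ∉ S) :
    IsSignAdmissible σ ((S.erase (cyc σ j x)).erase (cyc σ j y)) j κ ∧
      ∀ {lam : ι → ℤ} {c c' : ι → ℚ}, IsCoord p σ S lam c →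
        IsCoord p σ ((S.erase (cyc σ j x)).erase (cyc σ j y)) lam c' →
        (p ^ per σ j - κ) * (c' j - c j) =
          2 * (p ^ (y + 1) * c (cyc σ j y) - p ^ (x + 1) * c (cyc σ j x)) := by
  have hne : cyc σ j y ≠ cyc σ j x := fun e => by
    have := iterate_succ_injOn σ j (by omega) (by omega) e
    omega
  have hprod : ∀ n, n ≤ per σ j → ∏ z ∈ Finset.range n,
      sgn ((S.erase (cyc σ j x)).erase (cyc σ j y)) (cyc σ j z) =
      (if y < n then -1 else 1) * ((if x < n then -1 else 1) *
        ∏ z ∈ Finset.range n, sgn S (cyc σ j z)) := fun n hn => by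
    rw [prod_sgn_erase σ _ j (by omega) hn (Finset.mem_erase.mpr ⟨hne, hyS⟩),
      prod_sgn_erase σ S j (by omega) hn hxS]
  have hA : IsSignAdmissible σ ((S.erase (cyc σ j x)).erase (cyc σ j y)) j κ := by
    refine ⟨Finset.mem_erase.mpr ⟨cyc_ne_self σ j (by omega), Finset.mem_erase.mpr
      ⟨cyc_ne_self σ j (by omega), h.1⟩⟩, h.2.1, fun n hn hnS => ?_⟩
    have hny : n ≠ y := by rintro rfl; simp at hnS
    have hnS := Finset.mem_of_mem_erase hnS
    have hnx : n ≠ x := by rintro rfl; simp at hnS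
    have hnS := Finset.mem_of_mem_erase hnS
    rw [hprod n hn.le, h.2.2 n hn hnS]
    -- A remaining element lies before both removed ones or after both, so the two sign changes
    -- cancel.
    by_cases h1 : y < n
    · have : x < n := by
        by_contra h2
        exact hmin n h1 (by omega) hnS
      simp [h1, this]
    · have : ¬ x < n := by omega
      simp [h1, this]
  refine ⟨hA, fun {lam c c'} hc hc' => ?_⟩
  have := coord_sub_eq_period ((Finset.erase_subset _ _).trans (Finset.erase_subset _ S)) hc hc' j
  rw [hA.prod_period, Finset.sum_eq_add x y (by omega)] at this
  · rw [if_pos (by simp [hxS]), if_pos (by simp [hyS]), hprod x (by omega), hprod y (by omega),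
      h.2.2 x (by omega) hxS, h.2.2 y (by omega) hyS, if_pos hyx, if_neg (lt_irrefl _),
      if_neg (lt_irrefl _), if_neg (by omega)] at this
    have hκ : κ * κ = 1 := by rcases h.2.1 with rfl | rfl <;> norm_num
    linear_combination -κ * this + (-p ^ per σ j * (c' j - c j) +
      2 * (p ^ (y + 1) * c (cyc σ j y) - p ^ (x + 1) * c (cyc σ j x))) * hκ
  · intro n hn hne'
    rw [if_neg]
    simp only [Finset.mem_sdiff, Finset.mem_erase, not_and]
    exact fun h1 hh => hh
      (fun e => hne'.2 (iterate_succ_injOn σ j (Finset.mem_range.mp hn) (by omega) e))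
      (fun e => hne'.1 (iterate_succ_injOn σ j (Finset.mem_range.mp hn) (by omega) e)) h1
  · simp; omega
  · simp; omega

/-- Removing `j` itself, and passing to the element of `S` that precedes `j` in its cycle. -/
lemma IsSignAdmissible.erase_self [Finite ι] {p : ℕ} {σ : Equiv.Perm ι}
    {S : Finset ι} {j : ι} {κ : ℚ} (h : IsSignAdmissible σ S j κ) {t : ℕ}
    (ht : t + 1 < per σ j) (htS : cyc σ j t ∈ S)
    (hmin : ∀ n, t < n → n + 1 < per σ j → cyc σ j n ∉ S) :
    IsSignAdmissible σ (S.erase j) (cyc σ j t) (-κ) ∧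
      ∀ {lam : ι → ℤ} {c c' : ι → ℚ}, IsCoord p σ S lam c →
        IsCoord p σ (S.erase j) lam c' →
        (p ^ per σ j + κ) * (c' (cyc σ j t) - c (cyc σ j t)) =
          -2 * κ * p ^ (per σ j - 1 - t) * c j := by
  have hcyc : ∀ n, cyc σ (cyc σ j t) n = cyc σ j (t + 1 + n) := fun n => by
    simp only [cyc, ← Function.iterate_add_apply]
    rw [show n + 1 + (t + 1) = t + 1 + n + 1 by omega]
  have hper : per σ (cyc σ j t) = per σ j := Function.minimalPeriod_apply_iterate
    (Function.Injective.mem_periodicPts σ.symm.injective j) _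
  have hlast := iterate_period_sub_one_succ σ j
  have hadd : ∀ m, cyc σ j (per σ j + m) = cyc σ j m := fun m => by
    simp only [cyc]
    rw [show per σ j + m + 1 = m + 1 + per σ j by omega, Function.iterate_add_apply,
      show σ.symm^[per σ j] j = j from Function.iterate_minimalPeriod]
  have hκ : κ ≠ 0 := by rcases h.2.1 with rfl | rfl <;> norm_num
  -- the sign of the gap between `cyc σ j t` and `j`
  have hgap : ∀ r, t + 1 + r + 1 ≤ per σ j →
      ∏ y ∈ Finset.range r, sgn (S.erase j) (cyc σ j (t + 1 + y)) =
      ∏ y ∈ Finset.range r, sgn S (cyc σ j (t + 1 + y)) := fun r hr => by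
    refine Finset.prod_congr rfl fun y hy => ?_
    have : cyc σ j (t + 1 + y) ≠ j := (cyc_ne_self σ j (by simp at hy; omega)).symm
    simp [sgn, this]
  -- The products from `j` up to `t` and from `j` back to `j` are both κ, which leaves 1 for the gap
  -- between.
  have hgap1 : ∏ y ∈ Finset.range (per σ j - 2 - t), sgn S (cyc σ j (t + 1 + y)) = 1 := by
    have e1 := h.2.2 (per σ j - 1) (by omega) (hlast.symm ▸ h.1)
    rw [show per σ j - 1 = t + 1 + (per σ j - 2 - t) by omega, Finset.prod_range_add,
      Finset.prod_range_succ, h.2.2 t (by omega) htS, sgn_of_mem htS, mul_one] at e1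
    exact mul_left_cancel₀ hκ (e1.trans (mul_one κ).symm)
  have hgap2 : ∏ y ∈ Finset.range (per σ j - 1 - t), sgn (S.erase j) (cyc σ j (t + 1 + y)) = -1 := by
    rw [show per σ j - 1 - t = per σ j - 2 - t + 1 by omega, Finset.prod_range_succ,
      hgap _ (by omega), hgap1, show t + 1 + (per σ j - 2 - t) = per σ j - 1 by omega, hlast]
    simp [sgn]
  have hprod : ∀ m, m ≤ t + 1 →
      ∏ y ∈ Finset.range (per σ j - 1 - t + m), sgn (S.erase j) (cyc σ j (t + 1 + y)) =
        - ∏ y ∈ Finset.range m, sgn S (cyc σ j y) := fun m hm => by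
    rw [Finset.prod_range_add, hgap2, neg_one_mul]
    congr 1
    refine Finset.prod_congr rfl fun y hy => ?_
    rw [Finset.mem_range] at hy
    rw [show t + 1 + (per σ j - 1 - t + y) = per σ j + y by omega, hadd]
    have : cyc σ j y ≠ j := (cyc_ne_self σ j (by omega)).symm
    simp [sgn, this]
  have hA : IsSignAdmissible σ (S.erase j) (cyc σ j t) (-κ) := by
    refine ⟨Finset.mem_erase.mpr ⟨(cyc_ne_self σ j ht).symm, htS⟩,
      by rcases h.2.1 with rfl | rfl <;> simp, fun n hn hnS => ?_⟩
    change n < per σ (cyc σ j t) at hn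
    change cyc σ (cyc σ j t) n ∈ _ at hnS
    rw [hper] at hn
    rw [hcyc] at hnS
    simp only [hcyc]
    have hn1 : per σ j - 1 - t ≤ n := by
      by_contra hlt
      by_cases h1 : t + 1 + n + 1 < per σ j
      · exact hmin _ (by omega) h1 (Finset.mem_of_mem_erase hnS)
      · rw [show t + 1 + n = per σ j - 1 by omega, hlast] at hnS
        simp at hnS
    obtain ⟨m, rfl⟩ := Nat.exists_eq_add_of_le hn1
    rw [show t + 1 + (per σ j - 1 - t + m) = per σ j + m by omega, hadd] at hnS
    rw [hprod m (by omega), h.2.2 m (by omega) (Finset.mem_of_mem_erase hnS)]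
  refine ⟨hA, fun {lam c c'} hc hc' => ?_⟩
  have := coord_sub_eq_period (Finset.erase_subset _ S) hc hc' (cyc σ j t)
  rw [hA.prod_period, hper, Finset.sum_eq_single (per σ j - 2 - t)] at this
  · simp only [hcyc] at this
    rw [show t + 1 + (per σ j - 2 - t) = per σ j - 1 by omega, hlast, if_pos (by simp [h.1]),
      hgap _ (by omega), hgap1, show per σ j - 2 - t + 1 = per σ j - 1 - t by omega] at this
    have hκ : κ * κ = 1 := by rcases h.2.1 with rfl | rfl <;> norm_num
    linear_combination κ * this - p ^ per σ j * (c' (cyc σ j t) - c (cyc σ j t)) * hκ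
  · intro n hn hne
    rw [hcyc, if_neg]
    simp only [Finset.mem_sdiff, Finset.mem_erase, not_and]
    intro h1 hh
    refine hh (fun e => hne ?_) h1
    replace e := e.trans hlast.symm
    simp only [Finset.mem_range] at hn
    by_cases h2 : t + 1 + n < per σ j
    · have := iterate_succ_injOn σ j h2 (by omega) e
      omega
    · rw [show t + 1 + n = per σ j + (t + 1 + n - per σ j) by omega, hadd] at e
      have := iterate_succ_injOn σ j (by omega)
        (by omega) e
      omega
  · simp; omega

/-- Let `C S` be sets of weights for which division by the Hasse invariants and restriction
to smaller strata is possible, and let the weights in `C {j}` have a non-negative `j`-th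
coordinate. Then the weights in `C S` have a non-negative `j`-th coordinate whenever `(S, j)` is
admissible. -/
theorem coord_nonneg_of_isSignAdmissible [Fintype ι] {p : ℕ} (hp : 2 ≤ p) (σ : Equiv.Perm ι)
    (C : Finset ι → Set (ι → ℤ))
    (hdiv : ∀ S, ∀ lam ∈ C S, ∃ a : ι → ℕ, ∀ i ∈ S,
      lam - ∑ l ∈ S, a l • hasseWeight p σ l ∈ C (S.erase i))
    (hbase : ∀ j, ∀ lam ∈ C {j}, ∀ c, IsCoord p σ {j} lam c → 0 ≤ c j) :
    ∀ (S : Finset ι) (j : ι) (κ : ℚ), IsSignAdmissible σ S j κ → ∀ lam ∈ C S, ∀ c,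
      IsCoord p σ S lam c → 0 ≤ c j := by
  intro S
  induction S using Finset.strongInduction with
  | H S ih =>
  intro j κ hadm lam hlam c hc
  by_cases hS : S = {j}
  · subst hS
    exact hbase j lam hlam c hc
  obtain ⟨a, ha⟩ := hdiv S lam hlam
  have hb := hc.sub_hasseWeight a
  set b : ι → ℚ := fun i => c i - if i ∈ S then (a i : ℚ) else 0 with hbdef
  set mu := lam - ∑ l ∈ S, a l • hasseWeight p σ l
  -- The exponent `a j` is non-negative, so it is enough to bound the coordinate `b j` of the
  -- divided weight.
  have hcb : b j ≤ c j := by simp [hbdef, hadm.1]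
  refine le_trans ?_ hcb
  have hss : ∀ i ∈ S, S.erase i ⊂ S := fun i hi => Finset.erase_ssubset hi
  -- An element in another cycle can be removed without affecting the `j`-th coordinate; afterwards
  -- `S` lies in the cycle of `j`.
  by_cases hout : ∃ i ∈ S, j ≠ i ∧ ∀ n, cyc σ j n ≠ i
  · obtain ⟨i, hi, hji, hi'⟩ := hout
    obtain ⟨c', hc'⟩ := exists_isCoord hp σ (S.erase i) mu
    obtain ⟨h1, h2⟩ := hadm.erase_of_forall_ne hp hi' hji
    rw [← h2 hb hc']
    exact ih _ (hss i hi) j κ h1 mu (ha i hi) c' hc'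
  by_contra hneg
  rw [not_le] at hneg
  have hp0 : (0 : ℚ) < p := by exact_mod_cast (by omega : 0 < p)
  have hpd : (2 : ℚ) ≤ p ^ per σ j := two_le_pow_period hp σ j
  have hκ1 : κ ≤ 1 := by rcases hadm.2.1 with rfl | rfl <;> norm_num
  have hκ2 : -1 ≤ κ := by rcases hadm.2.1 with rfl | rfl <;> norm_num
  -- all coordinates along the cycle are negative, with a lower bound on their size
  have hchain : ∀ x, x + 1 < per σ j → cyc σ j x ∈ S →
      (p ^ per σ j + κ) * (- b j) ≤ 2 * p ^ (x + 1) * (- b (cyc σ j x)) := by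
    intro x
    induction x using Nat.strong_induction_on with
    | _ x ihx =>
    intro hx hxS
    by_cases hfirst : ∀ n < x, cyc σ j n ∉ S
    · obtain ⟨c', hc'⟩ := exists_isCoord hp σ (S.erase (cyc σ j x)) mu
      obtain ⟨h1, h2⟩ := hadm.erase_first (p := p) hx hxS hfirst
      have h3 := ih _ (hss _ hxS) j _ h1 mu (ha _ hxS) c' hc'
      have h4 := h2 hb hc'
      nlinarith
    · push Not at hfirst
      obtain ⟨y, hy, hmax⟩ := Finset.exists_max_image
        ((Finset.range x).filter fun n => cyc σ j n ∈ S) id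
        (by obtain ⟨n, hn⟩ := hfirst; exact ⟨n, by simpa using hn⟩)
      simp only [Finset.mem_filter, Finset.mem_range, id, and_imp] at hy hmax
      obtain ⟨h1, h2⟩ := hadm.erase_pair (p := p) hy.1 hx hxS hy.2
        (fun n hn hn' hnS => absurd (hmax n hn' hnS) (by omega))
      -- Removing two elements needs a second division. Its exponents only lower the coordinates at
      -- `j` and `y`, which is harmless for the estimate p^(y+1) (−b_y) ≤ p^(x+1) (−b_x).
      obtain ⟨a', ha'⟩ := hdiv _ mu (ha _ hxS)
      have hyx : cyc σ j y ∈ S.erase (cyc σ j x) := Finset.mem_erase.mpr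
        ⟨fun e => by have := iterate_succ_injOn σ j (by omega) (by omega) e; omega, hy.2⟩
      have hjx : j ∈ S.erase (cyc σ j x) := Finset.mem_erase.mpr ⟨cyc_ne_self σ j hx, hadm.1⟩
      obtain ⟨c', hc'⟩ := exists_isCoord hp σ ((S.erase (cyc σ j x)).erase (cyc σ j y))
        (mu - ∑ l ∈ S.erase (cyc σ j x), a' l • hasseWeight p σ l)
      have h3 := ih _ ((Finset.erase_ssubset hyx).trans (hss _ hxS)) j _ h1 _ (ha' _ hyx) c' hc'
      -- The sum is extended to `S` with exponent 0 at the removed element, because `erase_pair`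
      -- starts from coordinates relative to `S`.
      have hsum : ∑ l ∈ S.erase (cyc σ j x), a' l • hasseWeight p σ l =
          ∑ l ∈ S, (if l = cyc σ j x then 0 else a' l) • hasseWeight p σ l := by
        rw [← Finset.add_sum_erase S _ hxS]
        simp only [if_pos, zero_smul, zero_add]
        exact Finset.sum_congr rfl fun l hl => by rw [if_neg (Finset.ne_of_mem_erase hl)]
      have hb' := hb.sub_hasseWeight fun l => if l = cyc σ j x then 0 else a' l
      rw [← hsum] at hb'
      have h4 := h2 hb' hc'
      have hjx' := Finset.ne_of_mem_erase hjx
      have hyx' := Finset.ne_of_mem_erase hyx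
      simp only [if_pos hadm.1, if_pos hy.2, if_pos hxS, if_neg hjx', if_neg hyx', if_true,
        Nat.cast_zero, sub_zero] at h4
      have h5 := ihx y hy.1 (by omega) hy.2
      have h6 : (0 : ℚ) ≤ (p ^ per σ j - κ) * (c' j - (b j - a' j)) :=
        mul_nonneg (by linarith) (by linarith [Nat.cast_nonneg (α := ℚ) (a' j)])
      have h7 : (0 : ℚ) ≤ p ^ (y + 1) * a' (cyc σ j y) := by positivity
      linarith
  -- there is another element of `S` in the cycle
  have hex : ∃ n, n + 1 < per σ j ∧ cyc σ j n ∈ S := by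
    by_contra hno
    push Not at hno hout
    refine hS (Finset.eq_singleton_iff_unique_mem.mpr ⟨hadm.1, fun i hi => ?_⟩)
    by_contra hij
    obtain ⟨n, rfl⟩ := hout i hi (Ne.symm hij)
    have hmod : cyc σ j n = σ.symm^[(n + 1) % per σ j] j := by
      simp only [cyc, per, Function.iterate_mod_minimalPeriod_eq]
    have hlt : (n + 1) % per σ j < per σ j := Nat.mod_lt _ (period_pos σ j)
    rcases Nat.eq_zero_or_pos ((n + 1) % per σ j) with h0 | h0
    · rw [h0] at hmod
      exact hij hmod
    · have : cyc σ j n = cyc σ j ((n + 1) % per σ j - 1) := by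
        rw [hmod, cyc, Nat.sub_add_cancel h0]
      exact hno _ (by omega) (this ▸ hi)
  obtain ⟨t, ht, hmax⟩ := Finset.exists_max_image
    ((Finset.range (per σ j)).filter fun n => n + 1 < per σ j ∧ cyc σ j n ∈ S) id
    (by obtain ⟨n, hn⟩ := hex; exact ⟨n, by simp [hn]; omega⟩)
  simp only [Finset.mem_filter, Finset.mem_range, id, and_imp] at ht hmax
  -- Removing `j` itself and applying the induction hypothesis at the last element before it bounds
  -- `-b (cyc σ j t)` from above, against the lower bound of the chain.
  obtain ⟨h1, h2⟩ := hadm.erase_self (p := p) ht.2.1 ht.2.2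
    (fun n hn hn' hnS => absurd (hmax n (by omega) hn' hnS) (by omega))
  obtain ⟨c', hc'⟩ := exists_isCoord hp σ (S.erase j) mu
  have h3 := ih _ (hss _ hadm.1) _ _ h1 mu (ha _ hadm.1) c' hc'
  have h4 := h2 hb hc'
  have h5 := hchain t ht.2.1 ht.2.2
  have h6 : (p : ℚ) ^ (t + 1) * p ^ (per σ j - 1 - t) = p ^ per σ j := by
    rw [← pow_add]; congr 1; omega
  have h7 : (p ^ per σ j + κ) * (- b (cyc σ j t)) ≤ 2 * κ * p ^ (per σ j - 1 - t) * (- b j) := by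
    have : (0 : ℚ) ≤ (p ^ per σ j + κ) * c' (cyc σ j t) := mul_nonneg (by linarith) h3
    linarith
  -- Eliminating `b (cyc σ j t)` closes the cycle of inequalities. As κ² = 1, (q + κ)² − 4κq = (q −
  -- κ)² > 0, which contradicts `b j < 0`.
  have h8 : (p ^ per σ j + κ) * ((p ^ per σ j + κ) * (- b j)) ≤ 4 * κ * p ^ per σ j * (- b j) := by
    have e1 := mul_le_mul_of_nonneg_left h5 (by linarith : (0 : ℚ) ≤ p ^ per σ j + κ)
    have e2 := mul_le_mul_of_nonneg_left h7 (by positivity : (0 : ℚ) ≤ 2 * p ^ (t + 1))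
    refine (e1.trans (le_of_eq (by ring))).trans (e2.trans (le_of_eq ?_))
    rw [← h6]; ring
  generalize (p : ℚ) ^ per σ j = q at h8 hpd
  have h9 := mul_pos (neg_pos.mpr hneg) (by linarith : (0 : ℚ) < q - 1)
  have h10 := mul_pos h9 (by linarith : (0 : ℚ) < q - 1)
  rcases hadm.2.1 with rfl | rfl <;> nlinarith

end Coordinates

/-! ### Admissible subsets of the blocks -/

section Admissible

/-- Between two consecutive elements at odd distance there is an even number of factors −1. Hence
the sign is decided by the factors before the first element. -/
lemma exists_sign_of_odd_gaps (P : ℕ → Prop) [DecidablePred P]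
    (h : ∀ x y, P x → P y → x < y → (∀ z, x < z → z < y → ¬ P z) → Odd (y - x)) :
    ∃ κ : ℚ, (κ = 1 ∨ κ = -1) ∧
      ∀ v, P v → ∏ y ∈ Finset.range v, (if P y then (1 : ℚ) else -1) = κ := by
  by_cases hP : ∃ v, P v
  · obtain ⟨m, hm, hmin⟩ : ∃ m, P m ∧ ∀ n < m, ¬ P n :=
      ⟨Nat.find hP, Nat.find_spec hP, fun n hn => Nat.find_min hP hn⟩
    refine ⟨(-1) ^ m, neg_one_pow_eq_or ℚ m, fun v => ?_⟩
    induction v using Nat.strong_induction_on with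
    | _ v ih =>
    intro hv
    rcases lt_trichotomy v m with hlt | rfl | hlt
    · exact absurd hv (hmin v hlt)
    · rw [Finset.prod_congr rfl fun y hy => if_neg (hmin y (Finset.mem_range.mp hy))]
      simp
    · obtain ⟨w, hw, hmax⟩ := Finset.exists_max_image ((Finset.range v).filter P) id
        ⟨m, by simp [hlt, hm]⟩
      simp only [Finset.mem_filter, Finset.mem_range, id, and_imp] at hw hmax
      have hno : ∀ z, w < z → z < v → ¬ P z := fun z h1 h2 h3 =>
        absurd (hmax z h2 h3) (by omega)
      have hodd := h w v hw.2 hv hw.1 hno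
      obtain ⟨t, ht⟩ := hodd
      rw [show v = w + 1 + 2 * t by omega, Finset.prod_range_add, Finset.prod_range_succ,
        ih w hw.1 hw.2, if_pos hw.2, mul_one,
        Finset.prod_congr rfl fun y hy => if_neg (hno (w + 1 + y) (by omega)
          (by rw [Finset.mem_range] at hy; omega))]
      simp
  · exact ⟨1, Or.inl rfl, fun v hv => absurd ⟨v, hv⟩ hP⟩

lemma val_finRotate_iterate {d : ℕ} (x : Fin d) (n : ℕ) :
    ((finRotate d)^[n] x : ℕ) = (x + n) % d := by
  obtain ⟨d, rfl⟩ : ∃ k, d = k + 1 := ⟨d - 1, by have := x.2; omega⟩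
  induction n with
  | zero => simp [Nat.mod_eq_of_lt x.2]
  | succ n ih =>
    rw [Function.iterate_succ_apply', finRotate_apply, Fin.val_add, ih]
    rcases d with _ | d
    · simp [Nat.mod_one]
    · simp only [Fin.val_one, Nat.mod_add_mod]
      rfl

lemma frobPerm_symm_iterate {r : ℕ} (d : Fin r → ℕ) (m : Fin r) (x : Fin (d m)) (n : ℕ) :
    (frobPerm d).symm^[n] ⟨m, x⟩ = ⟨m, (finRotate (d m))^[n] x⟩ := by
  induction n with
  | zero => rfl
  | succ n ih =>
    rw [Function.iterate_succ_apply', ih, Function.iterate_succ_apply']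
    rfl

lemma per_frobPerm_le {r : ℕ} (d : Fin r → ℕ) (j : Idx d) : per (frobPerm d) j ≤ d j.1 := by
  obtain ⟨m, x⟩ := j
  have hd : 0 < d m := x.pos
  refine Function.IsPeriodicPt.minimalPeriod_le hd ?_
  rw [Function.IsPeriodicPt, Function.IsFixedPt, frobPerm_symm_iterate]
  congr 1
  ext
  rw [val_finRotate_iterate, Nat.add_mod_right, Nat.mod_eq_of_lt x.2]

/-- In normalized position `j` is the largest element. The walk from it first crosses the points of
the block after `j`, none of which lies in `S`, and then runs through the block from 0, where the
odd gaps keep the sign constant. -/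
lemma IsAdmissiblePair.isSignAdmissible {r : ℕ} {d : Fin r → ℕ} {S : Finset (Idx d)} {j : Idx d}
    (h : IsAdmissiblePair (block S j.1) j.2) : ∃ κ, IsSignAdmissible (frobPerm d) S j κ := by
  obtain ⟨m, x⟩ := j
  obtain ⟨c, hj, hmax, hgap⟩ := h
  dsimp only at hj hmax hgap
  set S' := (block S m).map (finRotate (d m) ^ c).toEmbedding
  set j' := (finRotate (d m) ^ c) x with hj'
  have hmem : ∀ a, (finRotate (d m) ^ c) a ∈ S' ↔ (⟨m, a⟩ : Idx d) ∈ S := by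
    intro a
    simp [S', block]
  have hmem' : ∀ n, cyc (frobPerm d) ⟨m, x⟩ n ∈ S ↔ (finRotate (d m))^[n + 1] j' ∈ S' := by
    intro n
    rw [cyc, frobPerm_symm_iterate, ← hmem, hj']
    rw [← Equiv.Perm.iterate_eq_pow, ← Function.iterate_add_apply, ← Function.iterate_add_apply,
      add_comm]
  let P : ℕ → Prop := fun v => ∃ hv : v < d m, (⟨v, hv⟩ : Fin (d m)) ∈ S'
  classical
  obtain ⟨κ, hκ, hprod⟩ := exists_sign_of_odd_gaps P (by
    rintro a b ⟨ha, haS⟩ ⟨hb, hbS⟩ hab hno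
    have := hgap _ haS _ hbS hab fun z hz hz' => hno z hz'.1 hz'.2 ⟨z.2, hz⟩
    dsimp only at this
    rw [← Nat.cast_sub hab.le] at this
    exact_mod_cast this)
  have hxd := x.2
  have hjd := j'.2
  have hP : ∀ n, cyc (frobPerm d) ⟨m, x⟩ n ∈ S ↔ P ((j' + (n + 1)) % d m) := by
    intro n
    rw [hmem']
    simp only [P, ← val_finRotate_iterate j' (n + 1), Fin.is_lt, Fin.eta, exists_true_left]
  have hsgn : ∀ n, sgn S (cyc (frobPerm d) ⟨m, x⟩ n) =
      if P ((j' + (n + 1)) % d m) then 1 else -1 := by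
    intro n
    rw [sgn]
    exact if_congr (hP n) rfl rfl
  have hPle : ∀ v, P v → v ≤ j' := fun v ⟨hv, hvS⟩ => hmax _ hvS
  refine ⟨(-1) ^ (d m - 1 - j') * κ, ?_, ?_, fun n hn hnS => ?_⟩
  · rw [← hmem x]; exact hj
  · rcases hκ with rfl | rfl <;> rcases neg_one_pow_eq_or ℚ (d m - 1 - j') with h | h <;>
      simp [h]
  · have hn' : n < d m := hn.trans_le (per_frobPerm_le d ⟨m, x⟩)
    rw [hP] at hnS
    have h1 : d m - 1 - j' ≤ n := by
      by_contra hlt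
      rw [Nat.mod_eq_of_lt (by omega)] at hnS
      have := hPle _ hnS
      omega
    obtain ⟨v, rfl⟩ := Nat.exists_eq_add_of_le h1
    have h2 : ∀ y, (j' + (d m - 1 - j' + y + 1)) % d m = y % d m := fun y => by
      rw [show (j' : ℕ) + (d m - 1 - j' + y + 1) = y + d m by omega, Nat.add_mod_right]
    rw [h2, Nat.mod_eq_of_lt (by omega)] at hnS
    rw [Finset.prod_range_add]
    congr 1
    · rw [Finset.prod_congr rfl (g := fun _ => (-1 : ℚ)), Finset.prod_const, Finset.card_range]
      intro y hy
      rw [Finset.mem_range] at hy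
      rw [hsgn, if_neg]
      rw [Nat.mod_eq_of_lt (by omega)]
      intro h
      have := hPle _ h
      omega
    · rw [← hprod v hnS]
      refine Finset.prod_congr rfl fun y hy => ?_
      rw [Finset.mem_range] at hy
      rw [hsgn, h2, Nat.mod_eq_of_lt (by omega)]

lemma isGAdmissible_of_forall_eq_one {r : ℕ} {d : Fin r → ℕ} (hd : ∀ m, d m = 1)
    (S : Finset (Idx d)) : IsGAdmissible S := by
  intro j hj
  have : Subsingleton (Fin (d j.1)) := by rw [hd]; infer_instance
  refine ⟨0, ?_, fun x _ => (Subsingleton.elim x _).le, fun x _ y _ hxy =>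
    absurd (Subsingleton.elim x y) hxy.ne⟩
  simp only [pow_zero, Finset.mem_map_equiv, block, Finset.mem_filter, Finset.mem_univ, true_and]
  exact hj

lemma isGAdmissible_univ {r : ℕ} (d : Fin r → ℕ) :
    IsGAdmissible (Finset.univ : Finset (Idx d)) := by
  rintro ⟨m, x⟩ -
  have hx := x.2
  -- This translation moves `x` to the end of the block; all gaps of the full block are 1.
  refine ⟨d m - 1 - x, ?_⟩
  have hb : (block (Finset.univ : Finset (Idx d)) m) = Finset.univ := by simp [block]
  have hval : (((finRotate (d m) ^ (d m - 1 - x)) x : Fin (d m)) : ℕ) = d m - 1 := by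
    rw [← Equiv.Perm.iterate_eq_pow, val_finRotate_iterate, Nat.mod_eq_of_lt (by omega)]
    omega
  dsimp only
  rw [hb, Finset.map_univ_equiv]
  refine ⟨Finset.mem_univ _, fun y _ => ?_, fun y _ z _ hyz hno => ?_⟩
  · rw [Fin.le_def, hval]
    have := y.2
    omega
  · have : (z : ℕ) = y + 1 := by
      by_contra hne
      have hlt : (y : ℕ) < z := hyz
      exact hno ⟨y + 1, by have := z.2; omega⟩ (Finset.mem_univ _)
        ⟨by rw [Fin.lt_def]; simp, by rw [Fin.lt_def]; simp; omega⟩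
    rw [this]
    exact ⟨0, by push_cast; ring⟩

end Admissible

/-! ### Commutative algebra -/

section Algebra

open TensorProduct

/-- In a flat algebra over a reduced ring, `b ⊗ b = 0` only for `b = 0`. -/
lemma eq_zero_of_tmul_self_eq_zero {A B : Type*} [CommRing A] [CommRing B] [Algebra A B]
    [IsReduced A] [Module.Flat A B] {b : B} (h : b ⊗ₜ[A] b = 0) : b = 0 := by
  -- `b ∈ ann(b) B`
  have h1 : ∃ a : Ideal A, (∀ x ∈ a, x • b = 0) ∧ b ∈ a • (⊤ : Submodule A B) := by
    let f : A →ₗ[A] B := LinearMap.toSpanSingleton A B b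
    let a : Ideal A := LinearMap.ker f
    refine ⟨a, fun x hx => by simpa [a, f] using hx, ?_⟩
    -- Tensoring the embedding `A ⧸ a → B`, `1 ↦ b`, with the flat module `B` embeds B/aB into B ⊗
    -- B, and the class of `b` goes to `b ⊗ b = 0`.
    let g : (A ⧸ a) →ₗ[A] B := a.liftQ f le_rfl
    have hg : Function.Injective g := by
      rw [← LinearMap.ker_eq_bot]
      exact Submodule.ker_liftQ_eq_bot _ _ _ le_rfl
    have h2 : Function.Injective (LinearMap.lTensor B g) :=
      Module.Flat.lTensor_preserves_injective_linearMap g hg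
    have h3 : b ⊗ₜ[A] (Submodule.Quotient.mk 1 : A ⧸ a) = 0 := by
      apply h2
      rw [LinearMap.lTensor_tmul, map_zero]
      change b ⊗ₜ[A] (f 1) = 0
      simpa [f] using h
    have h4 := congrArg (TensorProduct.tensorQuotEquivQuotSMul B a) h3
    rw [map_zero] at h4
    have h5 : TensorProduct.tensorQuotEquivQuotSMul B a
        (b ⊗ₜ[A] (Ideal.Quotient.mk a 1)) = Submodule.Quotient.mk ((1 : A) • b) :=
      TensorProduct.tensorQuotEquivQuotSMul_tmul_mk a b 1
    have h6 := h5.symm.trans h4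
    rwa [one_smul, Submodule.Quotient.mk_eq_zero] at h6
  obtain ⟨a, ha, hb⟩ := h1
  -- finitely many elements of `a` suffice
  have h2 : ∃ s : Finset A, (∀ x ∈ s, x • b = 0) ∧
      b ∈ (Ideal.span (s : Set A)) • (⊤ : Submodule A B) := by
    classical
    suffices ∀ x ∈ a • (⊤ : Submodule A B), ∃ s : Finset A, (∀ x ∈ s, x ∈ a) ∧
        x ∈ (Ideal.span (s : Set A)) • (⊤ : Submodule A B) by
      obtain ⟨s, hs, h⟩ := this b hb
      exact ⟨s, fun x hx => ha x (hs x hx), h⟩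
    intro x hx
    refine Submodule.smul_induction_on hx (fun r hr n _ => ⟨{r}, by simpa using hr, ?_⟩) ?_
    · exact Submodule.smul_mem_smul (Ideal.subset_span (by simp)) trivial
    · rintro x y ⟨s, hs, hx⟩ ⟨t, ht, hy⟩
      refine ⟨s ∪ t, fun z hz => (Finset.mem_union.mp hz).elim (hs z) (ht z), add_mem ?_ ?_⟩
      · exact Submodule.smul_mono_left (Ideal.span_mono (by simp)) hx
      · exact Submodule.smul_mono_left (Ideal.span_mono (by simp)) hy
  obtain ⟨s, hs, hb⟩ := h2
  set a := Ideal.span (s : Set A)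
  let v : B ⊗[A] a →ₗ[A] B := (TensorProduct.rid A B).toLinearMap ∘ₗ LinearMap.lTensor B a.subtype
  have h2 : b ∈ LinearMap.range v :=
    Submodule.smul_induction_on hb (fun r hr n _ => ⟨n ⊗ₜ ⟨r, hr⟩, by simp [v]⟩)
      fun x y hx hy => add_mem hx hy
  obtain ⟨β, hβ⟩ := h2
  -- multiplication by these elements is injective on the ideal they span
  let m : a →ₗ[A] (s → A) := LinearMap.pi fun x => x.1 • a.subtype
  have hm : Function.Injective m := by
    rw [← LinearMap.ker_eq_bot, LinearMap.ker_eq_bot']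
    intro x hx
    have h3 : ∀ y ∈ a, y * x.1 = 0 := by
      intro y hy
      refine Submodule.span_induction (fun y hy => ?_) (zero_mul _)
        (fun y z _ _ hy hz => by rw [add_mul, hy, hz, add_zero])
        (fun r y _ hy => by rw [smul_mul_assoc, hy, smul_zero]) hy
      simpa [m] using congrFun hx ⟨y, hy⟩
    have h4 : IsNilpotent x.1 := ⟨2, by rw [pow_two]; exact h3 _ x.2⟩
    exact Subtype.ext h4.eq_zero
  classical
  have h5 : Function.Injective (TensorProduct.piScalarRight A A B s ∘ LinearMap.lTensor B m) :=
    (TensorProduct.piScalarRight A A B s).injective.comp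
      (Module.Flat.lTensor_preserves_injective_linearMap m hm)
  have h6 : ∀ γ, (TensorProduct.piScalarRight A A B s) (LinearMap.lTensor B m γ) =
      fun x => x.1 • v γ := by
    intro γ
    induction γ with
    | zero => ext; simp
    | add x y hx hy => rw [map_add, map_add, hx, hy, map_add]; ext; simp
    | tmul x y => ext i; simp [v, m, mul_smul]
  have h7 : β = 0 := by
    apply h5
    simp only [Function.comp, h6, map_zero]
    ext x
    simp only [Pi.zero_apply, hβ]
    exact hs _ x.2
  rw [← hβ, h7, map_zero]

/-- `B` becomes a domain, or zero, after inverting `s`. -/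
def IsDomainAway {B : Type*} [CommRing B] (s : B) : Prop :=
  ∀ x y : B, x * y = 0 → (∃ n : ℕ, s ^ n * x = 0) ∨ ∃ n : ℕ, s ^ n * y = 0

/-- Over the fraction field `B` becomes a finite product of fields. The idempotents of this product
are integral; since integral closure commutes with smooth base change and `P` is integrally closed,
they already lie in `B`. They sum to 1, so one of them avoids `p`, and inverting it leaves a subring
of a single field. -/
lemma exists_isDomainAway_of_etale {P B : Type u} [CommRing P] [IsDomain P] [IsIntegrallyClosed P]
    [CommRing B] [Algebra P B] [Algebra.Etale P B] (p : Ideal B) [p.IsPrime] :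
    ∃ s ∉ p, IsDomainAway s := by
  let K := FractionRing P
  obtain ⟨I, hI, L, hL, hL', e, -⟩ :=
    (Algebra.Etale.iff_exists_algEquiv_prod K (K ⊗[P] B)).mp inferInstance
  classical
  let φ : B →+* Π i, L i := (e : K ⊗[P] B →+* Π i, L i).comp
    (Algebra.TensorProduct.includeRight : B →ₐ[P] K ⊗[P] B).toRingHom
  have hφ : Function.Injective φ := by
    refine e.injective.comp ?_
    exact Algebra.TensorProduct.includeRight_injective (IsFractionRing.injective P K)
  -- idempotents lift
  have hlift : ∀ i, ∃ b : B, φ b = Pi.single i 1 := by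
    intro i
    let x : B ⊗[P] K := Algebra.TensorProduct.comm P K B (e.symm (Pi.single i 1))
    have hx : IsIntegral B x := by
      refine ⟨Polynomial.X ^ 2 - Polynomial.X, ?_, ?_⟩
      · exact Polynomial.monic_X_pow_sub (Polynomial.degree_X_le.trans_lt (by norm_num))
      · simp only [Polynomial.eval₂_sub, Polynomial.eval₂_pow, Polynomial.eval₂_X, x,
          ← map_pow, sub_eq_zero]
        congr 2
        ext l
        rcases eq_or_ne l i with rfl | h
        · simp
        · simp [h]
    obtain ⟨y, hy⟩ := (TensorProduct.toIntegralClosure_bijective_of_smooth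
      (R := P) (S := B) (B := K)).2 ⟨x, hx⟩
    have hy' : ∀ y : B ⊗[P] integralClosure P K, ∃ b : B,
        (TensorProduct.toIntegralClosure P B K y : B ⊗[P] K) = b ⊗ₜ 1 := by
      intro y
      induction y with
      | zero => exact ⟨0, by simp⟩
      | add y z hy hz =>
        obtain ⟨b, hb⟩ := hy
        obtain ⟨b', hb'⟩ := hz
        exact ⟨b + b', by rw [map_add, add_tmul, ← hb, ← hb']; rfl⟩
      | tmul b y =>
        obtain ⟨q, hq⟩ := IsIntegrallyClosed.isIntegral_iff.mp y.2
        refine ⟨q • b, ?_⟩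
        rw [smul_tmul, Algebra.smul_def, mul_one, hq]
        simp [TensorProduct.toIntegralClosure]
    obtain ⟨b, hb⟩ := hy' y
    refine ⟨b, ?_⟩
    rw [hy] at hb
    have : (Algebra.TensorProduct.comm P K B).symm x = (1 : K) ⊗ₜ b := by
      rw [show x = b ⊗ₜ 1 from hb]; simp
    simp only [φ, RingHom.comp_apply]
    change e ((1 : K) ⊗ₜ b) = _
    rw [← this]
    simp [x]
  choose b hb using hlift
  have := Fintype.ofFinite I
  have hsum : ∑ i, b i = 1 := by
    apply hφ
    rw [map_sum, map_one]
    simp only [hb]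
    exact Finset.univ_sum_single 1
  obtain ⟨i, hi⟩ : ∃ i, b i ∉ p := by
    by_contra h
    push Not at h
    exact (Ideal.ne_top_iff_one p).mp ‹p.IsPrime›.ne_top (hsum ▸ sum_mem fun i _ => h i)
  have key : ∀ x, φ x i = 0 → ∃ n : ℕ, b i ^ n * x = 0 := by
    intro x hx
    refine ⟨1, hφ ?_⟩
    rw [pow_one, map_mul, hb, map_zero]
    ext l
    rcases eq_or_ne l i with rfl | h
    · simp [hx]
    · simp [h]
  refine ⟨b i, hi, fun x y hxy => ?_⟩
  have : φ x i * φ y i = 0 := by rw [← Pi.mul_apply, ← map_mul, hxy, map_zero]; rfl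
  exact (mul_eq_zero.mp this).imp (key x) (key y)

/-- Locally a smooth algebra is étale over a polynomial ring over `R`, which is factorial and
therefore integrally closed. The rest is clearing denominators. -/
lemma exists_isDomainAway_of_smooth {R B : Type u} [CommRing R] [IsDomain R]
    [UniqueFactorizationMonoid R] [CommRing B] [Algebra R B] [Algebra.Smooth R B]
    (p : Ideal B) [p.IsPrime] : ∃ s ∉ p, IsDomainAway s := by
  obtain ⟨f, hfp, n, _, _, _⟩ :=
    Algebra.IsSmoothAt.exists_isStandardEtale_mvPolynomial (R := R) (p := p)
  have hdisj : Disjoint (Submonoid.powers f : Set B) p := by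
    rw [Set.disjoint_left]
    rintro _ ⟨m, rfl⟩ hm
    exact hfp (‹p.IsPrime›.mem_of_pow_mem _ hm)
  have := IsLocalization.isPrime_of_isPrime_disjoint (.powers f) (Localization.Away f) p ‹_› hdisj
  obtain ⟨g, hg, hdom⟩ := exists_isDomainAway_of_etale (P := MvPolynomial (Fin n) R)
    (p.map (algebraMap B (Localization.Away f)))
  obtain ⟨⟨a, ⟨_, m, rfl⟩⟩, ha⟩ := IsLocalization.surj (.powers f) g
  dsimp only at ha
  have hap : a ∉ p := by
    intro hap
    have h1 : g * algebraMap B (Localization.Away f) (f ^ m) ∈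
        p.map (algebraMap B (Localization.Away f)) := by
      rw [ha]
      exact Ideal.mem_map_of_mem _ hap
    have h2 : IsUnit (algebraMap B (Localization.Away f) (f ^ m)) :=
      IsLocalization.map_units (Localization.Away f) (⟨f ^ m, m, rfl⟩ : Submonoid.powers f)
    exact hg ((Ideal.mul_unit_mem_iff_mem _ h2).mp h1)
  refine ⟨f * a, fun h => (‹p.IsPrime›.mem_or_mem h).elim hfp hap, ?_⟩
  have key : ∀ (x : B) (n : ℕ), g ^ n * algebraMap B (Localization.Away f) x = 0 →
      ∃ n : ℕ, (f * a) ^ n * x = 0 := by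
    intro x n hx
    have h1 : algebraMap B (Localization.Away f) (a ^ n * x) = 0 := by
      rw [map_mul, map_pow, ← ha, mul_pow, mul_right_comm, hx, zero_mul]
    obtain ⟨⟨_, l, rfl⟩, hl⟩ := (IsLocalization.map_eq_zero_iff (.powers f) _ _).mp h1
    refine ⟨n + l, ?_⟩
    dsimp only at hl
    calc (f * a) ^ (n + l) * x = f ^ n * a ^ l * (f ^ l * (a ^ n * x)) := by ring
      _ = 0 := by rw [hl, mul_zero]
  intro x y hxy
  refine (hdom (algebraMap _ _ x) (algebraMap _ _ y) (by rw [← map_mul, hxy, map_zero])).imp ?_ ?_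
  · rintro ⟨n, hn⟩; exact key x n hn
  · rintro ⟨n, hn⟩; exact key y n hn

/-- Modulo the variables outside `S`, every polynomial agrees with what remains of it after these
variables are set to zero. -/
lemma ker_killCompl {ι k : Type*} [CommRing k] (S : Set ι) :
    RingHom.ker (MvPolynomial.killCompl (R := k) (Subtype.val_injective (p := (· ∈ S)))) =
      Ideal.span (MvPolynomial.X '' Sᶜ) := by
  classical
  apply le_antisymm
  · have h : ∀ q : MvPolynomial ι k, q - MvPolynomial.rename Subtype.val
        (MvPolynomial.killCompl (R := k) (Subtype.val_injective (p := (· ∈ S))) q) ∈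
          Ideal.span (MvPolynomial.X '' Sᶜ) := by
      intro q
      induction q using MvPolynomial.induction_on with
      | C a => simp [MvPolynomial.algHom_C]
      | add a b ha hb => rw [map_add, map_add, add_sub_add_comm]; exact add_mem ha hb
      | mul_X a i ha =>
        rw [map_mul, map_mul]
        by_cases hi : i ∈ S
        · have : MvPolynomial.killCompl (R := k) (Subtype.val_injective (p := (· ∈ S)))
              (MvPolynomial.X i) = MvPolynomial.X ⟨i, hi⟩ := by
            simp only [MvPolynomial.killCompl, MvPolynomial.aeval_X]
            rw [dif_pos ⟨⟨i, hi⟩, rfl⟩]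
            congr 1
            exact (Equiv.symm_apply_eq _).mpr rfl
          rw [this, MvPolynomial.rename_X, ← sub_mul]
          exact Ideal.mul_mem_right _ _ ha
        · have : MvPolynomial.killCompl (R := k) (Subtype.val_injective (p := (· ∈ S)))
              (MvPolynomial.X i) = 0 := by
            simp only [MvPolynomial.killCompl, MvPolynomial.aeval_X]
            rw [dif_neg]
            rintro ⟨l, rfl⟩
            exact hi l.2
          rw [this, map_zero, mul_zero, sub_zero]
          exact Ideal.mul_mem_left _ _ (Ideal.subset_span ⟨i, hi, rfl⟩)
    intro q hq
    have := h q
    rwa [RingHom.mem_ker.mp hq, map_zero, sub_zero] at this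
  · rw [Ideal.span_le]
    rintro _ ⟨i, hi, rfl⟩
    rw [SetLike.mem_coe, RingHom.mem_ker]
    simp only [MvPolynomial.killCompl, MvPolynomial.aeval_X]
    rw [dif_neg]
    rintro ⟨l, rfl⟩
    exact hi l.2

/-- Cutting a smooth algebra over `k[X_i]` by the variables outside `S`: the other variables are
non-zero-divisors, and the quotient is locally a domain. -/
lemma smooth_cut {ι : Type} {k B : Type u} [Field k] [CommRing B] (θ : MvPolynomial ι k →+* B)
    (hθ : θ.Smooth) (S : Set ι) :
    (∀ i ∈ S, ∀ b, θ (.X i) * b ∈ Ideal.span ((fun i => θ (.X i)) '' Sᶜ) →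
      b ∈ Ideal.span ((fun i => θ (.X i)) '' Sᶜ)) ∧
    (∀ (p : Ideal B) [p.IsPrime], Ideal.span ((fun i => θ (.X i)) '' Sᶜ) ≤ p → ∃ s ∉ p,
      IsDomainAway (Ideal.Quotient.mk (Ideal.span ((fun i => θ (.X i)) '' Sᶜ)) s)) := by
  algebraize [θ]
  -- The quotient of `B` is its base change to the polynomial ring `Q` in the variables of `S`. It
  -- is smooth over `Q`: flatness keeps the variables regular, and smoothness over a factorial
  -- domain makes it locally a domain.
  let Q := MvPolynomial {i // i ∈ S} k
  let κ : MvPolynomial ι k →ₐ[k] Q := MvPolynomial.killCompl (Subtype.val_injective (p := (· ∈ S)))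
  have hκ : Function.Surjective κ := fun q =>
    ⟨MvPolynomial.rename Subtype.val q, MvPolynomial.killCompl_rename_app _ q⟩
  let _ : Algebra (MvPolynomial ι k) Q := κ.toRingHom.toAlgebra
  let f : B →+* Q ⊗[MvPolynomial ι k] B :=
    (Algebra.TensorProduct.includeRight : B →ₐ[MvPolynomial ι k] _).toRingHom
  have hf : Function.Surjective f := Algebra.TensorProduct.includeRight_surjective B hκ
  have hker : RingHom.ker f = Ideal.span ((fun i => θ (.X i)) '' Sᶜ) := by
    have h1 := Algebra.TensorProduct.rTensor_ker (R := MvPolynomial ι k) (C := B)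
      (Algebra.ofId (MvPolynomial ι k) Q) hκ
    have h2 : RingHom.ker (Algebra.ofId (MvPolynomial ι k) Q) =
        Ideal.span (MvPolynomial.X '' Sᶜ) := ker_killCompl S
    rw [h2, Ideal.map_span] at h1
    let e := Algebra.TensorProduct.lid (MvPolynomial ι k) B
    have h3 : f = ((Algebra.TensorProduct.map (Algebra.ofId (MvPolynomial ι k) Q)
        (AlgHom.id (MvPolynomial ι k) B)).toRingHom).comp (e.symm : B →+* _) := by
      ext b
      simp [f, e]
    rw [h3, ← RingHom.comap_ker]
    change Ideal.comap (e.symm : B →+* _) (RingHom.ker (Algebra.TensorProduct.map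
      (Algebra.ofId (MvPolynomial ι k) Q) (AlgHom.id (MvPolynomial ι k) B))) = _
    rw [h1]
    have h4 := Ideal.map_comap_of_equiv (e : _ ≃+* B)
      (I := Ideal.span ((Algebra.TensorProduct.includeLeft : MvPolynomial ι k →ₐ[MvPolynomial ι k]
        MvPolynomial ι k ⊗[MvPolynomial ι k] B) '' (MvPolynomial.X '' Sᶜ)))
    refine Eq.trans h4.symm ?_
    rw [Ideal.map_span]
    congr 1
    ext b
    simp only [Set.mem_image, exists_exists_and_eq_and]
    refine exists_congr fun i => and_congr_right fun _ => ?_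
    simp [e, Algebra.smul_def]
    rfl
  rw [← hker]
  refine ⟨fun i hi b hb => ?_, fun p _ hp => ?_⟩
  · rw [RingHom.mem_ker, map_mul] at hb
    have h1 : f (θ (.X i)) = algebraMap Q (Q ⊗[MvPolynomial ι k] B) (.X ⟨i, hi⟩) := by
      have h2 : κ (.X i) = .X ⟨i, hi⟩ := by
        have := MvPolynomial.killCompl_rename_app (R := k) (Subtype.val_injective (p := (· ∈ S)))
          (.X ⟨i, hi⟩)
        rwa [MvPolynomial.rename_X] at this
      have h3 : f (algebraMap (MvPolynomial ι k) B (.X i)) =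
          algebraMap (MvPolynomial ι k) (Q ⊗[MvPolynomial ι k] B) (.X i) :=
        (Algebra.TensorProduct.includeRight : B →ₐ[MvPolynomial ι k] _).commutes _
      rw [← h2]
      exact h3.trans (IsScalarTower.algebraMap_apply (MvPolynomial ι k) Q _ _)
    rw [h1, ← Algebra.smul_def] at hb
    have h2 : IsSMulRegular Q (MvPolynomial.X ⟨i, hi⟩ : Q) :=
      (IsRegular.of_ne_zero (MvPolynomial.X_ne_zero _)).left
    have h3 := h2.of_flat (S := Q ⊗[MvPolynomial ι k] B)
    exact h3.right_eq_zero_of_smul (by rw [algebraMap_smul]; exact hb)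
  · have : (p.map f).IsPrime := Ideal.map_isPrime_of_surjective hf hp
    obtain ⟨s, hs, hdom⟩ := exists_isDomainAway_of_smooth (R := Q) (p.map f)
    obtain ⟨s, rfl⟩ := hf s
    refine ⟨s, fun h => hs (Ideal.mem_map_of_mem _ h), fun x y hxy => ?_⟩
    obtain ⟨x, rfl⟩ := Ideal.Quotient.mk_surjective x
    obtain ⟨y, rfl⟩ := Ideal.Quotient.mk_surjective y
    simp only [← map_mul, ← map_pow, Ideal.Quotient.eq_zero_iff_mem, RingHom.mem_ker] at hxy ⊢
    simpa only [← map_mul, ← map_pow] using hdom (f x) (f y) (by rw [← map_mul, hxy])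

end Algebra

/-! ### Smoothness of the upper left entries -/

section UpperLeft

/-- The map of coordinate rings of `G ⟶ 𝔸^n`, `(g_i) ↦ ((g_i)_{11})`. -/
def upperLeft (k : Type u) [Field k] (ι : Type) : MvPolynomial ι k →ₐ[k] CoordRing k ι :=
  MvPolynomial.aeval fun i => genericPt k ι i 0 0

lemma coordRing_algHom_ext {k : Type u} [Field k] {ι : Type} {A : Type*}
    [CommRing A] [Algebra k A] {f g : CoordRing k ι →ₐ[k] A}
    (h : ∀ i a b, f (genericPt k ι i a b) = g (genericPt k ι i a b)) : f = g := by
  apply Ideal.Quotient.algHom_ext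
  ext ⟨i, a, b⟩
  exact h i a b

/-- The morphism from the coordinate ring attached to a tuple of matrices. -/
def coordLift {k : Type u} [Field k] {ι : Type} {A : Type*} [CommRing A] [Algebra k A]
    (g : ι → Matrix (Fin 2) (Fin 2) A) (hg : ∀ i, (g i).det = 1) : CoordRing k ι →ₐ[k] A :=
  Ideal.Quotient.liftₐ _ (MvPolynomial.aeval fun x : ι × Fin 2 × Fin 2 => g x.1 x.2.1 x.2.2) (by
    intro a ha
    have : Ideal.span (Set.range fun i : ι =>
      (MvPolynomial.X (i, 0, 0) * MvPolynomial.X (i, 1, 1) -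
        MvPolynomial.X (i, 0, 1) * MvPolynomial.X (i, 1, 0) - 1 :
          MvPolynomial (ι × Fin 2 × Fin 2) k)) ≤ RingHom.ker (MvPolynomial.aeval
            (R := k) fun x : ι × Fin 2 × Fin 2 => g x.1 x.2.1 x.2.2) := by
      rw [Ideal.span_le]
      rintro _ ⟨i, rfl⟩
      have := hg i
      rw [Matrix.det_fin_two] at this
      simp [RingHom.mem_ker, this]
    exact this ha)

lemma coordLift_genericPt {k : Type u} [Field k] {ι : Type} {A : Type*} [CommRing A] [Algebra k A]
    (g : ι → Matrix (Fin 2) (Fin 2) A) (hg : ∀ i, (g i).det = 1) (i : ι) (a b : Fin 2) :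
    coordLift (k := k) g hg (genericPt k ι i a b) = g i a b := by
  change coordLift (k := k) g hg (Ideal.Quotient.mk _ (MvPolynomial.X (i, a, b))) = _
  exact (Ideal.Quotient.lift_mk _ _ _).trans (MvPolynomial.aeval_X _ _)

/-- Infinitesimal lifting: arbitrary lifts of the other entries give determinant 1 + ε with ε² = 0.
Scaling the second row by 1 − ε restores determinant 1 and leaves the prescribed upper left entry
alone. -/
lemma upperLeft_smooth (k : Type u) [Field k] (ι : Type) [Finite ι] :
    (upperLeft k ι : MvPolynomial ι k →+* CoordRing k ι).Smooth := by
  let _ : Algebra (MvPolynomial ι k) (CoordRing k ι) := (upperLeft k ι).toRingHom.toAlgebra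
  have : IsScalarTower k (MvPolynomial ι k) (CoordRing k ι) :=
    .of_algebraMap_eq fun x => ((upperLeft k ι).commutes x).symm
  have : Algebra.FinitePresentation k (CoordRing k ι) := by
    refine Algebra.FinitePresentation.quotient ?_
    exact Submodule.fg_span (Set.finite_range _)
  have hfp : Algebra.FinitePresentation (MvPolynomial ι k) (CoordRing k ι) :=
    .of_restrict_scalars_finitePresentation k _ _
  have hfs : Algebra.FormallySmooth (MvPolynomial ι k) (CoordRing k ι) := by
    refine .of_comp_surjective fun C _ _ J hJ f => ?_
    let _ : Algebra k C := ((algebraMap (MvPolynomial ι k) C).comp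
      (algebraMap k (MvPolynomial ι k))).toAlgebra
    have : IsScalarTower k (MvPolynomial ι k) C := .of_algebraMap_eq fun x => rfl
    have hup : ∀ i, genericPt k ι i 0 0 = algebraMap (MvPolynomial ι k) (CoordRing k ι) (.X i) :=
      fun i => by
        change _ = upperLeft k ι _
        simp [upperLeft]
    -- lift the entries, then correct the second row
    choose b hb using fun i => Ideal.Quotient.mk_surjective (f (genericPt k ι i 0 1))
    choose c hc using fun i => Ideal.Quotient.mk_surjective (f (genericPt k ι i 1 0))
    choose e he using fun i => Ideal.Quotient.mk_surjective (f (genericPt k ι i 1 1))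
    let a : ι → C := fun i => algebraMap (MvPolynomial ι k) C (.X i)
    have ha : ∀ i, Ideal.Quotient.mk J (a i) = f (genericPt k ι i 0 0) := fun i => by
      rw [hup, f.commutes]; rfl
    let ε : ι → C := fun i => a i * e i - b i * c i - 1
    have hε : ∀ i, ε i ∈ J := fun i => by
      rw [← Ideal.Quotient.eq_zero_iff_mem]
      have := (genericPt k ι i).det_coe
      rw [Matrix.det_fin_two] at this
      simp only [ε, map_sub, map_mul, ha, hb, hc, he, map_one]
      rw [← map_mul, ← map_mul, ← map_sub, this, map_one, sub_self]
    have hε2 : ∀ i, ε i * ε i = 0 := fun i => by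
      have : ε i * ε i ∈ J ^ 2 := by rw [pow_two]; exact Ideal.mul_mem_mul (hε i) (hε i)
      rwa [hJ] at this
    let g : ι → Matrix (Fin 2) (Fin 2) C := fun i =>
      !![a i, b i; (1 - ε i) * c i, (1 - ε i) * e i]
    have hg : ∀ i, (g i).det = 1 := fun i => by
      simp only [g, Matrix.det_fin_two_of]
      have : a i * e i - b i * c i = 1 + ε i := by simp [ε]
      linear_combination (1 - ε i) * this - hε2 i
    have hcomm : ∀ q : MvPolynomial ι k, coordLift (k := k) g hg
        (algebraMap (MvPolynomial ι k) (CoordRing k ι) q) = algebraMap (MvPolynomial ι k) C q := by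
      intro q
      have : (coordLift (k := k) g hg).comp (upperLeft k ι) =
          IsScalarTower.toAlgHom k (MvPolynomial ι k) C := by
        ext i
        simp only [upperLeft, AlgHom.comp_apply, MvPolynomial.aeval_X, coordLift_genericPt]
        rfl
      exact DFunLike.congr_fun this q
    refine ⟨{ (coordLift (k := k) g hg).toRingHom with commutes' := hcomm }, ?_⟩
    have key : ((Ideal.Quotient.mkₐ k J).comp (coordLift (k := k) g hg)) = f.restrictScalars k := by
      refine coordRing_algHom_ext fun i x y => ?_
      rw [AlgHom.comp_apply, coordLift_genericPt]
      change Ideal.Quotient.mk J (g i x y) = f _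
      fin_cases x <;> fin_cases y
      · exact ha i
      · exact hb i
      · change Ideal.Quotient.mk J ((1 - ε i) * c i) = f (genericPt k ι i 1 0)
        rw [map_mul, map_sub, Ideal.Quotient.eq_zero_iff_mem.mpr (hε i), map_one, sub_zero,
          one_mul, hc]
      · change Ideal.Quotient.mk J ((1 - ε i) * e i) = f (genericPt k ι i 1 1)
        rw [map_mul, map_sub, Ideal.Quotient.eq_zero_iff_mem.mpr (hε i), map_one, sub_zero,
          one_mul, he]
    ext z
    exact DFunLike.congr_fun key z
  exact ⟨hfs, hfp⟩

end UpperLeft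

/-! ### Sections of the automorphic line bundles -/

section Sections

variable {k : Type u} [Field k] {ι : Type}

lemma pull_comp {Y Z W : KSch k} (f : Y ⟶ Z) (g : Z ⟶ W) (a : Fn W) :
    pull (f ≫ g) a = pull f (pull g a) := by
  rw [pull, Over.comp_left, Scheme.Hom.comp_appTop]
  rfl

lemma pull_id {Y : KSch k} (a : Fn Y) : pull (𝟙 Y) a = a := by
  simp [pull]

lemma mat_comp {Y Z : KSch k} (f : Y ⟶ Z) (g : Z ⟶ GSch k ι) (i : ι) (a b : Fin 2) :
    mat (f ≫ g) i a b = pull f (mat g i a b) :=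
  pull_comp f g _

lemma torusCoord_map {p : ℕ} {σ : Equiv.Perm ι} {A B : Type u} [CommRing A] [CommRing B]
    (f : A →+* B) (e : zipGroup p σ A) (i : ι) :
    torusCoord (zipGroupMap f e) i = Units.map f.toMonoidHom (torusCoord e i) := by
  ext
  simp [torusCoord, zipGroupMap]

lemma zipGroup_snd_diag {p : ℕ} {σ : Equiv.Perm ι} {A : Type u} [CommRing A] (e : zipGroup p σ A) (i : ι) :
    e.1.2 i 0 0 = ((torusCoord e (σ i) ^ p : Aˣ) : A) ∧
      e.1.2 i 1 1 = (((torusCoord e (σ i) ^ p)⁻¹ : Aˣ) : A) := by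
  obtain ⟨k1, k2, k3⟩ := e.2 i
  have h1 : e.1.2 i 0 0 = ((torusCoord e (σ i) ^ p : Aˣ) : A) := by
    rw [k3, Units.val_pow_eq_pow_val]; rfl
  refine ⟨h1, ?_⟩
  symm
  apply Units.inv_eq_of_mul_eq_one_right
  have := (e.1.2 i).det_coe
  rw [Matrix.det_fin_two, k2, mul_zero, sub_zero, h1] at this
  exact this

variable [Fintype ι]

lemma character_add {p : ℕ} {σ : Equiv.Perm ι} {A : Type u} [CommRing A] (lam mu : ι → ℤ)
    (e : zipGroup p σ A) : character (lam + mu) e = character lam e * character mu e := by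
  simp [character, zpow_add, Finset.prod_mul_distrib]

lemma character_zero {p : ℕ} {σ : Equiv.Perm ι} {A : Type u} [CommRing A]
    (e : zipGroup p σ A) : character (0 : ι → ℤ) e = 1 := by
  simp [character]

lemma character_neg {p : ℕ} {σ : Equiv.Perm ι} {A : Type u} [CommRing A] (lam : ι → ℤ)
    (e : zipGroup p σ A) : character (-lam) e = (character lam e)⁻¹ := by
  simp [character]

lemma character_zsmul {p : ℕ} {σ : Equiv.Perm ι} {A : Type u} [CommRing A] (n : ℤ) (lam : ι → ℤ)
    (e : zipGroup p σ A) : character (n • lam) e = character lam e ^ n := by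
  simp only [character, ← Finset.prod_zpow, Pi.smul_apply, smul_eq_mul, mul_comm n, zpow_mul]

lemma character_single [DecidableEq ι] {p : ℕ} {σ : Equiv.Perm ι} {A : Type u} [CommRing A] (i : ι)
    (e : zipGroup p σ A) : character (Pi.single i 1) e = torusCoord e i := by
  rw [character, Finset.prod_eq_single i]
  · simp
  · intro l _ hl
    simp [hl]
  · simp

lemma character_map {p : ℕ} {σ : Equiv.Perm ι} {A B : Type u} [CommRing A] [CommRing B]
    (f : A →+* B) (lam : ι → ℤ) (e : zipGroup p σ A) :
    character lam (zipGroupMap f e) = Units.map f.toMonoidHom (character lam e) := by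
  simp [character, torusCoord_map, map_prod, map_zpow]

variable {p : ℕ} {σ : Equiv.Perm ι} {J : KSch k}
  {rel : ∀ T : KSch k, zipGroup p σ (Fn T) → (T ⟶ J) → (T ⟶ J) → Prop}

lemma IsSection.mul {lam mu : ι → ℤ} {f g : Fn J} (hf : IsSection p σ J rel lam f)
    (hg : IsSection p σ J rel mu g) : IsSection p σ J rel (lam + mu) (f * g) := by
  intro T e z z' h
  rw [map_mul, hf T e z z' h, hg T e z z' h, map_mul, character_add, Units.val_mul]
  ring

lemma IsSection.one : IsSection p σ J rel 0 (1 : Fn J) := by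
  intro T e z z' _
  rw [map_one, map_one, character_zero, Units.val_one, mul_one]

lemma IsSection.pow {lam : ι → ℤ} {f : Fn J} (hf : IsSection p σ J rel lam f) (n : ℕ) :
    IsSection p σ J rel (n • lam) (f ^ n) := by
  induction n with
  | zero => simpa using IsSection.one
  | succ n ih =>
    rw [succ_nsmul, pow_succ]
    exact ih.mul hf

lemma IsSection.prod {α : Type*} (s : Finset α) {lam : α → ι → ℤ} {f : α → Fn J}
    (hf : ∀ a ∈ s, IsSection p σ J rel (lam a) (f a)) :
    IsSection p σ J rel (∑ a ∈ s, lam a) (∏ a ∈ s, f a) := by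
  classical
  induction s using Finset.induction_on with
  | empty => simpa using IsSection.one
  | insert a s ha ih =>
    rw [Finset.sum_insert ha, Finset.prod_insert ha]
    exact (hf a (Finset.mem_insert_self _ _)).mul
      (ih fun b hb => hf b (Finset.mem_insert_of_mem hb))

lemma IsSection.units_inv {lam : ι → ℤ} {f : (Fn J)ˣ}
    (hf : IsSection p σ J rel lam (f : Fn J)) :
    IsSection p σ J rel (-lam) ((f⁻¹ : (Fn J)ˣ) : Fn J) := by
  intro T e z z' h
  have h1 : Units.map (pull z').toMonoidHom f = character lam e * Units.map (pull z).toMonoidHom f :=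
    Units.ext (hf T e z z' h)
  have h2 := congrArg (fun u : (Fn T)ˣ => ((u⁻¹ : (Fn T)ˣ) : Fn T)) h1
  simp only [mul_inv, ← map_inv] at h2
  rw [character_neg]
  exact h2

lemma IsSection.units_zpow {lam : ι → ℤ} {f : (Fn J)ˣ}
    (hf : IsSection p σ J rel lam (f : Fn J)) (n : ℤ) :
    IsSection p σ J rel (n • lam) ((f ^ n : (Fn J)ˣ) : Fn J) := by
  obtain ⟨n, rfl | rfl⟩ := n.eq_nat_or_neg
  · rw [zpow_natCast, natCast_zsmul, Units.val_pow_eq_pow_val]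
    exact hf.pow n
  · rw [zpow_neg, zpow_natCast, neg_smul, natCast_zsmul]
    refine IsSection.units_inv ?_
    rw [Units.val_pow_eq_pow_val]
    exact hf.pow n

lemma IsSection.pullback {J' : KSch k}
    {rel' : ∀ T : KSch k, zipGroup p σ (Fn T) → (T ⟶ J') → (T ⟶ J') → Prop} (φ : J' ⟶ J)
    (hφ : ∀ T e z z', rel' T e z z' → rel T e (z ≫ φ) (z' ≫ φ)) {lam : ι → ℤ} {f : Fn J}
    (hf : IsSection p σ J rel lam f) : IsSection p σ J' rel' lam (pull φ f) := by
  intro T e z z' h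
  rw [← pull_comp, ← pull_comp]
  exact hf T e _ _ (hφ T e z z' h)

/-- `rel` is compatible with the action of `E` on `G` through `g : J ⟶ G`. -/
def IsCompatible (rel : ∀ T : KSch k, zipGroup p σ (Fn T) → (T ⟶ J) → (T ⟶ J) → Prop)
    (g : J ⟶ GSch k ι) : Prop :=
  ∀ T e z z', rel T e z z' → mat (z' ≫ g) = e.1.1 * mat (z ≫ g) * e.1.2⁻¹

variable [DecidableEq ι]

/-- With x lower and y⁻¹ upper triangular, the upper left entry of x g y⁻¹ is the product of the
three upper left entries; that of y⁻¹ is the (−p)-th power of the σ i-th torus coordinate of x. -/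
lemma IsCompatible.isSection_upperLeft {g : J ⟶ GSch k ι} (hg : IsCompatible rel g) (i : ι) :
    IsSection p σ J rel (hasseWeight p σ i) (mat g i 0 0) := by
  intro T e z z' h
  have h1 := hg T e z z' h
  rw [← mat_comp, ← mat_comp, h1]
  have h2 : character (hasseWeight p σ i) e = torusCoord e i * (torusCoord e (σ i) ^ p)⁻¹ := by
    rw [hasseWeight, sub_eq_add_neg, character_add, character_neg, character_zsmul,
      character_single, character_single, zpow_natCast]
  obtain ⟨k1, k2, k3⟩ := e.2 i
  rw [h2, Units.val_mul, ← (zipGroup_snd_diag e i).2]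
  change _ = e.1.1 i 0 0 * _ * _
  simp [Matrix.mul_apply, Fin.sum_univ_two, Matrix.SpecialLinearGroup.coe_inv,
    Matrix.adjugate_fin_two, k1, k2]
  ring

/-- Once the upper left entry vanishes, the upper right entry is scaled in the same way, now by the
lower right entry of y⁻¹. This turns the exponent −p into p. -/
lemma IsCompatible.isSection_upperRight {g : J ⟶ GSch k ι} (hg : IsCompatible rel g) (i : ι)
    (hi : mat g i 0 0 = 0) :
    IsSection p σ J rel (Pi.single i 1 + (p : ℤ) • Pi.single (σ i) 1) (mat g i 0 1) := by
  intro T e z z' h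
  have h1 := hg T e z z' h
  have h0 : mat (z ≫ g) i 0 0 = 0 := by rw [mat_comp, hi, map_zero]
  rw [← mat_comp, ← mat_comp, h1]
  obtain ⟨k1, k2, k3⟩ := e.2 i
  rw [character_add, character_zsmul, character_single, character_single, zpow_natCast,
    Units.val_mul, ← (zipGroup_snd_diag e i).1]
  change _ = e.1.1 i 0 0 * _ * _
  simp [Matrix.mul_apply, Fin.sum_univ_two, Matrix.SpecialLinearGroup.coe_inv,
    Matrix.adjugate_fin_two, k1, h0]
  ring

/-- The upper right entry is invertible where the upper left entry vanishes. -/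
def upperRightUnit (g : J ⟶ GSch k ι) (i : ι) (hi : mat g i 0 0 = 0) : (Fn J)ˣ :=
  have h : mat g i 0 1 * (- mat g i 1 0) = 1 := by
    have := (mat g i).det_coe
    rw [Matrix.det_fin_two, hi, zero_mul, zero_sub] at this
    rw [mul_neg, this]
  ⟨mat g i 0 1, - mat g i 1 0, h, by rw [mul_comm, h]⟩

lemma IsCoord.eq_sum (S : Finset ι) {lam : ι → ℤ} {c : ι → ℤ}
    (hc : IsCoord p σ S lam fun i => (c i : ℚ)) (hc0 : ∀ i ∈ S, 0 ≤ c i) :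
    lam = (∑ i, if i ∈ S then 0 else c i • (Pi.single i 1 + (p : ℤ) • Pi.single (σ i) 1)) +
      ∑ i ∈ S, (c i).toNat • hasseWeight p σ i := by
  have key : ∀ l, lam l = ∑ i, c i * ((if l = i then (1 : ℤ) else 0) -
      (if i ∈ S then 1 else -1) * (p * (if σ.symm l = i then 1 else 0))) := by
    intro l
    have h : (lam l : ℚ) = ((c l - c (σ.symm l) * ((if σ.symm l ∈ S then 1 else -1) * p) : ℤ) : ℚ) := by
      rw [hc l]
      by_cases h2 : σ.symm l ∈ S <;> simp [sgn, h2] <;> ring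
    have h' : lam l = c l - c (σ.symm l) * ((if σ.symm l ∈ S then 1 else -1) * p) := by
      exact_mod_cast h
    rw [h']
    simp [mul_sub, Finset.sum_sub_distrib]
  rw [show ∑ i ∈ S, (c i).toNat • hasseWeight p σ i =
    ∑ i, if i ∈ S then (c i).toNat • hasseWeight p σ i else 0 by simp, ← Finset.sum_add_distrib]
  ext l
  rw [key l, Finset.sum_apply]
  refine Finset.sum_congr rfl fun i _ => ?_
  have hl : (l = σ i) ↔ (σ.symm l = i) := by rw [Equiv.symm_apply_eq]
  by_cases hi : i ∈ S
  · simp [hi, hasseWeight_apply, Int.toNat_of_nonneg (hc0 i hi)]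
  · simp only [hi, Pi.single_apply, hl, if_false, Pi.add_apply, Pi.smul_apply, smul_eq_mul,
      Pi.zero_apply]
    ring

/-- A weight with integral coordinates that are non-negative on `S` has an explicit section where
the upper left entries outside `S` vanish. -/
lemma IsCompatible.exists_isSection {g : J ⟶ GSch k ι} (hg : IsCompatible rel g) (S : Finset ι)
    (hS : ∀ i ∉ S, mat g i 0 0 = 0) {lam : ι → ℤ} {c : ι → ℤ}
    (hc : IsCoord p σ S lam fun i => (c i : ℚ)) (hc0 : ∀ i ∈ S, 0 ≤ c i) :
    ∃ v : (Fn J)ˣ, IsSection p σ J rel lam (v * ∏ i ∈ S, mat g i 0 0 ^ (c i).toNat) := by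
  have h1 : IsSection p σ J rel (∑ i ∈ S, (c i).toNat • hasseWeight p σ i)
      (∏ i ∈ S, mat g i 0 0 ^ (c i).toNat) :=
    IsSection.prod S fun i _ => (hg.isSection_upperLeft i).pow _
  have h2 : ∀ i, ∃ w : (Fn J)ˣ, IsSection p σ J rel
      (if i ∈ S then 0 else c i • (Pi.single i 1 + (p : ℤ) • Pi.single (σ i) 1)) (w : Fn J) := by
    intro i
    by_cases hi : i ∈ S
    · exact ⟨1, by simpa [hi] using IsSection.one⟩
    -- Off `S` the exponent may have any sign, because the upper right entry is a unit.
    · refine ⟨upperRightUnit g i (hS i hi) ^ c i, ?_⟩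
      rw [if_neg hi]
      exact IsSection.units_zpow (f := upperRightUnit g i (hS i hi))
        (hg.isSection_upperRight i (hS i hi)) (c i)
  choose w hw using h2
  refine ⟨∏ i, w i, ?_⟩
  rw [Units.coe_prod, hc.eq_sum S hc0]
  exact (IsSection.prod Finset.univ fun i _ => hw i).mul h1

end Sections

/-! ### Vanishing loci of smooth coordinates -/

section Cuts

variable {ι : Type} {W J : Scheme.{u}}

/-- The restriction of a global function to an open subset. -/
abbrev res (U : W.Opens) : Γ(W, ⊤) →+* Γ(W, U) :=
  (W.presheaf.map (homOfLE (le_top : U ≤ ⊤)).op).hom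

lemma eq_zero_of_forall_germ_eq_zero (h : Γ(W, ⊤))
    (H : ∀ y : W, W.presheaf.germ ⊤ y trivial h = 0) : h = 0 :=
  TopCat.Presheaf.section_ext W.sheaf ⊤ _ _ fun y _ => (H y).trans (map_zero _).symm

lemma germ_res_apply (U : W.Opens) (y : W) (hy : y ∈ U) (h : Γ(W, ⊤)) :
    W.presheaf.germ U y hy (res U h) = W.presheaf.germ ⊤ y trivial h :=
  W.presheaf.germ_res_apply _ _ _ _

lemma eq_zero_of_forall_exists_res_eq_zero (h : Γ(W, ⊤))
    (H : ∀ y : W, ∃ U : W.Opens, y ∈ U ∧ res U h = 0) : h = 0 := by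
  refine eq_zero_of_forall_germ_eq_zero h fun y => ?_
  obtain ⟨U, hy, hU⟩ := H y
  rw [← germ_res_apply U y hy, hU, map_zero]

lemma exists_gluing {α : Type*} (V : α → W.Opens) (hV : ∀ y, ∃ a, y ∈ V a) (g : ∀ a, Γ(W, V a))
    (hg : ∀ a b y (ha : y ∈ V a) (hb : y ∈ V b),
      W.presheaf.germ (V a) y ha (g a) = W.presheaf.germ (V b) y hb (g b)) :
    ∃ s : Γ(W, ⊤), ∀ a, res (V a) s = g a := by
  obtain ⟨s, hs, -⟩ := W.sheaf.existsUnique_gluing' V ⊤ (fun y => homOfLE le_top)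
    (fun y _ => TopologicalSpace.Opens.mem_iSup.2 (hV y)) g (by
      intro a b
      refine TopCat.Presheaf.section_ext W.sheaf _ _ _ fun y hy => ?_
      refine (W.presheaf.germ_res_apply _ _ _ _).trans (Eq.trans ?_
        (W.presheaf.germ_res_apply _ _ _ _).symm)
      exact hg a b y hy.1 hy.2)
  exact ⟨s, hs⟩

lemma app_res (j : J ⟶ W) (U : W.Opens) (h : Γ(W, ⊤)) :
    j.app U (res U h) = res (j ⁻¹ᵁ U) (j.appTop h) := by
  have := j.naturality (homOfLE (le_top : U ≤ ⊤)).op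
  exact congr($this h)

lemma exists_affineOpen_mem (w : W) : ∃ U : W.affineOpens, w ∈ U.1 := by
  obtain ⟨_, ⟨U, hU, rfl⟩, hxU, -⟩ :=
    W.isBasis_affineOpens.exists_subset_of_mem_open (Set.mem_univ w) isOpen_univ
  exact ⟨⟨U, hU⟩, hxU⟩

/-- The functions `f i` are the coordinates of a smooth morphism to an affine space over `k`. -/
def SmoothCoordinates (k : Type u) [Field k] (f : ι → Γ(W, ⊤)) : Prop :=
  ∀ U : W.affineOpens, ∃ θ : MvPolynomial ι k →+* Γ(W, U), θ.Smooth ∧ ∀ i, θ (.X i) = res U.1 (f i)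

/-- The ideal sheaf generated by the `f i` with `i ∉ S`. -/
def cutIdeal (f : ι → Γ(W, ⊤)) (S : Set ι) : W.IdealSheafData :=
  .ofIdealTop (Ideal.span (f '' Sᶜ))

/-- The closed subscheme where the `f i` with `i ∉ S` vanish. -/
structure IsCut (f : ι → Γ(W, ⊤)) (S : Set ι) (j : J ⟶ W) : Prop where
  isClosedImmersion : IsClosedImmersion j
  ker_eq : j.ker = cutIdeal f S

lemma cutIdeal_ideal (f : ι → Γ(W, ⊤)) (S : Set ι) (U : W.affineOpens) :
    (cutIdeal f S).ideal U = Ideal.span ((fun i => res U.1 (f i)) '' Sᶜ) := by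
  rw [cutIdeal, Scheme.IdealSheafData.ofIdealTop_ideal, Ideal.map_span, Set.image_image]

lemma cutIdeal_le_iff (f : ι → Γ(W, ⊤)) (S : Set ι) (j : J ⟶ W) :
    cutIdeal f S ≤ j.ker ↔ ∀ i ∉ S, j.appTop (f i) = 0 := by
  rw [Scheme.Hom.ker, Scheme.IdealSheafData.le_ofIdeals_iff]
  refine ⟨fun h i hi => eq_zero_of_forall_exists_res_eq_zero _ fun y => ?_, fun h U => ?_⟩
  · obtain ⟨U, hU⟩ := exists_affineOpen_mem (j y)
    refine ⟨j ⁻¹ᵁ U.1, hU, ?_⟩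
    rw [← app_res]
    have := h U
    rw [cutIdeal_ideal, Ideal.span_le] at this
    exact this ⟨i, hi, rfl⟩
  · rw [cutIdeal_ideal, Ideal.span_le]
    rintro _ ⟨i, hi, rfl⟩
    change j.app U.1 _ = 0
    rw [app_res, h i hi, map_zero]

lemma mem_support_cutIdeal (f : ι → Γ(W, ⊤)) (S : Set ι) (w : W) :
    w ∈ (cutIdeal f S).support ↔ ∀ i ∉ S, w ∉ W.basicOpen (f i) := by
  rw [← SetLike.mem_coe, cutIdeal, Scheme.IdealSheafData.coe_support_ofIdealTop,
    Scheme.zeroLocus_span, Scheme.mem_zeroLocus_iff, Set.forall_mem_image]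
  rfl

lemma isCut_subschemeι (f : ι → Γ(W, ⊤)) (S : Set ι) : IsCut f S (cutIdeal f S).subschemeι :=
  ⟨inferInstance, Scheme.IdealSheafData.ker_subschemeι _⟩

lemma isCut_univ (f : ι → Γ(W, ⊤)) : IsCut f Set.univ (𝟙 W) := by
  refine ⟨inferInstance, ?_⟩
  rw [Scheme.Hom.ker_eq_bot_of_isIso]
  refine Scheme.IdealSheafData.ext ?_
  ext1 U
  rw [cutIdeal_ideal]
  simp

lemma IsCut.restrict {f : ι → Γ(W, ⊤)} {S : Set ι} {j : J ⟶ W} (h : IsCut f S j) (U : W.Opens) :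
    IsCut (fun i => U.ι.appTop (f i)) S (j ∣_ U) := by
  have := h.isClosedImmersion
  refine ⟨inferInstance, Scheme.IdealSheafData.ext ?_⟩
  ext1 V
  rw [Scheme.ker_morphismRestrict_ideal, h.ker_eq, cutIdeal_ideal, cutIdeal_ideal]
  congr 1
  refine Set.image_congr fun i _ => ?_
  simp only [res, Scheme.Opens.ι_appTop]
  exact congr($(W.presheaf.map_comp (homOfLE (le_top : U.ι ''ᵁ ⊤ ≤ ⊤)).op
    (homOfLE (U.ι.image_mono le_top : U.ι ''ᵁ V.1 ≤ U.ι ''ᵁ ⊤)).op) (f i))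

lemma IsCut.appTop_eq_zero {f : ι → Γ(W, ⊤)} {S : Set ι} {j : J ⟶ W} (h : IsCut f S j) {i : ι}
    (hi : i ∉ S) : j.appTop (f i) = 0 :=
  (cutIdeal_le_iff f S j).1 h.ker_eq.ge i hi

lemma IsCut.exists_lift {f : ι → Γ(W, ⊤)} {S : Set ι} {j : J ⟶ W} (h : IsCut f S j) {T : Scheme.{u}}
    (t : T ⟶ W) (ht : ∀ i ∉ S, t.appTop (f i) = 0) : ∃ t' : T ⟶ J, t' ≫ j = t := by
  have := h.isClosedImmersion
  have H : j.ker ≤ t.ker := by rw [h.ker_eq, cutIdeal_le_iff]; exact ht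
  exact ⟨IsClosedImmersion.lift j t H, IsClosedImmersion.lift_fac _ _ _⟩

lemma IsCut.range_eq {f : ι → Γ(W, ⊤)} {S : Set ι} {j : J ⟶ W} (h : IsCut f S j) :
    Set.range j = {w | ∀ i ∉ S, w ∉ W.basicOpen (f i)} := by
  have := h.isClosedImmersion
  have h1 := j.support_ker
  rw [h.ker_eq, j.isClosedEmbedding.isClosed_range.closure_eq] at h1
  ext w
  rw [← h1]
  exact mem_support_cutIdeal f S w

lemma IsCut.ker_app {f : ι → Γ(W, ⊤)} {S : Set ι} {j : J ⟶ W} (h : IsCut f S j)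
    (U : W.affineOpens) :
    RingHom.ker (j.app U.1).hom = Ideal.span ((fun i => res U.1 (f i)) '' Sᶜ) := by
  have := h.isClosedImmersion
  rw [← cutIdeal_ideal, ← h.ker_eq, Scheme.Hom.ker_apply]

/-- This is `smooth_cut` at the prime of the point `j y`; it provides both the reducedness and the
local irreducibility of cuts. -/
lemma SmoothCoordinates.exists_isDomain {k : Type u} [Field k] {f : ι → Γ(W, ⊤)}
    (hf : SmoothCoordinates k f) {S : Set ι} {j : J ⟶ W} (h : IsCut f S j) (y : J) :
    ∃ V : J.affineOpens, y ∈ V.1 ∧ IsDomain Γ(J, V.1) := by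
  have := h.isClosedImmersion
  obtain ⟨U, hU⟩ := exists_affineOpen_mem (j y)
  obtain ⟨θ, hθ, hθf⟩ := hf U
  let P : Ideal Γ(W, U.1) :=
    (IsLocalRing.maximalIdeal (W.presheaf.stalk (j y))).comap (W.presheaf.germ U.1 (j y) hU).hom
  have hP : ∀ b : Γ(W, U.1), b ∉ P ↔ j y ∈ W.basicOpen b := by
    intro b
    rw [Scheme.mem_basicOpen _ _ _ hU, Ideal.mem_comap, IsLocalRing.mem_maximalIdeal,
      mem_nonunits_iff, not_not]
  have hK := h.ker_app U
  simp only [← hθf] at hK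
  obtain ⟨s, hs, hdom⟩ := (smooth_cut θ hθ S).2 P (by
    rw [← hK]
    intro b hb
    by_contra hbP
    rw [hP] at hbP
    have : y ∈ j ⁻¹ᵁ W.basicOpen b := hbP
    rw [Scheme.preimage_basicOpen, RingHom.mem_ker.1 hb] at this
    simp at this)
  have hsurj : Function.Surjective (j.app U.1) := j.app_surjective U.1 U.2
  have hV : IsAffineOpen (j ⁻¹ᵁ U.1) := U.2.preimage j
  have hy : y ∈ J.basicOpen (j.app U.1 s) := by
    rw [← Scheme.preimage_basicOpen]
    exact (hP s).1 hs
  refine ⟨⟨J.basicOpen (j.app U.1 s), hV.basicOpen _⟩, hy, ?_⟩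
  have hdom' : IsDomainAway (j.app U.1 s) := by
    intro a b hab
    obtain ⟨a, rfl⟩ := hsurj a
    obtain ⟨b, rfl⟩ := hsurj b
    have key : ∀ x : Γ(W, U.1), Ideal.Quotient.mk (Ideal.span ((fun i => θ (.X i)) '' Sᶜ)) x = 0 ↔
        j.app U.1 x = 0 := by
      intro x
      rw [Ideal.Quotient.eq_zero_iff_mem, ← hK]
      rfl
    have := hdom (Ideal.Quotient.mk _ a) (Ideal.Quotient.mk _ b)
      (by rw [← map_mul, key, map_mul]; exact hab)
    simpa only [← map_pow, ← map_mul, key] using this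
  have hloc := hV.isLocalization_basicOpen (j.app U.1 s)
  have hnt : Nontrivial Γ(J, J.basicOpen (j.app U.1 s)) :=
    (J.presheaf.germ _ y hy).hom.domain_nontrivial
  have hnz : NoZeroDivisors Γ(J, J.basicOpen (j.app U.1 s)) := by
    refine ⟨fun {a b} hab => ?_⟩
    obtain ⟨⟨x, t⟩, hx⟩ := IsLocalization.surj (Submonoid.powers (j.app U.1 s)) a
    obtain ⟨⟨x', t'⟩, hx'⟩ := IsLocalization.surj (Submonoid.powers (j.app U.1 s)) b
    simp only at hx hx'
    have h1 : algebraMap Γ(J, j ⁻¹ᵁ U.1) Γ(J, J.basicOpen (j.app U.1 s)) (x * x') = 0 := by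
      rw [map_mul, ← hx, ← hx', mul_mul_mul_comm, hab, zero_mul]
    rw [IsLocalization.map_eq_zero_iff (Submonoid.powers (j.app U.1 s))] at h1
    obtain ⟨⟨_, n, rfl⟩, hn⟩ := h1
    have key : ∀ z : Γ(J, j ⁻¹ᵁ U.1), (∃ n, j.app U.1 s ^ n * z = 0) →
        algebraMap Γ(J, j ⁻¹ᵁ U.1) Γ(J, J.basicOpen (j.app U.1 s)) z = 0 := by
      rintro z ⟨n, hn⟩
      rw [IsLocalization.map_eq_zero_iff (Submonoid.powers (j.app U.1 s))]
      exact ⟨⟨_, n, rfl⟩, hn⟩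
    simp only [← mul_assoc] at hn
    rcases hdom' _ _ hn with ⟨m, hm⟩ | hx0
    · left
      rw [← mul_assoc, ← pow_add] at hm
      have := key x ⟨_, hm⟩
      rw [this] at hx
      exact ((IsLocalization.map_units _ t).mul_left_eq_zero).1 hx
    · right
      have := key x' hx0
      rw [this] at hx'
      exact ((IsLocalization.map_units _ t').mul_left_eq_zero).1 hx'
  exact NoZeroDivisors.to_isDomain _

lemma isReduced_of_exists_isReduced
    (H : ∀ y : J, ∃ V : J.affineOpens, y ∈ V.1 ∧ _root_.IsReduced Γ(J, V.1)) : IsReduced J := by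
  have : ∀ y : J, _root_.IsReduced (J.presheaf.stalk y) := by
    intro y
    obtain ⟨V, hy, hV⟩ := H y
    let := J.presheaf.algebra_section_stalk ⟨y, hy⟩
    have := V.2.isLocalization_stalk ⟨y, hy⟩
    exact isReduced_localizationPreserves (V.2.primeIdealOf ⟨y, hy⟩).asIdeal.primeCompl
      (J.presheaf.stalk y) inferInstance
  exact isReduced_of_isReduced_stalk J

lemma isReduced_of_exists_isDomain
    (H : ∀ y : J, ∃ V : J.affineOpens, y ∈ V.1 ∧ IsDomain Γ(J, V.1)) : IsReduced J :=
  isReduced_of_exists_isReduced fun y =>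
    let ⟨V, hy, _⟩ := H y
    ⟨V, hy, inferInstance⟩

lemma exists_isPreirreducible_of_exists_isDomain
    (H : ∀ y : J, ∃ V : J.affineOpens, y ∈ V.1 ∧ IsDomain Γ(J, V.1)) (y : J) :
    ∃ V : J.Opens, y ∈ V ∧ IsPreirreducible (V : Set J) := by
  obtain ⟨V, hy, hV⟩ := H y
  refine ⟨V.1, hy, ?_⟩
  have h1 : IsAffine V.1 := V.2
  have h2 : Nonempty V.1 := ⟨⟨y, hy⟩⟩
  have h3 : IsDomain Γ(V.1, ⊤) := V.1.topIso.commRingCatIsoToRingEquiv.symm.isDomain_iff.1 hV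
  have h4 := isIntegral_of_isAffine_of_isDomain V.1
  have h5 : IrreducibleSpace V.1 := inferInstance
  have h6 := (PreirreducibleSpace.isPreirreducible_univ (X := V.1)).image V.1.ι
    V.1.ι.continuous.continuousOn
  rwa [Set.image_univ, Scheme.Opens.range_ι] at h6

/-- The germs of `f` are not zero divisors. -/
def IsRegularFn (f : Γ(J, ⊤)) : Prop :=
  ∀ y : J, J.presheaf.germ ⊤ y trivial f ∈ nonZeroDivisors (J.presheaf.stalk y)

lemma IsRegularFn.eq_zero {f h : Γ(J, ⊤)} (hf : IsRegularFn f) (H : f * h = 0) : h = 0 := by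
  refine eq_zero_of_forall_germ_eq_zero h fun y => ?_
  refine (mul_left_mem_nonZeroDivisors_eq_zero_iff (hf y)).1 ?_
  rw [← map_mul, H, map_zero]

lemma IsRegularFn.pow {f : Γ(J, ⊤)} (hf : IsRegularFn f) (n : ℕ) : IsRegularFn (f ^ n) := fun y => by
  rw [map_pow]; exact pow_mem (hf y) n

lemma IsRegularFn.prod {α : Type*} (s : Finset α) {f : α → Γ(J, ⊤)}
    (hf : ∀ a ∈ s, IsRegularFn (f a)) : IsRegularFn (∏ a ∈ s, f a) := fun y => by
  rw [map_prod]; exact prod_mem fun a ha => hf a ha y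

/-- The maps on stalks are flat, and flat maps preserve non-zero-divisors. -/
lemma IsRegularFn.of_flat {T : Scheme.{u}} (t : T ⟶ J) [Flat t] {f : Γ(J, ⊤)} (hf : IsRegularFn f) :
    IsRegularFn (t.appTop f) := by
  intro y
  have h1 : T.presheaf.germ ⊤ y trivial (t.appTop f) =
      t.stalkMap y (J.presheaf.germ ⊤ (t y) trivial f) :=
    (t.germ_stalkMap_apply ⊤ y trivial f).symm
  rw [h1]
  have h2 := Flat.stalkMap t y
  let := (t.stalkMap y).hom.toAlgebra
  have h3 : Module.Flat (J.presheaf.stalk (t y)) (T.presheaf.stalk y) := h2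
  rw [mem_nonZeroDivisors_iff_left]
  intro x hx
  refine Module.Flat.isSMulRegular_of_nonZeroDivisors (hf (t y)) (?_ : _ • x = _ • (0 : _))
  rw [smul_zero, Algebra.smul_def]
  exact hx

lemma SmoothCoordinates.isRegularFn {k : Type u} [Field k] {f : ι → Γ(W, ⊤)}
    (hf : SmoothCoordinates k f) {S : Set ι} {j : J ⟶ W} (h : IsCut f S j) {i : ι} (hi : i ∈ S) :
    IsRegularFn (j.appTop (f i)) := by
  intro y
  have := h.isClosedImmersion
  obtain ⟨U, hU⟩ := exists_affineOpen_mem (j y)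
  obtain ⟨θ, hθ, hθf⟩ := hf U
  have hK := h.ker_app U
  simp only [← hθf] at hK
  have hreg := (smooth_cut θ hθ S).1 i hi
  have hsurj : Function.Surjective (j.app U.1) := j.app_surjective U.1 U.2
  have hV : IsAffineOpen (j ⁻¹ᵁ U.1) := U.2.preimage j
  have hnz : res (j ⁻¹ᵁ U.1) (j.appTop (f i)) ∈ nonZeroDivisors Γ(J, j ⁻¹ᵁ U.1) := by
    rw [mem_nonZeroDivisors_iff_left]
    intro x hx
    obtain ⟨b, rfl⟩ := hsurj x
    rw [← app_res, ← hθf] at hx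
    have := hreg b (by rw [← hK, RingHom.mem_ker, map_mul]; exact hx)
    rw [← hK] at this
    exact this
  have hyV : y ∈ j ⁻¹ᵁ U.1 := hU
  let := J.presheaf.algebra_section_stalk ⟨y, hyV⟩
  have := hV.isLocalization_stalk ⟨y, hyV⟩
  rw [← germ_res_apply (j ⁻¹ᵁ U.1) y hyV]
  exact IsLocalization.map_nonZeroDivisors_le (hV.primeIdealOf ⟨y, hyV⟩).asIdeal.primeCompl
    (J.presheaf.stalk y) ⟨_, hnz, rfl⟩

/-- Divisibility by a regular function is a local property. -/
lemma IsRegularFn.dvd_of_local {f h : Γ(J, ⊤)} (hf : IsRegularFn f)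
    (H : ∀ y : J, ∃ V : J.Opens, y ∈ V ∧ res V f ∣ res V h) : f ∣ h := by
  choose V hV g hg using H
  -- Regularity makes the local quotients unique, so they glue.
  obtain ⟨s, hs⟩ := exists_gluing V (fun y => ⟨y, hV y⟩) g (by
    intro a b y ha hb
    refine sub_eq_zero.1 ((mul_left_mem_nonZeroDivisors_eq_zero_iff (hf y)).1 ?_)
    rw [mul_sub]
    nth_rewrite 1 [← germ_res_apply (V a) y ha]
    rw [← germ_res_apply (V b) y hb, ← map_mul, ← map_mul, ← hg, ← hg, germ_res_apply,
      germ_res_apply, sub_self])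
  refine ⟨s, ?_⟩
  rw [← sub_eq_zero]
  refine eq_zero_of_forall_exists_res_eq_zero _ fun y => ⟨V y, hV y, ?_⟩
  rw [map_sub, map_mul, sub_eq_zero, hg y, hs y]

/-- On affine opens the ideal of the smaller cut is generated by `f i` together with the ideal of
the larger one. -/
lemma IsCut.dvd_of_appTop_eq_zero {k : Type u} [Field k] {f : ι → Γ(W, ⊤)}
    (hf : SmoothCoordinates k f) {S : Set ι} {j : J ⟶ W} (h : IsCut f S j) {i : ι} (hi : i ∈ S)
    {J' : Scheme.{u}} {j' : J' ⟶ W} (h' : IsCut f (S \ {i}) j') (r : J' ⟶ J) (hr : r ≫ j = j')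
    (a : Γ(J, ⊤)) (ha : r.appTop a = 0) : j.appTop (f i) ∣ a := by
  have := h.isClosedImmersion
  refine (hf.isRegularFn h hi).dvd_of_local fun y => ?_
  obtain ⟨U, hU⟩ := exists_affineOpen_mem (j y)
  refine ⟨j ⁻¹ᵁ U.1, hU, ?_⟩
  obtain ⟨b, hb⟩ := j.app_surjective U.1 U.2 (res (j ⁻¹ᵁ U.1) a)
  have h1 : b ∈ RingHom.ker (j'.app U.1).hom := by
    subst hr
    rw [RingHom.mem_ker, Scheme.Hom.comp_app]
    change r.app _ (j.app U.1 b) = 0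
    rw [hb, app_res, ha, map_zero]
  have hS : (S \ {i})ᶜ = insert i Sᶜ := by
    ext l; by_cases hl : l = i <;> simp [hl]
  rw [h'.ker_app, hS, Set.image_insert_eq, Ideal.mem_span_insert, ← h.ker_app] at h1
  obtain ⟨c, z, hz, rfl⟩ := h1
  rw [← hb, map_add, map_mul, app_res, show j.app U.1 z = 0 from hz, add_zero]
  exact dvd_mul_left _ _

end Cuts

/-! ### Smoothness of the upper left entries -/

section SmoothEntries

variable {k : Type u} [Field k] {ι : Type}

lemma smoothCoordinates_mat [Finite ι] {W : KSch k} (g : W ⟶ GSch k ι) (hg : Smooth g.left) :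
    SmoothCoordinates (W := W.left) k fun i => (mat g i 0 0 : Γ(W.left, ⊤)) := by
  intro U
  have h1 : (g.left.appLE ⊤ U.1 le_top).hom.Smooth :=
    hg.smooth_appLE (isAffineOpen_top (Spec (CommRingCat.of (CoordRing k ι)))) U.2 le_top
  have h2 : ((Scheme.ΓSpecIso (CommRingCat.of (CoordRing k ι))).inv.hom).Smooth := by
    refine RingHom.Smooth.of_bijective ?_
    exact ConcreteCategory.bijective_of_isIso (Scheme.ΓSpecIso (CommRingCat.of (CoordRing k ι))).inv
  refine ⟨(g.left.appLE ⊤ U.1 le_top).hom.comp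
    ((Scheme.ΓSpecIso (CommRingCat.of (CoordRing k ι))).inv.hom.comp
      (upperLeft k ι : MvPolynomial ι k →+* CoordRing k ι)), ?_, fun i => ?_⟩
  · exact RingHom.Smooth.comp (RingHom.Smooth.comp (upperLeft_smooth k ι) h2) h1
  · have h3 : upperLeft k ι (.X i) = genericPt k ι i 0 0 := by simp [upperLeft]
    have h4 : ∀ a, g.left.appLE ⊤ U.1 le_top a = res U.1 (g.left.appTop a) := by
      exact fun a => rfl
    refine (h4 _).trans (congrArg (fun a => res U.1 (g.left.appTop
      ((Scheme.ΓSpecIso (CommRingCat.of (CoordRing k ι))).inv a))) h3)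

lemma SmoothCoordinates.restrict {W : Scheme.{u}} {f : ι → Γ(W, ⊤)} (hf : SmoothCoordinates k f)
    (U : W.Opens) : SmoothCoordinates k fun i => U.ι.appTop (f i) := by
  intro V
  obtain ⟨θ, hθ, h⟩ := hf ⟨U.ι ''ᵁ V.1, V.2.image_of_isOpenImmersion _⟩
  refine ⟨θ, hθ, fun i => (h i).trans ?_⟩
  simp only [res, Scheme.Opens.ι_appTop]
  exact congr($(W.presheaf.map_comp (homOfLE (le_top : U.ι ''ᵁ ⊤ ≤ ⊤)).op
    (homOfLE (U.ι.image_mono le_top : U.ι ''ᵁ V.1 ≤ U.ι ''ᵁ ⊤)).op) (f i))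

end SmoothEntries

/-! ### Subschemes of the torsor that are stable under the zip group -/

section Stable

variable {k : Type u} [Field k] {ι : Type} {p : ℕ} {σ : Equiv.Perm ι} {X : KSch k}

namespace ZipMorphism

variable (ζ : ZipMorphism p σ X)

/-- The upper left entries, as functions on the torsor. -/
def entry (i : ι) : Γ(ζ.I.left, ⊤) := mat ζ.q i 0 0

/-- The graph of the action of the zip group, restricted to `J`. -/
def actRel {J : KSch k} (j : J ⟶ ζ.I) (T : KSch k) (e : zipGroup p σ (Fn T)) (z z' : T ⟶ J) : Prop :=
  ζ.act e (z ≫ j) = z' ≫ j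

/-- A monomorphism to the torsor with image stable under the zip group. -/
structure IsStable {J : KSch k} (j : J ⟶ ζ.I) : Prop where
  mono : Mono j
  injective : Function.Injective j.left
  exists_lift : ∀ {T : KSch k} (z : T ⟶ J) (w : T ⟶ ζ.I), w ≫ ζ.π = z ≫ j ≫ ζ.π →
    ∃ w' : T ⟶ J, w' ≫ j = w

variable {ζ}

lemma isCompatible_actRel [Fintype ι] {J : KSch k} (j : J ⟶ ζ.I) :
    IsCompatible (ζ.actRel j) (j ≫ ζ.q) := by
  intro T e z z' h
  rw [← Category.assoc, ← Category.assoc, ← (h : ζ.act e (z ≫ j) = z' ≫ j), ζ.act_q]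

/-- The universal pair of points of `J` in the same orbit. -/
lemma IsStable.exists_universal {J : KSch k} {j : J ⟶ ζ.I} (hj : ζ.IsStable j) :
    ∃ (T : KSch k) (z w : T ⟶ J) (e : zipGroup p σ (Fn T)), Flat z.left ∧ ζ.actRel j T e z w ∧
      (∀ (T' : KSch k) (e' : zipGroup p σ (Fn T')) (z' w' : T' ⟶ J), ζ.actRel j T' e' z' w' →
        ∃ t : T' ⟶ T, t ≫ z = z' ∧ t ≫ w = w' ∧ zipGroupMap (pull t) e = e') ∧
      ∀ y y' : J.left, ζ.π.left (j.left y) = ζ.π.left (j.left y') →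
        ∃ t : T.left, z.left t = y ∧ w.left t = y' := by
  have := hj.mono
  have := ζ.flat
  -- The universal pair is J ×_X I, flat over J because π is flat. Stability brings its second
  -- projection into J, and simple transitivity supplies the group element.
  let T : KSch k := Over.mk (Limits.pullback.fst (j ≫ ζ.π).left ζ.π.left ≫ J.hom)
  let z : T ⟶ J := Over.homMk (Limits.pullback.fst (j ≫ ζ.π).left ζ.π.left) rfl
  let v : T ⟶ ζ.I := Over.homMk (Limits.pullback.snd (j ≫ ζ.π).left ζ.π.left) (by
    have := Limits.pullback.condition (f := (j ≫ ζ.π).left) (g := ζ.π.left)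
    simp only [T, Over.mk_hom, ← Over.w ζ.π, ← Over.w (j ≫ ζ.π)]
    rw [reassoc_of% this])
  have hv : v ≫ ζ.π = z ≫ j ≫ ζ.π := by
    ext1
    exact Limits.pullback.condition.symm
  obtain ⟨w, hw⟩ := hj.exists_lift z v hv
  obtain ⟨e, he, heu⟩ := ζ.simply_transitive (z ≫ j) (w ≫ j) (by rw [hw, hv, Category.assoc])
  refine ⟨T, z, w, e, ?_, he, ?_, ?_⟩
  · change Flat (Limits.pullback.fst (j ≫ ζ.π).left ζ.π.left)
    infer_instance
  · intro T' e' z' w' h'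
    have hπ : z' ≫ j ≫ ζ.π = (w' ≫ j) ≫ ζ.π := by
      rw [← (h' : ζ.act e' (z' ≫ j) = w' ≫ j), ζ.act_π, Category.assoc]
    let t : T' ⟶ T := Over.homMk (Limits.pullback.lift z'.left (w' ≫ j).left (by
      exact congrArg CommaMorphism.left hπ)) (by
        simp only [T, Over.mk_hom, Limits.pullback.lift_fst_assoc]
        exact Over.w z')
    have tz : t ≫ z = z' := by
      ext1
      exact Limits.pullback.lift_fst _ _ _
    have tv : t ≫ v = w' ≫ j := by
      ext1
      exact Limits.pullback.lift_snd _ _ _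
    refine ⟨t, tz, ?_, ?_⟩
    · rw [← cancel_mono j, Category.assoc, hw, tv]
    · refine (ζ.simply_transitive (z' ≫ j) (w' ≫ j) (by rw [← hπ, Category.assoc])).unique ?_ h'
      have := ζ.act_natural t e (z ≫ j)
      rw [he, hw, tv, ← Category.assoc, tz] at this
      exact this.symm
  · intro y y' hyy
    obtain ⟨t, h1, h2⟩ := Scheme.Pullback.exists_preimage_pullback
      (f := (j ≫ ζ.π).left) (g := ζ.π.left) y (j.left y') hyy
    refine ⟨t, h1, hj.injective ?_⟩
    rw [← h2, ← Scheme.Hom.comp_apply, ← Over.comp_left, hw]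
    rfl

/-- Regularity may be lost under arbitrary base change. So the factor is cancelled on the universal
pair, which is flat over `J`, and the identity is pulled back from there. -/
lemma IsStable.isSection_of_mul [Fintype ι] {J : KSch k} {j : J ⟶ ζ.I} (hj : ζ.IsStable j)
    {lam mu : ι → ℤ} {f h : Fn J} (hf : IsSection p σ J (ζ.actRel j) lam f)
    (hreg : IsRegularFn (J := J.left) f)
    (hfh : IsSection p σ J (ζ.actRel j) (lam + mu) (f * h)) :
    IsSection p σ J (ζ.actRel j) mu h := by
  obtain ⟨T, z, w, e, hz, he, huniv, -⟩ := hj.exists_universal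
  have key : pull w h = (character mu e : Fn T) * pull z h := by
    have h1 := hf T e z w he
    have h2 := hfh T e z w he
    rw [map_mul, map_mul, h1, character_add, Units.val_mul] at h2
    have hreg' : IsRegularFn (J := T.left) (pull z f) := hreg.of_flat z.left
    have h3 : pull z f * ((character lam e : Fn T) *
        (pull w h - (character mu e : Fn T) * pull z h)) = 0 := by
      linear_combination h2
    have h4 := hreg'.eq_zero h3
    exact sub_eq_zero.1 ((Units.mul_right_eq_zero _).1 h4)
  intro T' e' z' w' h'
  obtain ⟨t, rfl, rfl, rfl⟩ := huniv T' e' z' w' h'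
  rw [pull_comp, pull_comp, key, map_mul, character_map]
  rfl

/-- The two pullbacks of a section to the universal pair differ by a unit, hence have the same
non-vanishing locus. -/
lemma IsStable.mem_basicOpen_of_isSection [Fintype ι] {J : KSch k} {j : J ⟶ ζ.I}
    (hj : ζ.IsStable j) {lam : ι → ℤ} {f : Γ(J.left, ⊤)} (hf : IsSection p σ J (ζ.actRel j) lam f)
    {y y' : J.left} (hyy : ζ.π.left (j.left y) = ζ.π.left (j.left y'))
    (hy : y ∈ J.left.basicOpen f) : y' ∈ J.left.basicOpen f := by
  obtain ⟨T, z, w, e, hz, he, -, hpt⟩ := hj.exists_universal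
  obtain ⟨t, rfl, rfl⟩ := hpt y y' hyy
  have h1 : t ∈ z.left ⁻¹ᵁ J.left.basicOpen f := hy
  change t ∈ w.left ⁻¹ᵁ J.left.basicOpen f
  rw [Scheme.preimage_basicOpen_top] at h1 ⊢
  have h2 : w.left.appTop f = (character lam e : Fn T) * z.left.appTop f := hf T e z w he
  have h3 : T.left.basicOpen (w.left.appTop f) = T.left.basicOpen (z.left.appTop f) := by
    rw [h2, Scheme.basicOpen_mul, Scheme.basicOpen_of_isUnit _ (Units.isUnit _)]
    simp
  exact h3 ▸ h1

variable (ζ) in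
/-- A union of fibres of `π`. -/
def IsSaturated (A : Set ζ.I.left) : Prop :=
  ∀ y y', ζ.π.left y = ζ.π.left y' → y ∈ A → y' ∈ A

variable (ζ) in
/-- `j` is the closed immersion into the open `O` that is defined by the vanishing of the entries
with index outside `S`. -/
def IsCutOn (O : ζ.I.left.Opens) (S : Finset ι) {J : KSch k} (j : J ⟶ ζ.I) : Prop :=
  ∃ j' : J.left ⟶ O, j' ≫ O.ι = j.left ∧ IsCut (fun i => O.ι.appTop (ζ.entry i)) S j'

lemma isSection_entry [Fintype ι] [DecidableEq ι] {J : KSch k} (j : J ⟶ ζ.I) (i : ι) :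
    IsSection p σ J (ζ.actRel j) (hasseWeight p σ i) (pull j (ζ.entry i)) := by
  have := (isCompatible_actRel (ζ := ζ) j).isSection_upperLeft i
  rwa [mat_comp] at this

lemma IsCutOn.pull_entry_eq_zero {O : ζ.I.left.Opens} {S : Finset ι} {J : KSch k} {j : J ⟶ ζ.I}
    (hj : ζ.IsCutOn O S j) {i : ι} (hi : i ∉ S) : pull j (ζ.entry i) = 0 := by
  obtain ⟨j', h1, h2⟩ := hj
  have := h2.appTop_eq_zero (i := i) hi
  rw [pull, ← h1, Scheme.Hom.comp_appTop]
  exact this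

lemma IsCutOn.exists_lift {O : ζ.I.left.Opens} {S : Finset ι} {J : KSch k} {j : J ⟶ ζ.I}
    (hj : ζ.IsCutOn O S j) {T : KSch k} (w : T ⟶ ζ.I) (hw : ∀ t, w.left t ∈ O)
    (hw' : ∀ i ∉ S, pull w (ζ.entry i) = 0) : ∃ w' : T ⟶ J, w' ≫ j = w := by
  obtain ⟨j', h1, h2⟩ := hj
  have hO : Set.range w.left ⊆ Set.range O.ι := by
    rw [Scheme.Opens.range_ι]
    rintro _ ⟨t, rfl⟩
    exact hw t
  obtain ⟨v, hv⟩ := h2.exists_lift (IsOpenImmersion.lift O.ι w.left hO) (by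
    intro i hi
    have := hw' i hi
    rw [pull, ← IsOpenImmersion.lift_fac O.ι w.left hO, Scheme.Hom.comp_appTop] at this
    exact this)
  have hvj : v ≫ j.left = w.left := by
    rw [← h1, reassoc_of% hv, IsOpenImmersion.lift_fac]
  refine ⟨Over.homMk v ?_, ?_⟩
  · rw [← Over.w j, reassoc_of% hvj, Over.w w]
  · ext1
    exact hvj

lemma IsCutOn.mem {O : ζ.I.left.Opens} {S : Finset ι} {J : KSch k} {j : J ⟶ ζ.I}
    (hj : ζ.IsCutOn O S j) (y : J.left) : j.left y ∈ O := by
  obtain ⟨j', h1, h2⟩ := hj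
  rw [← h1, Scheme.Hom.comp_apply]
  exact (j' y).2

/-- The entries are multiplied by units under the action, so their vanishing propagates along
orbits. -/
lemma IsCutOn.isStable [Fintype ι] {O : ζ.I.left.Opens} (hO : ζ.IsSaturated O) {S : Finset ι}
    {J : KSch k} {j : J ⟶ ζ.I} (hj : ζ.IsCutOn O S j) : ζ.IsStable j := by
  classical
  have hmono : Mono j.left ∧ Function.Injective j.left := by
    obtain ⟨j', h1, h2⟩ := hj
    have := h2.isClosedImmersion
    rw [← h1]
    refine ⟨inferInstance, ?_⟩
    rw [Scheme.Hom.comp_base]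
    exact O.ι.injective.comp j'.injective
  refine ⟨⟨fun a b hab => ?_⟩, hmono.2, fun {T} z w hw => ?_⟩
  · ext1
    have := hmono.1
    rw [← cancel_mono j.left, ← Over.comp_left, hab, Over.comp_left]
  · obtain ⟨e, he, -⟩ := ζ.simply_transitive (z ≫ j) w (by rw [hw, Category.assoc])
    refine hj.exists_lift w (fun t => ?_) fun i hi => ?_
    · refine hO (j.left (z.left t)) _ ?_ (hj.mem _)
      have := congrArg (fun φ => φ.left t) hw
      exact this.symm
    · have h1 := isSection_entry (ζ := ζ) (𝟙 ζ.I) i T e (z ≫ j) w (by simpa [actRel] using he)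
      rw [pull_id, pull_comp, hj.pull_entry_eq_zero hi, map_zero, mul_zero] at h1
      exact h1

lemma IsCutOn.range_eq {O : ζ.I.left.Opens} {S : Finset ι} {J : KSch k} {j : J ⟶ ζ.I}
    (hj : ζ.IsCutOn O S j) :
    Set.range j.left = {y | y ∈ O ∧ ∀ i ∉ S, y ∉ ζ.I.left.basicOpen (ζ.entry i)} := by
  obtain ⟨j', h1, h2⟩ := hj
  have h3 := h2.range_eq
  have h4 : ∀ (y : O) i, y ∈ O.toScheme.basicOpen (O.ι.appTop (ζ.entry i)) ↔
      y.1 ∈ ζ.I.left.basicOpen (ζ.entry i) := by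
    intro y i
    rw [← Scheme.preimage_basicOpen_top]
    rfl
  ext y
  rw [← h1]
  constructor
  · rintro ⟨x, rfl⟩
    have h5 : j' x ∈ Set.range j' := ⟨x, rfl⟩
    rw [h3] at h5
    exact ⟨(j' x).2, fun i hi hy => h5 i hi ((h4 _ i).2 hy)⟩
  · rintro ⟨hy, hyi⟩
    have h5 : (⟨y, hy⟩ : O) ∈ Set.range j' := by
      rw [h3]
      exact fun i hi h => hyi i hi ((h4 _ i).1 h)
    obtain ⟨x, hx⟩ := h5
    refine ⟨x, ?_⟩
    rw [Scheme.Hom.comp_apply, hx]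
    rfl

lemma IsCutOn.isEmbedding {O : ζ.I.left.Opens} {S : Finset ι} {J : KSch k} {j : J ⟶ ζ.I}
    (hj : ζ.IsCutOn O S j) : Topology.IsEmbedding j.left := by
  obtain ⟨j', h1, h2⟩ := hj
  have := h2.isClosedImmersion
  rw [← h1, Scheme.Hom.comp_base]
  exact O.ι.isOpenEmbedding.isEmbedding.comp j'.isClosedEmbedding.isEmbedding

lemma exists_isCutOn (ζ : ZipMorphism p σ X) (O : ζ.I.left.Opens) (S : Finset ι) :
    ∃ (J : KSch k) (j : J ⟶ ζ.I), ζ.IsCutOn O S j := by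
  let c := (cutIdeal (fun i => O.ι.appTop (ζ.entry i)) (S : Set ι)).subschemeι
  exact ⟨Over.mk (c ≫ O.ι ≫ ζ.I.hom), Over.homMk (c ≫ O.ι) (Category.assoc _ _ _), c, rfl,
    isCut_subschemeι _ _⟩

end ZipMorphism

end Stable

/-! ### Cuts of the torsor of a smooth morphism -/

section CutsOfTorsor

variable {k : Type u} [Field k] {ι : Type} {p : ℕ} {σ : Equiv.Perm ι} {X : KSch k}

namespace ZipMorphism

variable {ζ : ZipMorphism p σ X}

lemma IsSmooth.smoothCoordinates_entry [Finite ι] (hζ : ζ.IsSmooth) :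
    SmoothCoordinates (W := ζ.I.left) k ζ.entry :=
  smoothCoordinates_mat ζ.q hζ

variable {O : ζ.I.left.Opens} {S : Finset ι} {J : KSch k} {j : J ⟶ ζ.I}

lemma IsCutOn.isRegularFn [Finite ι] (hj : ζ.IsCutOn O S j) (hζ : ζ.IsSmooth) {i : ι} (hi : i ∈ S) :
    IsRegularFn (J := J.left) (pull j (ζ.entry i)) := by
  obtain ⟨j', h1, h2⟩ := hj
  have := (hζ.smoothCoordinates_entry.restrict O).isRegularFn h2 (i := i) hi
  rw [pull, ← h1, Scheme.Hom.comp_appTop]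
  exact this

lemma IsCutOn.isReduced [Finite ι] (hj : ζ.IsCutOn O S j) (hζ : ζ.IsSmooth) : IsReduced J.left := by
  obtain ⟨j', h1, h2⟩ := hj
  exact isReduced_of_exists_isDomain
    ((hζ.smoothCoordinates_entry.restrict O).exists_isDomain h2)

lemma IsCutOn.exists_isPreirreducible [Finite ι] (hj : ζ.IsCutOn O S j) (hζ : ζ.IsSmooth)
    (y : J.left) : ∃ V : J.left.Opens, y ∈ V ∧ IsPreirreducible (V : Set J.left) := by
  obtain ⟨j', h1, h2⟩ := hj
  exact exists_isPreirreducible_of_exists_isDomain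
    ((hζ.smoothCoordinates_entry.restrict O).exists_isDomain h2) y

lemma IsCutOn.dvd [Finite ι] [DecidableEq ι] (hj : ζ.IsCutOn O S j) (hζ : ζ.IsSmooth) {i : ι}
    (hi : i ∈ S) {J' : KSch k} (r : J' ⟶ J) (hr : ζ.IsCutOn O (S.erase i) (r ≫ j)) (a : Fn J)
    (ha : pull r a = 0) : pull j (ζ.entry i) ∣ a := by
  obtain ⟨j', h1, h2⟩ := hj
  obtain ⟨j'', h1', h2'⟩ := hr
  rw [Finset.coe_erase] at h2'
  have h3 : r.left ≫ j' = j'' := by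
    rw [← cancel_mono O.ι, Category.assoc, h1, h1', Over.comp_left]
  have := IsCut.dvd_of_appTop_eq_zero (hζ.smoothCoordinates_entry.restrict O) h2 (i := i) hi h2'
    r.left h3 a ha
  rw [pull, ← h1, Scheme.Hom.comp_appTop]
  exact this

lemma IsCutOn.isLocallyNoetherian [Finite ι] (hj : ζ.IsCutOn O S j) (hζ : ζ.IsSmooth) :
    IsLocallyNoetherian J.left := by
  obtain ⟨j', h1, h2⟩ := hj
  have := h2.isClosedImmersion
  have : Smooth ζ.q.left := hζ
  have : IsLocallyNoetherian (GSch k ι).left := by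
    change IsLocallyNoetherian (Spec (CommRingCat.of (CoordRing k ι)))
    infer_instance
  have : IsLocallyNoetherian ζ.I.left := LocallyOfFiniteType.isLocallyNoetherian ζ.q.left
  have : IsLocallyNoetherian O := LocallyOfFiniteType.isLocallyNoetherian O.ι
  exact LocallyOfFiniteType.isLocallyNoetherian j'

variable (ζ) in
/-- The weights of the non-zero sections on the cuts of `O`. -/
def cutWeights [Fintype ι] (O : ζ.I.left.Opens) (S : Finset ι) : Set (ι → ℤ) :=
  {lam | ∃ (J : KSch k) (j : J ⟶ ζ.I) (h : Fn J), ζ.IsCutOn O S j ∧ h ≠ 0 ∧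
    IsSection p σ J (ζ.actRel j) lam h}

/-- Division by the highest possible powers of the entries. -/
lemma IsCutOn.exists_sub_mem_cutWeights [Fintype ι] [DecidableEq ι] (hj : ζ.IsCutOn O S j)
    (hζ : ζ.IsSmooth) (hO : ζ.IsSaturated O) {lam : ι → ℤ} {h : Γ(J.left, ⊤)}
    (hh : IsSection p σ J (ζ.actRel j) lam h) (y : J.left)
    (hy : J.left.presheaf.germ ⊤ y trivial h ≠ 0)
    (hyf : ∀ i, j.left y ∉ ζ.I.left.basicOpen (ζ.entry i)) :
    ∃ a : ι → ℕ, ∀ i ∈ S, lam - ∑ l ∈ S, a l • hasseWeight p σ l ∈ ζ.cutWeights O (S.erase i) := by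
  have hst := hj.isStable hO
  have := hj.isLocallyNoetherian hζ
  let m := IsLocalRing.maximalIdeal (J.left.presheaf.stalk y)
  let f : ι → Γ(J.left, ⊤) := fun i => pull j (ζ.entry i)
  have hfm : ∀ i, J.left.presheaf.germ ⊤ y trivial (f i) ∈ m := by
    intro i
    rw [IsLocalRing.mem_maximalIdeal, mem_nonunits_iff, ← Scheme.mem_basicOpen_top]
    change y ∉ J.left.basicOpen (j.left.appTop (ζ.entry i))
    rw [← Scheme.preimage_basicOpen_top]
    exact hyf i
  -- Krull's intersection theorem at `y`. All entries lie in the maximal ideal there, so the degree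
  -- of a monomial in the entries that divides `h` is bounded.
  obtain ⟨N, hN⟩ : ∃ N, J.left.presheaf.germ ⊤ y trivial h ∉ m ^ N := by
    by_contra! hcon
    have := Ideal.iInf_pow_eq_bot_of_isLocalRing m (IsLocalRing.maximalIdeal.isMaximal _).ne_top
    exact hy (by rw [← Ideal.mem_bot, ← this, Ideal.mem_iInf]; exact hcon)
  let P : ℕ → Prop := fun n => ∃ a : ι → ℕ, ∑ l ∈ S, a l = n ∧ ∏ l ∈ S, f l ^ a l ∣ h
  have hP0 : P 0 := ⟨0, by simp, by simp⟩
  have hPN : ∀ n, P n → n < N := by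
    rintro n ⟨a, rfl, g, hg⟩
    by_contra! hle
    refine hN (Ideal.pow_le_pow_right hle ?_)
    rw [hg, map_mul, map_prod]
    refine Ideal.mul_mem_right _ _ ?_
    rw [← Finset.prod_pow_eq_pow_sum]
    refine Ideal.prod_mem_prod fun l _ => ?_
    rw [map_pow]
    exact Ideal.pow_mem_pow (hfm l) _
  -- Maximality of the total degree makes `h0` indivisible by each single entry, so one exponent
  -- vector `a` serves all `i ∈ S`.
  obtain ⟨n, ⟨a, ha, h0, hh0⟩, hmax⟩ : ∃ n, P n ∧ ¬ P (n + 1) := by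
    by_contra! hcon
    have : ∀ n, P n := fun n => by
      induction n with
      | zero => exact hP0
      | succ n ih => exact hcon n ih
    exact (hPN N (this N)).false
  have hF : IsSection p σ J (ζ.actRel j) (∑ l ∈ S, a l • hasseWeight p σ l) (∏ l ∈ S, f l ^ a l) :=
    IsSection.prod S fun l _ => (isSection_entry j l).pow (a l)
  have hsec : IsSection p σ J (ζ.actRel j) (lam - ∑ l ∈ S, a l • hasseWeight p σ l) h0 := by
    refine hst.isSection_of_mul hF (IsRegularFn.prod S fun l hl => (hj.isRegularFn hζ hl).pow _) ?_
    rw [add_sub_cancel]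
    exact hh0 ▸ hh
  refine ⟨a, fun i hi => ?_⟩
  obtain ⟨J', j', hj'⟩ := ζ.exists_isCutOn O (S.erase i)
  obtain ⟨r, rfl⟩ := hj.exists_lift j' hj'.mem fun l hl =>
    hj'.pull_entry_eq_zero fun h => hl (Finset.mem_of_mem_erase h)
  refine ⟨J', r ≫ j, pull r h0, hj', fun hzero => hmax ?_, hsec.pullback r fun T e z z' hzz => ?_⟩
  · obtain ⟨g, hg⟩ := hj.dvd hζ hi r hj' h0 hzero
    refine ⟨a + Pi.single i 1, ?_, g, ?_⟩
    · simp [Finset.sum_add_distrib, ha, Finset.sum_pi_single', hi]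
    · rw [hh0, hg]
      simp only [Pi.add_apply, pow_add, Finset.prod_mul_distrib, mul_assoc]
      congr 2
      rw [Finset.prod_eq_single i]
      · simp [f]
      · intro l _ hl
        simp [hl]
      · exact fun h => absurd hi h
  · simpa [actRel] using hzz

end ZipMorphism

end CutsOfTorsor

/-! ### Relatively open and closed subsets that avoid a closed stratum -/

section Topology

variable {Y X : Type*} [TopologicalSpace Y]

/-- A union of fibres of `π`. -/
def Saturated (π : Y → X) (A : Set Y) : Prop :=
  ∀ y y', π y = π y' → y ∈ A → y' ∈ A

/-- `A` is a relatively open subset of `Z`. -/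
def RelOpen (Z A : Set Y) : Prop :=
  A ⊆ Z ∧ ∀ y ∈ A, ∃ V : Set Y, IsOpen V ∧ y ∈ V ∧ V ∩ Z ⊆ A

/-- Every point of `Z` has an irreducible neighbourhood in `Z`. -/
def LocallyIrreducible (Z : Set Y) : Prop :=
  ∀ y ∈ Z, ∃ V : Set Y, IsOpen V ∧ y ∈ V ∧ IsPreirreducible (V ∩ Z)

/-- The union of the saturated closed and relatively open subsets of `Z` that do not meet `E`. -/
def badSet (π : Y → X) (Z E : Set Y) : Set Y :=
  ⋃₀ {A | Saturated π A ∧ IsClosed A ∧ RelOpen Z A ∧ Disjoint A E}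

variable {π : Y → X} {Z E A : Set Y}

/-- For an open continuous map, closures commute with preimages. -/
lemma Saturated.closure [TopologicalSpace X] (hπ : IsOpenMap π) (hc : Continuous π) (hA : Saturated π A) :
    Saturated π (closure A) := by
  have h1 : π ⁻¹' (π '' A) = A := by
    refine Set.Subset.antisymm ?_ (Set.subset_preimage_image _ _)
    rintro y ⟨a, ha, hay⟩
    exact hA a y hay ha
  have h2 := hπ.preimage_closure_eq_closure_preimage hc (π '' A)
  rw [h1] at h2
  intro y y' hyy hy
  rw [← h2] at hy ⊢
  rw [Set.mem_preimage, ← hyy]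
  exact hy

/-- Inside an irreducible neighbourhood of a limit point a non-empty relatively open set is dense,
so the closure contains the neighbourhood. -/
lemma RelOpen.closure (hZ : IsClosed Z) (hirr : LocallyIrreducible Z) (hA : RelOpen Z A) :
    RelOpen Z (closure A) := by
  refine ⟨hZ.closure_subset_iff.2 hA.1, fun y hy => ?_⟩
  obtain ⟨V, hV, hyV, hVirr⟩ := hirr y (hZ.closure_subset_iff.2 hA.1 hy)
  refine ⟨V, hV, hyV, fun v hv => ?_⟩
  rw [mem_closure_iff]
  intro U hU hvU
  obtain ⟨a, haV, haA⟩ := mem_closure_iff.1 hy V hV hyV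
  obtain ⟨V', hV', haV', hsub⟩ := hA.2 a haA
  obtain ⟨b, hb, hb1, hb2⟩ := hVirr U V' hU hV' ⟨v, hv, hvU⟩ ⟨a, ⟨haV, hA.1 haA⟩, haV'⟩
  exact ⟨b, hb1, hsub ⟨hb2, hb.2⟩⟩

/-- A closed and relatively open set that meets an irreducible neighbourhood contains all of it, so
a limit point of the union lies in a single member. -/
lemma LocallyIrreducible.isClosed_badSet (hZ : IsClosed Z) (hirr : LocallyIrreducible Z) :
    IsClosed (badSet π Z E) := by
  refine isClosed_of_closure_subset fun y hy => ?_
  have hsub : badSet π Z E ⊆ Z := Set.sUnion_subset fun A hA => hA.2.2.1.1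
  have hyZ : y ∈ Z := hZ.closure_subset_iff.2 hsub hy
  obtain ⟨V, hV, hyV, hVirr⟩ := hirr y hyZ
  obtain ⟨a, haV, A, hA, haA⟩ := mem_closure_iff.1 hy V hV hyV
  refine ⟨A, hA, ?_⟩
  by_contra hyA
  obtain ⟨V', hV', haV', hsub'⟩ := hA.2.2.1.2 a haA
  obtain ⟨b, hb, hb1, hb2⟩ := hVirr V' Aᶜ hV' hA.2.1.isOpen_compl
    ⟨a, ⟨haV, hA.2.2.1.1 haA⟩, haV'⟩ ⟨y, ⟨hyV, hyZ⟩, hyA⟩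
  exact hb2 (hsub' ⟨hb1, hb.2⟩)

lemma saturated_badSet : Saturated π (badSet π Z E) := by
  rintro y y' hyy ⟨A, hA, hy⟩
  exact ⟨A, hA, hA.1 y y' hyy hy⟩

lemma relOpen_badSet : RelOpen Z (badSet π Z E) := by
  refine ⟨Set.sUnion_subset fun A hA => hA.2.2.1.1, ?_⟩
  rintro y ⟨A, hA, hy⟩
  obtain ⟨V, hV, hyV, hsub⟩ := hA.2.2.1.2 y hy
  exact ⟨V, hV, hyV, hsub.trans (Set.subset_sUnion_of_mem hA)⟩

lemma disjoint_badSet : Disjoint (badSet π Z E) E :=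
  Set.disjoint_sUnion_left.2 fun _ hA => hA.2.2.2

/-- A saturated relatively open subset that is not bad specializes to `E`. -/
lemma RelOpen.closure_inter_nonempty [TopologicalSpace X] (hπ : IsOpenMap π) (hc : Continuous π) (hZ : IsClosed Z)
    (hirr : LocallyIrreducible Z) (hA : RelOpen Z A) (hsat : Saturated π A) {a : Y} (ha : a ∈ A)
    (hbad : a ∉ badSet π Z E) : (_root_.closure A ∩ E).Nonempty := by
  by_contra hcon
  exact hbad ⟨_root_.closure A, ⟨hsat.closure hπ hc, isClosed_closure, hA.closure hZ hirr,
    Set.disjoint_iff_inter_eq_empty.2 (Set.not_nonempty_iff_eq_empty.1 hcon)⟩, subset_closure ha⟩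

end Topology

/-! ### The good open subset of the torsor, obtained by removing everything that stays away from the
minimal stratum -/

section GoodOpen

variable {k : Type u} [Field k] {ι : Type} {p : ℕ} {σ : Equiv.Perm ι} {X : KSch k}

namespace ZipMorphism

variable (ζ : ZipMorphism p σ X)

/-- The points of the torsor where the entries with index outside `S` vanish. -/
def zeroSet (S : Finset ι) : Set ζ.I.left :=
  {y | ∀ i ∉ S, y ∉ ζ.I.left.basicOpen (ζ.entry i)}

variable {ζ}

lemma isClosed_zeroSet (S : Finset ι) : IsClosed (ζ.zeroSet S) := by
  simp only [zeroSet, Set.ofPred_forall]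
  exact isClosed_iInter fun i => isClosed_iInter fun _ =>
    (ζ.I.left.basicOpen (ζ.entry i)).2.isClosed_compl

lemma zeroSet_mono {S T : Finset ι} (h : S ⊆ T) : ζ.zeroSet S ⊆ ζ.zeroSet T :=
  fun _ hy i hi => hy i fun hiS => hi (h hiS)

lemma zeroSet_inter [DecidableEq ι] (S T : Finset ι) :
    ζ.zeroSet S ∩ ζ.zeroSet T = ζ.zeroSet (S ∩ T) := by
  ext y
  refine ⟨fun h i hi => ?_, fun h => ⟨zeroSet_mono Finset.inter_subset_left h,
    zeroSet_mono Finset.inter_subset_right h⟩⟩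
  by_cases hS : i ∈ S
  · exact h.2 i fun hT => hi (Finset.mem_inter.2 ⟨hS, hT⟩)
  · exact h.1 i hS

lemma isOpenMap_π : IsOpenMap ζ.π.left := by
  have := ζ.flat
  have := ζ.locallyOfFinitePresentation
  exact ζ.π.left.isOpenMap

lemma isStable_id : ζ.IsStable (𝟙 ζ.I) :=
  ⟨inferInstance, fun _ _ h => by simpa using h, fun _ w _ => ⟨w, by simp⟩⟩

lemma saturated_zeroSet [Fintype ι] (S : Finset ι) : Saturated ζ.π.left (ζ.zeroSet S) := by
  classical
  intro y y' hyy hy i hi hy'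
  refine hy i hi ?_
  have h1 := isSection_entry (ζ := ζ) (𝟙 ζ.I) i
  rw [pull_id] at h1
  exact isStable_id.mem_basicOpen_of_isSection h1 (by simpa using hyy.symm) hy'

lemma IsCutOn.range_eq_inter {O : ζ.I.left.Opens} {S : Finset ι} {J : KSch k} {j : J ⟶ ζ.I}
    (hj : ζ.IsCutOn O S j) : Set.range j.left = ↑O ∩ ζ.zeroSet S :=
  hj.range_eq

lemma IsSmooth.locallyIrreducible_zeroSet [Finite ι] (hζ : ζ.IsSmooth) (S : Finset ι) :
    LocallyIrreducible (ζ.zeroSet S) := by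
  intro y hy
  obtain ⟨J, j, hj⟩ := ζ.exists_isCutOn ⊤ S
  have hr := hj.range_eq_inter
  obtain ⟨x, rfl⟩ : y ∈ Set.range j.left := by rw [hr]; exact ⟨trivial, hy⟩
  obtain ⟨V, hxV, hV⟩ := hj.exists_isPreirreducible hζ x
  obtain ⟨U, hU, hUV⟩ := hj.isEmbedding.isOpen_iff.1 V.2
  refine ⟨U, hU, by rw [← Set.mem_preimage, hUV]; exact hxV, ?_⟩
  have h1 : U ∩ ζ.zeroSet S = j.left '' (V : Set J.left) := by
    change _ = j.left '' (V.carrier)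
    rw [← hUV, Set.image_preimage_eq_inter_range, hr]
    simp
  rw [h1]
  exact hV.image _ j.left.continuous.continuousOn

variable (ζ) in
/-- The complement of the bad subsets of the closed subsets `zeroSet S`. -/
def goodOpen [Finite ι] (hζ : ζ.IsSmooth) : ζ.I.left.Opens :=
  ⟨(⋃ S : Finset ι, badSet ζ.π.left (ζ.zeroSet S) (ζ.zeroSet ∅))ᶜ,
    (isClosed_iUnion_of_finite fun S =>
      (hζ.locallyIrreducible_zeroSet S).isClosed_badSet (isClosed_zeroSet S)).isOpen_compl⟩

lemma mem_goodOpen [Finite ι] {hζ : ζ.IsSmooth} {y : ζ.I.left} :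
    y ∈ ζ.goodOpen hζ ↔ ∀ S : Finset ι, y ∉ badSet ζ.π.left (ζ.zeroSet S) (ζ.zeroSet ∅) := by
  change y ∈ (⋃ S : Finset ι, badSet ζ.π.left (ζ.zeroSet S) (ζ.zeroSet ∅))ᶜ ↔ _
  simp

lemma isSaturated_goodOpen [Finite ι] (hζ : ζ.IsSmooth) : ζ.IsSaturated (ζ.goodOpen hζ) := by
  intro y y' hyy hy
  rw [SetLike.mem_coe, mem_goodOpen] at hy ⊢
  exact fun S h => hy S (saturated_badSet y' y hyy.symm h)

lemma zeroSet_empty_subset_goodOpen [Finite ι] (hζ : ζ.IsSmooth) :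
    ζ.zeroSet ∅ ⊆ ζ.goodOpen hζ := by
  intro y hy
  rw [SetLike.mem_coe, mem_goodOpen]
  exact fun S h => Set.disjoint_left.1 disjoint_badSet h hy

/-- On a minimal stratum closure the bad subset is open and closed. -/
lemma relOpen_zeroSet_singleton_diff_goodOpen [Finite ι] (hζ : ζ.IsSmooth) (i : ι) :
    RelOpen (ζ.zeroSet {i}) (ζ.zeroSet {i} \ ζ.goodOpen hζ) := by
  classical
  refine ⟨Set.sdiff_subset, fun y hy => ?_⟩
  have h1 := hy.2
  rw [SetLike.mem_coe, mem_goodOpen] at h1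
  push Not at h1
  obtain ⟨T, hT⟩ := h1
  obtain ⟨V, hV, hyV, hsub⟩ := relOpen_badSet.2 y hT
  -- If `i ∉ T`, the point would lie on the minimal stratum, which bad sets avoid. So `zeroSet {i}`
  -- is contained in `zeroSet T`, and the relatively open bad set restricts to it.
  have hiT : i ∈ T := by
    by_contra hiT
    refine Set.disjoint_left.1 disjoint_badSet hT ?_
    have h2 : y ∈ ζ.zeroSet {i} ∩ ζ.zeroSet T := ⟨hy.1, relOpen_badSet.1 hT⟩
    rwa [zeroSet_inter, Finset.singleton_inter_of_notMem hiT] at h2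
  refine ⟨V, hV, hyV, fun v hv => ⟨hv.2, fun hgood => ?_⟩⟩
  rw [SetLike.mem_coe, mem_goodOpen] at hgood
  exact hgood T (hsub ⟨hv.1, zeroSet_mono (Finset.singleton_subset_iff.2 hiT) hv.2⟩)

lemma IsCutOn.relOpen_image_basicOpen {O : ζ.I.left.Opens} {S : Finset ι} {J : KSch k} {j : J ⟶ ζ.I}
    (hj : ζ.IsCutOn O S j) (U : J.left.Opens) : RelOpen (ζ.zeroSet S) (j.left '' (U : Set J.left)) := by
  have hr := hj.range_eq_inter
  refine ⟨fun y hy => ?_, ?_⟩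
  · have : y ∈ Set.range j.left := Set.image_subset_range _ _ hy
    rw [hr] at this
    exact this.2
  · rintro _ ⟨y, hy, rfl⟩
    obtain ⟨V, hV, hVU⟩ := hj.isEmbedding.isOpen_iff.1 U.2
    refine ⟨V ∩ O, hV.inter O.2, ⟨by rw [← Set.mem_preimage, hVU]; exact hy, hj.mem y⟩, ?_⟩
    rintro v ⟨⟨hv1, hv2⟩, hv3⟩
    obtain ⟨x, rfl⟩ : v ∈ Set.range j.left := by rw [hr]; exact ⟨hv2, hv3⟩
    refine ⟨x, ?_, rfl⟩
    have : x ∈ j.left ⁻¹' V := hv1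
    rw [hVU] at this
    exact this

lemma IsCutOn.saturated_image_basicOpen [Fintype ι] {O : ζ.I.left.Opens} (hO : ζ.IsSaturated O)
    {S : Finset ι} {J : KSch k} {j : J ⟶ ζ.I} (hj : ζ.IsCutOn O S j) {lam : ι → ℤ}
    {h : Γ(J.left, ⊤)} (hh : IsSection p σ J (ζ.actRel j) lam h) :
    Saturated ζ.π.left (j.left '' (J.left.basicOpen h : Set J.left)) := by
  rintro _ y' hyy ⟨y, hy, rfl⟩
  have hr := hj.range_eq_inter
  have h1 : j.left y ∈ Set.range j.left := ⟨y, rfl⟩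
  rw [hr] at h1
  obtain ⟨x, rfl⟩ : y' ∈ Set.range j.left := by
    rw [hr]
    exact ⟨hO _ _ hyy h1.1, saturated_zeroSet S _ _ hyy h1.2⟩
  exact ⟨x, (hj.isStable hO).mem_basicOpen_of_isSection hh hyy hy, rfl⟩

lemma germ_ne_zero_of_mem_closure {J : Scheme.{u}} (h : Γ(J, ⊤)) {y : J}
    (hy : y ∈ closure (J.basicOpen h : Set J)) : J.presheaf.germ ⊤ y trivial h ≠ 0 := by
  intro h0
  rw [← map_zero (J.presheaf.germ ⊤ y trivial).hom] at h0
  obtain ⟨V, hyV, i1, i2, hV⟩ := J.presheaf.germ_eq (U := ⊤) (V := ⊤) y trivial trivial _ _ h0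
  obtain ⟨v, hv, hvh⟩ := mem_closure_iff.1 hy V V.2 hyV
  have h1 : v ∈ V ⊓ J.basicOpen h := ⟨hv, hvh⟩
  rw [← Scheme.basicOpen_res _ _ i1.op, hV, map_zero] at h1
  simp at h1

/-- A non-zero section over the good open is non-zero near a point of the minimal stratum. -/
lemma IsCutOn.exists_germ_ne_zero [Fintype ι] (hζ : ζ.IsSmooth) {S : Finset ι}
    {J : KSch k} {j : J ⟶ ζ.I} (hj : ζ.IsCutOn (ζ.goodOpen hζ) S j) {lam : ι → ℤ}
    {h : Γ(J.left, ⊤)} (hh : IsSection p σ J (ζ.actRel j) lam h) (hne : h ≠ 0) :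
    ∃ y : J.left, J.left.presheaf.germ ⊤ y trivial h ≠ 0 ∧ j.left y ∈ ζ.zeroSet ∅ := by
  have := hj.isReduced hζ
  have hD : J.left.basicOpen h ≠ ⊥ := fun h0 => hne ((basicOpen_eq_bot_iff h).1 h0)
  obtain ⟨y, hy⟩ := (TopologicalSpace.Opens.ne_bot_iff_nonempty _).1 hD
  -- Otherwise the closure of the non-vanishing locus would be one of the removed sets, although it
  -- contains a point of the good open.
  obtain ⟨e, he1, he2⟩ := (hj.relOpen_image_basicOpen (J.left.basicOpen h)).closure_inter_nonempty
    (E := ζ.zeroSet ∅) isOpenMap_π ζ.π.left.continuous (isClosed_zeroSet S)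
    (hζ.locallyIrreducible_zeroSet S)
    (hj.saturated_image_basicOpen (isSaturated_goodOpen hζ) hh) ⟨y, hy, rfl⟩
    (mem_goodOpen.1 (hj.mem y) S)
  obtain ⟨x, rfl⟩ : e ∈ Set.range j.left := by
    rw [hj.range_eq_inter]
    exact ⟨zeroSet_empty_subset_goodOpen hζ he2, zeroSet_mono (Finset.empty_subset S) he2⟩
  refine ⟨x, germ_ne_zero_of_mem_closure h ?_, he2⟩
  rw [hj.isEmbedding.closure_eq_preimage_closure_image]
  exact he1

lemma exists_sub_mem_cutWeights [Fintype ι] [DecidableEq ι] (hζ : ζ.IsSmooth) (S : Finset ι)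
    {lam : ι → ℤ} (hlam : lam ∈ ζ.cutWeights (ζ.goodOpen hζ) S) :
    ∃ a : ι → ℕ, ∀ i ∈ S,
      lam - ∑ l ∈ S, a l • hasseWeight p σ l ∈ ζ.cutWeights (ζ.goodOpen hζ) (S.erase i) := by
  obtain ⟨J, j, h, hj, hne, hh⟩ := hlam
  obtain ⟨y, hy, hy'⟩ := hj.exists_germ_ne_zero hζ hh hne
  exact hj.exists_sub_mem_cutWeights hζ (isSaturated_goodOpen hζ) hh y hy fun i => hy' i (by simp)

end ZipMorphism

end GoodOpen

/-! ### Reducedness -/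

section Reduced

open TensorProduct

/-- The relation turns fⁿ ⊗ fⁿ into a multiple of f²ⁿ ⊗ 1. If fⁿ⁺¹ = 0 with n ≥ 1 this vanishes,
whence fⁿ = 0, and the exponent descends to 1. -/
lemma eq_zero_of_isNilpotent_of_tmul {A B : Type*} [CommRing A] [CommRing B] [Algebra A B]
    [_root_.IsReduced A] [Module.Flat A B] {f : B} (hf : IsNilpotent f) (v : B ⊗[A] B)
    (h : (1 : B) ⊗ₜ[A] f = v * (f ⊗ₜ[A] (1 : B))) : f = 0 := by
  by_contra hne
  have key : ∀ n : ℕ, 1 ≤ n → f ^ (n + 1) = 0 → f ^ n = 0 := by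
    intro n hn h0
    refine eq_zero_of_tmul_self_eq_zero (A := A) ?_
    have h1 : (1 : B) ⊗ₜ[A] (f ^ n) = v ^ n * ((f ^ n) ⊗ₜ[A] (1 : B)) := by
      have := congrArg (· ^ n) h
      simpa [mul_pow, Algebra.TensorProduct.tmul_pow] using this
    calc (f ^ n) ⊗ₜ[A] (f ^ n) = ((f ^ n) ⊗ₜ[A] (1 : B)) * ((1 : B) ⊗ₜ[A] (f ^ n)) := by simp
      _ = v ^ n * ((f ^ n * f ^ n) ⊗ₜ[A] (1 : B)) := by
        rw [h1, mul_left_comm, Algebra.TensorProduct.tmul_mul_tmul, one_mul]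
      _ = 0 := by
        rw [← pow_add, pow_eq_zero_of_le (by omega : n + 1 ≤ n + n) h0, zero_tmul, mul_zero]
  obtain ⟨n, hn⟩ := hf
  have : ∀ m : ℕ, f ^ (m + 1) = 0 → f = 0 := by
    intro m
    induction m with
    | zero => simp
    | succ m ih => exact fun h => ih (key (m + 1) (by omega) h)
  exact hne (this n (by rw [pow_succ, hn, zero_mul]))

variable {J Y W : Scheme.{u}}

lemma appTop_SpecMap_fromSpec {V : J.Opens} (hV : IsAffineOpen V) {R : CommRingCat.{u}}
    (φ : Γ(J, V) ⟶ R) (f : Γ(J, ⊤)) :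
    (Spec.map φ ≫ hV.fromSpec).appTop f = (Scheme.ΓSpecIso R).inv (φ (res V f)) := by
  have h1 : hV.fromSpec.appTop f = (Scheme.ΓSpecIso Γ(J, V)).inv (res V f) := by
    have := hV.fromSpec_app_of_le ⊤ le_top
    have h2 := congr($this f)
    simp only [CommRingCat.comp_apply] at h2
    refine h2.trans ?_
    exact congr($((Spec Γ(J, V)).presheaf.map_id _) ((Scheme.ΓSpecIso Γ(J, V)).inv (res V f)))
  rw [Scheme.Hom.comp_appTop, CommRingCat.comp_apply, h1, ← CommRingCat.comp_apply,
    ← Scheme.ΓSpecIso_inv_naturality, CommRingCat.comp_apply]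

/-- A nilpotent function on a flat scheme over a reduced one vanishes if its two pullbacks to pairs
of points with the same image agree up to a factor. -/
lemma eq_zero_of_flat_of_isReduced (π : J ⟶ Y) [Flat π] [IsReduced Y] (f : Γ(J, ⊤))
    (hf : J.basicOpen f = ⊥)
    (H : ∀ (P : Scheme.{u}) (z w : P ⟶ J), z ≫ π = w ≫ π →
      ∃ v : Γ(P, ⊤), w.appTop f = v * z.appTop f) : f = 0 := by
  refine eq_zero_of_forall_exists_res_eq_zero f fun y => ?_
  obtain ⟨U, hU⟩ := exists_affineOpen_mem (π y)
  obtain ⟨_, ⟨V, hV, rfl⟩, hyV, hVU⟩ :=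
    J.isBasis_affineOpens.exists_subset_of_mem_open hU (π ⁻¹ᵁ U.1).2
  replace hV : IsAffineOpen V := hV
  refine ⟨V, hyV, ?_⟩
  let φ := π.appLE U.1 V hVU
  have hflat : φ.hom.Flat := HasRingHomProperty.appLE (P := @Flat) π inferInstance U ⟨V, hV⟩ hVU
  let := φ.hom.toAlgebra
  have : Module.Flat Γ(Y, U.1) Γ(J, V) := hflat
  have hnil : IsNilpotent (res V f) := by
    rw [Scheme.isNilpotent_iff_basicOpen_eq_bot_of_isCompact hV.isCompact, Scheme.basicOpen_res, hf, inf_bot_eq]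
  -- The two maps from the spectrum of the tensor square form the local universal pair; the
  -- hypothesis applied to it yields the relation between f ⊗ 1 and 1 ⊗ f.
  let R := CommRingCat.of (Γ(J, V) ⊗[Γ(Y, U.1)] Γ(J, V))
  let a : Γ(J, V) ⟶ R := CommRingCat.ofHom
    (Algebra.TensorProduct.includeLeft : Γ(J, V) →ₐ[Γ(Y, U.1)] Γ(J, V) ⊗[Γ(Y, U.1)] Γ(J, V)).toRingHom
  let b : Γ(J, V) ⟶ R := CommRingCat.ofHom
    (Algebra.TensorProduct.includeRight : Γ(J, V) →ₐ[Γ(Y, U.1)] Γ(J, V) ⊗[Γ(Y, U.1)] Γ(J, V)).toRingHom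
  have hab : φ ≫ a = φ ≫ b := by
    ext x
    exact ((Algebra.TensorProduct.includeLeft :
      Γ(J, V) →ₐ[Γ(Y, U.1)] Γ(J, V) ⊗[Γ(Y, U.1)] Γ(J, V)).commutes x).trans
      ((Algebra.TensorProduct.includeRight :
        Γ(J, V) →ₐ[Γ(Y, U.1)] Γ(J, V) ⊗[Γ(Y, U.1)] Γ(J, V)).commutes x).symm
  obtain ⟨v, hv⟩ := H (Spec R) (Spec.map a ≫ hV.fromSpec) (Spec.map b ≫ hV.fromSpec) (by
    rw [Category.assoc, Category.assoc, ← IsAffineOpen.SpecMap_appLE_fromSpec π U.2 hV hVU,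
      ← Category.assoc, ← Category.assoc, ← Spec.map_comp, ← Spec.map_comp, hab])
  rw [appTop_SpecMap_fromSpec, appTop_SpecMap_fromSpec] at hv
  have hv' := congrArg (Scheme.ΓSpecIso R).hom hv
  rw [map_mul] at hv'
  simp only [← CommRingCat.comp_apply, Category.assoc, Iso.inv_hom_id, Category.comp_id] at hv'
  exact eq_zero_of_isNilpotent_of_tmul (A := Γ(Y, U.1)) hnil _ hv'

/-- A function on a reduced scheme with empty non-vanishing locus is zero, so an inclusion of point
sets is enough. -/
lemma ker_le_ker_of_isReduced (t : Y ⟶ W) [IsClosedImmersion t] [IsReduced J] (j : J ⟶ W)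
    (h : Set.range j ⊆ Set.range t) : t.ker ≤ j.ker := by
  refine Scheme.IdealSheafData.le_ofIdeals_iff.2 fun U b hb => ?_
  rw [Scheme.Hom.ker_apply] at hb
  change j.app U.1 b = 0
  rw [← basicOpen_eq_bot_iff, ← Scheme.preimage_basicOpen, eq_bot_iff]
  intro y hy
  obtain ⟨y', hy'⟩ := h ⟨y, rfl⟩
  have h1 : y' ∈ t ⁻¹ᵁ W.basicOpen b := by
    change t y' ∈ W.basicOpen b
    rw [hy']
    exact hy
  rw [Scheme.preimage_basicOpen, RingHom.mem_ker.1 hb] at h1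
  simp at h1

lemma IsRegularFn.mem_closure_basicOpen [IsReduced J] {f : Γ(J, ⊤)}
    (hf : IsRegularFn f) (y : J) : y ∈ closure (J.basicOpen f : Set J) := by
  rw [mem_closure_iff]
  intro V hV hyV
  let V' : J.Opens := ⟨V, hV⟩
  by_contra hcon
  have h1 : J.basicOpen (res V' f) = ⊥ := by
    rw [Scheme.basicOpen_res, eq_bot_iff]
    rintro v ⟨hv, hvf⟩
    exact hcon ⟨v, hv, hvf⟩
  rw [basicOpen_eq_bot_iff] at h1
  have h2 := hf y
  rw [← germ_res_apply V' y hyV, h1, map_zero] at h2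
  exact zero_notMem_nonZeroDivisors h2

end Reduced

/-! ### The torsor over a stratum closure is a cut -/

section TorsorOver

variable {k : Type u} [Field k]

lemma range_redClosureι (Y : KSch k) (s : Set Y.left) :
    Set.range (redClosureι Y s).left = closure s := by
  change Set.range (Scheme.IdealSheafData.subschemeι _) = _
  rw [Scheme.IdealSheafData.range_subschemeι, Scheme.IdealSheafData.coe_support_vanishingIdeal]
  rfl

variable {ι : Type} {p : ℕ} {σ : Equiv.Perm ι} {X : KSch k}

namespace ZipMorphism

variable {ζ : ZipMorphism p σ X}

lemma saturated_preStratum [Fintype ι] (S : Finset ι) :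
    Saturated ζ.π.left (preStratum ζ.q S) := by
  classical
  have key : ∀ (y y' : ζ.I.left) i, ζ.π.left y = ζ.π.left y' →
      y ∈ ζ.I.left.basicOpen (ζ.entry i) → y' ∈ ζ.I.left.basicOpen (ζ.entry i) := by
    intro y y' i hyy hy
    have h1 := isSection_entry (ζ := ζ) (𝟙 ζ.I) i
    rw [pull_id] at h1
    exact isStable_id.mem_basicOpen_of_isSection h1 (by simpa using hyy) hy
  intro y y' hyy hy i
  rw [← hy i]
  exact ⟨key y' y i hyy.symm, key y y' i hyy⟩

/-- On the reduced cut for `S` the product of the entries over `S` is regular, so its non-vanishing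
locus, which is the stratum, is dense. -/
lemma IsSmooth.closure_preStratum [Finite ι] (hζ : ζ.IsSmooth) (S : Finset ι) :
    closure (preStratum ζ.q S) = ζ.zeroSet S := by
  classical
  refine Set.Subset.antisymm ((isClosed_zeroSet S).closure_subset_iff.2
    fun y hy i hi h => hi ((hy i).1 h)) fun y hy => ?_
  obtain ⟨J, j, hj⟩ := ζ.exists_isCutOn ⊤ S
  have hr := hj.range_eq_inter
  have := hj.isReduced hζ
  obtain ⟨x, rfl⟩ : y ∈ Set.range j.left := by rw [hr]; exact ⟨trivial, hy⟩
  have hreg : IsRegularFn (J := J.left) (∏ i ∈ S, pull j (ζ.entry i)) :=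
    IsRegularFn.prod S fun i hi => hj.isRegularFn hζ hi
  refine map_mem_closure j.left.continuous (hreg.mem_closure_basicOpen x) fun z hz i => ?_
  change j.left z ∈ ζ.I.left.basicOpen (ζ.entry i) ↔ _
  constructor
  · intro h
    by_contra hi
    have h1 : j.left z ∈ Set.range j.left := ⟨z, rfl⟩
    rw [hr] at h1
    exact h1.2 i hi h
  · intro hi
    change z ∈ j.left ⁻¹ᵁ ζ.I.left.basicOpen (ζ.entry i)
    rw [Scheme.preimage_basicOpen_top]
    rw [SetLike.mem_coe, ← Finset.mul_prod_erase S _ hi, Scheme.basicOpen_mul] at hz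
    exact hz.1

lemma IsSmooth.preimage_closure_stratum [Fintype ι] (hζ : ζ.IsSmooth) (S : Finset ι) :
    ζ.π.left ⁻¹' closure (ζ.stratum S) = ζ.zeroSet S := by
  rw [isOpenMap_π.preimage_closure_eq_closure_preimage ζ.π.left.continuous,
    ← hζ.closure_preStratum]
  congr 1
  refine Set.Subset.antisymm ?_ (Set.subset_preimage_image _ _)
  rintro y ⟨a, ha, hay⟩
  exact saturated_preStratum S a y hay ha

lemma IsSmooth.range_torsorOverι [Fintype ι] (hζ : ζ.IsSmooth) (S : Finset ι) :
    Set.range (ζ.torsorOverι S).left = ζ.zeroSet S := by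
  change Set.range (Limits.pullback.fst ζ.π.left (redClosureι X (ζ.stratum S)).left) = _
  rw [Scheme.Pullback.range_fst, range_redClosureι, hζ.preimage_closure_stratum]

variable (ζ) in
/-- The inclusion of the stratum closure. -/
def stratumClosureι (S : Finset ι) : ζ.stratumClosure S ⟶ X := redClosureι X (ζ.stratum S)

variable (ζ) in
/-- The projection of the restricted torsor to the stratum closure. -/
def torsorOverπ (S : Finset ι) : ζ.torsorOver S ⟶ ζ.stratumClosure S :=
  Over.homMk (Limits.pullback.snd ζ.π.left (redClosureι X (ζ.stratum S)).left) (by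
    have h := Limits.pullback.condition (f := ζ.π.left) (g := (redClosureι X (ζ.stratum S)).left)
    change _ ≫ (ζ.stratumClosure S).hom = Limits.pullback.fst ζ.π.left _ ≫ ζ.I.hom
    rw [← Over.w ζ.π, reassoc_of% h]
    exact congrArg _ (Over.w (redClosureι X (ζ.stratum S))).symm)

lemma torsorOver_condition (S : Finset ι) :
    ζ.torsorOverι S ≫ ζ.π = ζ.torsorOverπ S ≫ ζ.stratumClosureι S := by
  ext1
  exact Limits.pullback.condition

/-- The cut is reduced and has the same points, which gives one inclusion of ideals. For the other,
the entries outside `S` have empty non-vanishing locus on a torsor that is flat over a reduced base.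
They are not zero for free, as the torsor is not known to be reduced; equivariance makes them zero
through `eq_zero_of_flat_of_isReduced`. -/
lemma IsSmooth.isCut_torsorOverι [Fintype ι] (hζ : ζ.IsSmooth) (S : Finset ι)
    (hred : IsReduced (ζ.stratumClosure S).left) :
    IsCut (W := ζ.I.left) ζ.entry S (ζ.torsorOverι S).left := by
  classical
  have h1 : IsClosedImmersion (redClosureι X (ζ.stratum S)).left := by
    change IsClosedImmersion (Scheme.IdealSheafData.subschemeι _)
    infer_instance
  have h2 : IsClosedImmersion (ζ.torsorOverι S).left := by
    change IsClosedImmersion (Limits.pullback.fst ζ.π.left (redClosureι X (ζ.stratum S)).left)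
    infer_instance
  have hflat : Flat (ζ.torsorOverπ S).left := by
    have := ζ.flat
    change Flat (Limits.pullback.snd ζ.π.left (redClosureι X (ζ.stratum S)).left)
    infer_instance
  refine ⟨h2, le_antisymm ?_ ?_⟩
  · have hc := isCut_subschemeι ζ.entry (S : Set ι)
    rw [← hc.ker_eq]
    have := isReduced_of_exists_isDomain (hζ.smoothCoordinates_entry.exists_isDomain hc)
    refine ker_le_ker_of_isReduced _ _ ?_
    rw [hc.range_eq, hζ.range_torsorOverι]
    rfl
  · rw [cutIdeal_le_iff]
    intro i hi
    refine eq_zero_of_flat_of_isReduced (ζ.torsorOverπ S).left _ ?_ ?_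
    · rw [← Scheme.preimage_basicOpen_top, eq_bot_iff]
      intro y hy
      have h3 : (ζ.torsorOverι S).left y ∈ Set.range (ζ.torsorOverι S).left := ⟨y, rfl⟩
      rw [hζ.range_torsorOverι] at h3
      exact h3 i hi hy
    · intro P z w hzw
      let P' : KSch k := Over.mk (z ≫ (ζ.torsorOver S).hom)
      let z' : P' ⟶ ζ.torsorOver S := Over.homMk z rfl
      let w' : P' ⟶ ζ.torsorOver S := Over.homMk w (by
        rw [← Over.w (ζ.torsorOverπ S), ← reassoc_of% hzw, Over.w]
        rfl)
      have hzw' : z' ≫ ζ.torsorOverπ S = w' ≫ ζ.torsorOverπ S := by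
        ext1
        exact hzw
      obtain ⟨e, he, -⟩ := ζ.simply_transitive (z' ≫ ζ.torsorOverι S) (w' ≫ ζ.torsorOverι S) (by
        rw [Category.assoc, Category.assoc, torsorOver_condition, reassoc_of% hzw'])
      exact ⟨_, isSection_entry (ζ := ζ) (ζ.torsorOverι S) i P' e z' w' he⟩

end ZipMorphism

end TorsorOver

/-! ### Descent and extension by zero of functions -/

section Descent

variable {J Y W : Scheme.{u}}

/-- A function is a morphism to the relative affine line, and `π` is an effective epimorphism. -/
lemma exists_descent (π : J ⟶ Y) [Flat π] [Surjective π] [LocallyOfFinitePresentation π]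
    (f : Γ(J, ⊤)) (H : ∀ (P : Scheme.{u}) (z w : P ⟶ J), z ≫ π = w ≫ π →
      z.appTop f = w.appTop f) : ∃ g : Γ(Y, ⊤), π.appTop g = f := by
  let v : J ⟶ 𝔸(PUnit.{u + 1}; Y) := AffineSpace.homOfVector π fun _ => f
  have hv : ∀ (P : Scheme.{u}) (z w : P ⟶ J), z ≫ π = w ≫ π → z ≫ v = w ≫ v := by
    intro P z w hzw
    simp only [v, AffineSpace.comp_homOfVector, hzw]
    congr 1
    funext i
    exact H P z w hzw
  refine ⟨(EffectiveEpi.desc π v fun z w => hv _ z w).appTop (AffineSpace.coord Y PUnit.unit), ?_⟩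
  rw [← CommRingCat.comp_apply, ← Scheme.Hom.comp_appTop, EffectiveEpi.fac]
  exact AffineSpace.homOfVector_appTop_coord _ _ _

lemma topIso_hom_ι_appTop (U : W.Opens) (F : Γ(W, ⊤)) :
    U.topIso.hom (U.ι.appTop F) = res U F := by
  rw [Scheme.Opens.ι_appTop]
  exact congr($(W.presheaf.map_comp (homOfLE (le_top : U.ι ''ᵁ ⊤ ≤ ⊤)).op
    (eqToHom U.ι_image_top.symm).op) F).symm

lemma ι_appTop_eq_zero_iff (U : W.Opens) (F : Γ(W, ⊤)) : U.ι.appTop F = 0 ↔ res U F = 0 := by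
  have h1 : res U F = U.topIso.hom (U.ι.appTop F) := (topIso_hom_ι_appTop U F).symm
  rw [h1]
  exact (map_eq_zero_iff _ (ConcreteCategory.bijective_of_isIso U.topIso.hom).1).symm

lemma eq_of_ι_appTop_eq (U V : W.Opens) (hcover : ∀ y, y ∈ U ∨ y ∈ V) {F G : Γ(W, ⊤)}
    (hU : U.ι.appTop F = U.ι.appTop G) (hV : V.ι.appTop F = V.ι.appTop G) : F = G := by
  rw [← sub_eq_zero] at hU hV ⊢
  rw [← map_sub, ι_appTop_eq_zero_iff] at hU hV
  refine eq_zero_of_forall_exists_res_eq_zero _ fun y => ?_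
  rcases hcover y with hy | hy
  exacts [⟨U, hy, hU⟩, ⟨V, hy, hV⟩]

lemma exists_extension_by_zero (U V : W.Opens) (hcover : ∀ y, y ∈ U ∨ y ∈ V)
    (hdisj : ∀ y ∈ U, y ∉ V) (f : Γ(U, ⊤)) :
    ∃ F : Γ(W, ⊤), U.ι.appTop F = f ∧ V.ι.appTop F = 0 := by
  obtain ⟨F, hF⟩ := exists_gluing (fun b : Bool => if b then U else V)
    (fun y => (hcover y).elim (fun h => ⟨true, h⟩) fun h => ⟨false, h⟩)
    (fun b => match b with
      | true => U.topIso.hom f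
      | false => (0 : Γ(W, V))) (by
    rintro (_ | _) (_ | _) y ha hb
    · rfl
    · exact absurd ha (hdisj y hb)
    · exact absurd hb (hdisj y ha)
    · rfl)
  refine ⟨F, ?_, (ι_appTop_eq_zero_iff V F).2 (hF false)⟩
  have h1 : U.topIso.hom (U.ι.appTop F) = U.topIso.hom f := (topIso_hom_ι_appTop U F).trans (hF true)
  exact (ConcreteCategory.bijective_of_isIso U.topIso.hom).1 h1

/-- Near a zero of `g` the constant value of `g` must be 0, so the zero locus is open. -/
lemma PseudoComplete.isClosed_basicOpen {k : Type u} [Field k] {Y : KSch k} (hY : PseudoComplete Y)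
    (g : Γ(Y.left, ⊤)) : IsClosed (Y.left.basicOpen g : Set Y.left) := by
  rw [← isOpen_compl_iff, isOpen_iff_forall_mem_open]
  intro y hy
  obtain ⟨U, c, hyU, hU⟩ := hY.2 g y
  have hc : c = 0 := by
    by_contra hc
    refine hy ?_
    have h1 : IsUnit (const Y c) := by
      unfold const
      exact ((Ne.isUnit hc).map (Scheme.ΓSpecIso (CommRingCat.of k)).inv.hom).map Y.hom.appTop.hom
    have h2 : y ∈ U ⊓ Y.left.basicOpen g := by
      rw [← Scheme.basicOpen_res _ _ (homOfLE (le_top : U ≤ ⊤)).op, hU, Scheme.basicOpen_res,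
        Scheme.basicOpen_of_isUnit _ h1]
      exact ⟨hyU, trivial⟩
    exact h2.2
  refine ⟨U, fun v hv hvg => ?_, U.2, hyU⟩
  have h2 : v ∈ U ⊓ Y.left.basicOpen g := ⟨hv, hvg⟩
  rw [← Scheme.basicOpen_res _ _ (homOfLE (le_top : U ≤ ⊤)).op, hU, hc] at h2
  have h0 : const Y (0 : k) = 0 := by simp [const]
  rw [h0, map_zero] at h2
  simp at h2

end Descent

/-! ### Integral coordinates -/

section Coordinates

variable {ι : Type} {p : ℕ} {σ : Equiv.Perm ι}

lemma exists_mul_eq_intCast [Fintype ι] (c : ι → ℚ) :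
    ∃ N : ℕ, 1 ≤ N ∧ ∃ C : ι → ℤ, ∀ l, (C l : ℚ) = N * c l := by
  classical
  refine ⟨∏ l, (c l).den, Nat.one_le_iff_ne_zero.2 (Finset.prod_ne_zero_iff.2
    fun l _ => (c l).den_ne_zero),
    fun l => (∏ m ∈ Finset.univ.erase l, (c m).den : ℕ) * (c l).num, fun l => ?_⟩
  rw [← Finset.mul_prod_erase Finset.univ _ (Finset.mem_univ l)]
  push_cast
  rw [← Rat.mul_den_eq_num (c l)]
  ring

lemma IsCoord.zsmul [DecidableEq ι] {S : Finset ι} {lam : ι → ℤ} {c : ι → ℚ}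
    (hc : IsCoord p σ S lam c) (n : ℤ) : IsCoord p σ S (n • lam) fun l => n * c l := by
  intro l
  rw [Pi.smul_apply, smul_eq_mul, Int.cast_mul, hc l]
  ring

end Coordinates

/-! ### Sections on the minimal stratum closures -/

section Minimal

variable {k : Type u} [Field k] {ι : Type} {p : ℕ} {σ : Equiv.Perm ι} {X : KSch k}

namespace ZipMorphism

variable {ζ : ZipMorphism p σ X}

lemma isSection_pull_comp [Fintype ι] {J J' : KSch k} (a : J' ⟶ J) {j : J ⟶ ζ.I} {lam : ι → ℤ}
    {h : Fn J} (hh : IsSection p σ J (ζ.actRel j) lam h) :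
    IsSection p σ J' (ζ.actRel (a ≫ j)) lam (pull a h) :=
  hh.pullback a fun T e z z' hz => by simpa [actRel] using hz

/-- All cuts with the same index set are isomorphic. -/
lemma IsCutOn.exists_transfer [Fintype ι] {O : ζ.I.left.Opens} (hO : ζ.IsSaturated O) {S : Finset ι}
    {J J' : KSch k} {j : J ⟶ ζ.I} {j' : J' ⟶ ζ.I} (hj : ζ.IsCutOn O S j) (hj' : ζ.IsCutOn O S j') :
    ∃ a : J' ⟶ J, a ≫ j = j' ∧ Function.Injective (pull a) := by
  obtain ⟨a, ha⟩ := hj.exists_lift j' hj'.mem fun i hi => hj'.pull_entry_eq_zero hi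
  obtain ⟨b, hb⟩ := hj'.exists_lift j hj.mem fun i hi => hj.pull_entry_eq_zero hi
  have := (hj.isStable hO).mono
  have hba : b ≫ a = 𝟙 J := by rw [← cancel_mono j, Category.assoc, ha, hb, Category.id_comp]
  refine ⟨a, ha, fun x y hxy => ?_⟩
  have := congrArg (pull b) hxy
  rwa [← pull_comp, ← pull_comp, hba, pull_id, pull_id] at this

variable (ζ) in
/-- The part of the torsor over the stratum closure that lies in `O`. -/
def torsorIn (S : Finset ι) (O : ζ.I.left.Opens) : KSch k :=
  Over.mk (((ζ.torsorOverι S).left ⁻¹ᵁ O).ι ≫ (ζ.torsorOver S).hom)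

variable (ζ) in
/-- The inclusion into the torsor over the stratum closure. -/
def torsorInι (S : Finset ι) (O : ζ.I.left.Opens) : ζ.torsorIn S O ⟶ ζ.torsorOver S :=
  Over.homMk ((ζ.torsorOverι S).left ⁻¹ᵁ O).ι rfl

lemma IsSmooth.isCutOn_torsorIn [Fintype ι] (hζ : ζ.IsSmooth) (S : Finset ι)
    (hred : IsReduced (ζ.stratumClosure S).left) (O : ζ.I.left.Opens) :
    ζ.IsCutOn O S (ζ.torsorInι S O ≫ ζ.torsorOverι S) :=
  ⟨(ζ.torsorOverι S).left ∣_ O, morphismRestrict_ι _ _, (hζ.isCut_torsorOverι S hred).restrict O⟩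

/-- A function on the torsor over a stratum closure that is invariant where it does not vanish
descends. -/
lemma exists_descent_of_isSection_zero [Fintype ι] {S : Finset ι} {O : ζ.I.left.Opens}
    (hO : ζ.IsSaturated O) (O' : (ζ.torsorOver S).left.Opens)
    (hcover : ∀ y, y ∈ (ζ.torsorOverι S).left ⁻¹ᵁ O ∨ y ∈ O') {F : Γ((ζ.torsorOver S).left, ⊤)}
    (hF : IsSection p σ (ζ.torsorIn S O) (ζ.actRel (ζ.torsorInι S O ≫ ζ.torsorOverι S)) 0
      (pull (ζ.torsorInι S O) F)) (hdisj : ∀ y ∈ (ζ.torsorOverι S).left ⁻¹ᵁ O, y ∉ O')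
    (hF' : O'.ι.appTop F = 0) :
    ∃ g : Γ((ζ.stratumClosure S).left, ⊤), (ζ.torsorOverπ S).left.appTop g = F := by
  have h1 := ζ.flat
  have h2 := ζ.surjective
  have h3 := ζ.locallyOfFinitePresentation
  have h1' : Flat (ζ.torsorOverπ S).left :=
    inferInstanceAs (Flat (Limits.pullback.snd ζ.π.left (redClosureι X (ζ.stratum S)).left))
  have h2' : Surjective (ζ.torsorOverπ S).left :=
    inferInstanceAs (Surjective (Limits.pullback.snd ζ.π.left (redClosureι X (ζ.stratum S)).left))
  have h3' : LocallyOfFinitePresentation (ζ.torsorOverπ S).left :=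
    inferInstanceAs (LocallyOfFinitePresentation
      (Limits.pullback.snd ζ.π.left (redClosureι X (ζ.stratum S)).left))
  refine exists_descent (ζ.torsorOverπ S).left F fun P z w hzw => ?_
  let U := (ζ.torsorOverι S).left ⁻¹ᵁ O
  have hU : ∀ t : P, z t ∈ U ↔ w t ∈ U := by
    have hπ : ∀ t : P, ζ.π.left ((ζ.torsorOverι S).left (z t)) =
        ζ.π.left ((ζ.torsorOverι S).left (w t)) := by
      intro t
      have hc : (ζ.torsorOverι S).left ≫ ζ.π.left =
          (ζ.torsorOverπ S).left ≫ (ζ.stratumClosureι S).left :=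
        congrArg CommaMorphism.left (torsorOver_condition S)
      have hzw' : z ≫ (ζ.torsorOverι S).left ≫ ζ.π.left =
          w ≫ (ζ.torsorOverι S).left ≫ ζ.π.left := by
        rw [hc, reassoc_of% hzw]
      exact congr($hzw' t)
    exact fun t => ⟨hO _ _ (hπ t), hO _ _ (hπ t).symm⟩
  -- As `O` is saturated, `z` and `w` land in the same part of the torsor. Over `O` the pullbacks
  -- agree by invariance, over `O'` both vanish.
  refine eq_of_ι_appTop_eq (z ⁻¹ᵁ U) (z ⁻¹ᵁ O') (fun t => hcover (z t)) ?_ ?_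
  · let Q : KSch k := Over.mk ((z ⁻¹ᵁ U).ι ≫ z ≫ (ζ.torsorOver S).hom)
    have hw : Set.range ((z ⁻¹ᵁ U).ι ≫ w) ⊆ Set.range U.ι := by
      rw [Scheme.Opens.range_ι]
      rintro _ ⟨t, rfl⟩
      exact (hU _).1 t.2
    let zQ : Q ⟶ ζ.torsorIn S O := Over.homMk (z ∣_ U) (by
      change (z ∣_ U) ≫ U.ι ≫ _ = _
      rw [morphismRestrict_ι_assoc]
      rfl)
    let wl : (z ⁻¹ᵁ U).toScheme ⟶ U := IsOpenImmersion.lift U.ι ((z ⁻¹ᵁ U).ι ≫ w) hw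
    have hwl : wl ≫ U.ι = (z ⁻¹ᵁ U).ι ≫ w := IsOpenImmersion.lift_fac _ _ hw
    let wQ : Q ⟶ ζ.torsorIn S O := Over.homMk wl (by
      change wl ≫ U.ι ≫ _ = _
      rw [reassoc_of% hwl, ← Over.w (ζ.torsorOverπ S),
        ← reassoc_of% hzw, Over.w]
      rfl)
    have hzQ : (zQ ≫ ζ.torsorInι S O).left = (z ⁻¹ᵁ U).ι ≫ z := morphismRestrict_ι z U
    have hwQ : (wQ ≫ ζ.torsorInι S O).left = (z ⁻¹ᵁ U).ι ≫ w := hwl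
    have hππ : (zQ ≫ ζ.torsorInι S O) ≫ ζ.torsorOverπ S =
        (wQ ≫ ζ.torsorInι S O) ≫ ζ.torsorOverπ S := by
      ext1
      rw [Over.comp_left _ _ _ _ (ζ.torsorOverπ S), Over.comp_left _ _ _ _ (ζ.torsorOverπ S), hzQ, hwQ,
        Category.assoc, Category.assoc, hzw]
    obtain ⟨e, he, -⟩ := ζ.simply_transitive (zQ ≫ ζ.torsorInι S O ≫ ζ.torsorOverι S)
      (wQ ≫ ζ.torsorInι S O ≫ ζ.torsorOverι S) (by
        have := congrArg (· ≫ ζ.stratumClosureι S) hππ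
        simpa only [Category.assoc, torsorOver_condition] using this)
    have key := hF Q e zQ wQ he
    rw [character_zero, Units.val_one, one_mul, ← pull_comp, ← pull_comp] at key
    have e1 : pull (zQ ≫ ζ.torsorInι S O) F = (z ⁻¹ᵁ U).ι.appTop (z.appTop F) := by
      rw [pull, hzQ, Scheme.Hom.comp_appTop]
      rfl
    have e2 : pull (wQ ≫ ζ.torsorInι S O) F = (z ⁻¹ᵁ U).ι.appTop (w.appTop F) := by
      rw [pull, hwQ, Scheme.Hom.comp_appTop]
      rfl
    rw [← e1, ← e2, key]
  · have hw : Set.range ((z ⁻¹ᵁ O').ι ≫ w) ⊆ Set.range O'.ι := by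
      rw [Scheme.Opens.range_ι]
      rintro _ ⟨t, rfl⟩
      have h4 : z t.1 ∉ U := fun h => hdisj _ h t.2
      rw [hU] at h4
      exact (hcover (w t.1)).resolve_left h4
    have key : ∀ (v : P ⟶ (ζ.torsorOver S).left) (a : (z ⁻¹ᵁ O').toScheme ⟶ O'),
        a ≫ O'.ι = (z ⁻¹ᵁ O').ι ≫ v → (z ⁻¹ᵁ O').ι.appTop (v.appTop F) = 0 := by
      intro v a hav
      rw [← CommRingCat.comp_apply, ← Scheme.Hom.comp_appTop, ← hav, Scheme.Hom.comp_appTop,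
        CommRingCat.comp_apply, hF', map_zero]
    rw [key z (z ∣_ O') (morphismRestrict_ι z O'),
      key w (IsOpenImmersion.lift _ _ hw) (IsOpenImmersion.lift_fac _ _ hw)]

/-- An invariant function on the good part of a minimal stratum closure vanishes if it vanishes
on the minimal stratum. -/
lemma eq_zero_of_isSection_zero [Fintype ι] (hζ : ζ.IsSmooth) (i : ι)
    (hpc : PseudoComplete (ζ.stratumClosure {i})) {J : KSch k} {j : J ⟶ ζ.I}
    (hj : ζ.IsCutOn (ζ.goodOpen hζ) {i} j) {f : Fn J} (hf : IsSection p σ J (ζ.actRel j) 0 f)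
    (hdvd : pull j (ζ.entry i) ∣ f) : f = 0 := by
  by_contra hne
  have hO := isSaturated_goodOpen hζ
  let O := ζ.goodOpen hζ
  have hcut := hζ.isCutOn_torsorIn {i} hpc.1 O
  obtain ⟨a, ha, hinj⟩ := hj.exists_transfer hO hcut
  have hf' := isSection_pull_comp a hf
  have hne' : pull a f ≠ 0 := fun h0 => hne (hinj (h0.trans (map_zero _).symm))
  have hdvd' := map_dvd (pull a) hdvd
  rw [ha] at hf'
  rw [← pull_comp, ha] at hdvd'
  -- On `zeroSet {i}` the bad part is also open, so the function extends by zero to the whole torsor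
  -- and can descend to the stratum closure.
  let O' : (ζ.torsorOver {i}).left.Opens :=
    ⟨((ζ.torsorOverι {i}).left ⁻¹ᵁ O : Set (ζ.torsorOver {i}).left)ᶜ, by
      rw [isOpen_iff_forall_mem_open]
      intro y hy
      have hyZ : ∀ y, (ζ.torsorOverι {i}).left y ∈ ζ.zeroSet {i} := fun y => by
        rw [← hζ.range_torsorOverι]
        exact ⟨y, rfl⟩
      obtain ⟨V, hV, hyV, hsub⟩ := (relOpen_zeroSet_singleton_diff_goodOpen hζ i).2 _ ⟨hyZ y, hy⟩
      exact ⟨(ζ.torsorOverι {i}).left ⁻¹' V, fun v hv => (hsub ⟨hv, hyZ v⟩).2,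
        hV.preimage (ζ.torsorOverι {i}).left.continuous, hyV⟩⟩
  obtain ⟨F, hF, hF'⟩ := exists_extension_by_zero ((ζ.torsorOverι {i}).left ⁻¹ᵁ O) O'
    (fun y => em _) (fun y hy hy' => hy' hy) (pull a f)
  replace hF : pull (ζ.torsorInι {i} O) F = pull a f := hF
  rw [← hF] at hf' hne' hdvd'
  obtain ⟨g, hg⟩ := exists_descent_of_isSection_zero hO O' (fun y => em _) hf'
    (fun y hy hy' => hy' hy) hF'
  have hclosed : IsClosed ((ζ.torsorIn {i} O).left.basicOpen (pull (ζ.torsorInι {i} O) F) :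
      Set (ζ.torsorIn {i} O).left) := by
    change IsClosed ((ζ.torsorIn {i} O).left.basicOpen ((ζ.torsorInι {i} O).left.appTop F) :
      Set (ζ.torsorIn {i} O).left)
    rw [← hg, ← CommRingCat.comp_apply, ← Scheme.Hom.comp_appTop, ← Scheme.preimage_basicOpen_top]
    exact (hpc.isClosed_basicOpen g).preimage (Scheme.Hom.continuous _)
  obtain ⟨y, hy, hy'⟩ := hcut.exists_germ_ne_zero hζ hf' hne'
  have := hcut.isReduced hζ
  -- By pseudo-completeness the zero locus is open. It contains `y`, because the function is
  -- divisible by an entry that vanishes there; this contradicts the non-zero germ.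
  let V : (ζ.torsorIn {i} O).left.Opens := ⟨_, hclosed.isOpen_compl⟩
  have hyV : y ∈ V := by
    intro hyD
    obtain ⟨b, hb⟩ := hdvd'
    have h1 : y ∈ (ζ.torsorIn {i} O).left.basicOpen (pull (ζ.torsorInι {i} O) F) := hyD
    rw [hb, Scheme.basicOpen_mul] at h1
    have h2 : y ∈ (ζ.torsorInι {i} O ≫ ζ.torsorOverι {i}).left ⁻¹ᵁ
        ζ.I.left.basicOpen (ζ.entry i) := by
      rw [Scheme.preimage_basicOpen_top]
      exact h1.1
    exact hy' i (by simp) h2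
  have hV0 : res V (pull (ζ.torsorInι {i} O) F) = 0 := by
    rw [← basicOpen_eq_bot_iff, Scheme.basicOpen_res, eq_bot_iff]
    rintro v ⟨hv, hvD⟩
    exact hv hvD
  rw [← germ_res_apply V y hyV, hV0, map_zero] at hy
  exact hy rfl

/-- On a minimal stratum closure the weights of sections have non-negative coordinate. -/
lemma coord_nonneg_of_mem_cutWeights_singleton [Fintype ι] [DecidableEq ι] (hζ : ζ.IsSmooth) (i : ι)
    (hpc : PseudoComplete (ζ.stratumClosure {i})) {lam : ι → ℤ}
    (hlam : lam ∈ ζ.cutWeights (ζ.goodOpen hζ) {i}) {c : ι → ℚ} (hc : IsCoord p σ {i} lam c) :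
    0 ≤ c i := by
  obtain ⟨J, j, h, hj, hne, hh⟩ := hlam
  by_contra! hneg
  obtain ⟨N, hN, C, hC⟩ := exists_mul_eq_intCast c
  have hcC : IsCoord p σ {i} (-(N • lam)) fun l => ((-C l : ℤ) : ℚ) := by
    have := IsCoord.zsmul hc (-N)
    rw [neg_smul, natCast_zsmul] at this
    simpa [hC] using this
  have hCi : C i < 0 := by
    have : (C i : ℚ) < 0 := by
      rw [hC]
      exact mul_neg_of_pos_of_neg (by positivity) hneg
    exact_mod_cast this
  -- The weight `-(N • lam)` has positive `i`-th coordinate, so its explicit section contains a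
  -- positive power of the entry. Times `h ^ N` it has weight 0.
  obtain ⟨v, hv⟩ := (isCompatible_actRel (ζ := ζ) j).exists_isSection {i} (fun l hl => by
    rw [mat_comp]
    exact hj.pull_entry_eq_zero hl) hcC (by simp; omega)
  rw [Finset.prod_singleton, mat_comp] at hv
  have hψ := (hh.pow N).mul hv
  rw [add_neg_cancel] at hψ
  have hm : (-C i).toNat ≠ 0 := by omega
  have h0 := eq_zero_of_isSection_zero hζ i hpc hj hψ
    (Dvd.dvd.mul_left (Dvd.dvd.mul_left (dvd_pow_self _ hm) _) _)
  have hreg : IsRegularFn (J := J.left) (pull j (ζ.entry i)) := hj.isRegularFn hζ (by simp)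
  have h1 : pull j (ζ.entry i) ^ (-C i).toNat * (v * h ^ N) = 0 := by
    rw [← h0, entry]
    ring
  have h2 := (hreg.pow _).eq_zero h1
  have := hj.isReduced hζ
  exact hne ((pow_eq_zero_iff (by omega)).1 ((Units.mul_right_eq_zero v).1 h2))

end ZipMorphism

end Minimal

/-! ### Points and sections on the group -/

section Group

variable {k : Type u} [Field k] {ι : Type}

lemma mem_preStratum_iff {Y : KSch k} (g : Y ⟶ GSch k ι) (S : Finset ι) (y : Y.left) :
    y ∈ preStratum g S ↔ g.left y ∈ groupStratum k S := by
  have key : ∀ i, y ∈ Y.left.basicOpen (mat g i 0 0 : Γ(Y.left, ⊤)) ↔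
      g.left y ∈ (GSch k ι).left.basicOpen (mat (𝟙 (GSch k ι)) i 0 0 : Γ((GSch k ι).left, ⊤)) := by
    intro i
    have h1 : mat g i 0 0 = g.left.appTop (mat (𝟙 (GSch k ι)) i 0 0) := by
      rw [← Category.comp_id g, mat_comp, Category.comp_id]
    rw [h1, ← Scheme.preimage_basicOpen_top]
    rfl
  exact forall_congr' fun i => by rw [key i]

lemma groupStratum_nonempty (S : Finset ι) : (groupStratum k S).Nonempty := by
  classical
  let g : ι → Matrix (Fin 2) (Fin 2) k := fun i => if i ∈ S then 1 else !![0, 1; -1, 0]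
  have hg : ∀ i, (g i).det = 1 := fun i => by
    by_cases hi : i ∈ S <;> simp [g, hi]
  let φ := coordLift (k := k) g hg
  let P : PrimeSpectrum (CoordRing k ι) := ⟨RingHom.ker φ, RingHom.ker_isPrime _⟩
  refine ⟨P, fun i => ?_⟩
  have h1 : (mat (𝟙 (GSch k ι)) i 0 0 : Γ((GSch k ι).left, ⊤)) =
      (Scheme.ΓSpecIso (CommRingCat.of (CoordRing k ι))).inv (genericPt k ι i 0 0) :=
    pull_id (Y := GSch k ι) _
  have h2 : P ∈ (Spec (CommRingCat.of (CoordRing k ι))).basicOpen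
      ((Scheme.ΓSpecIso (CommRingCat.of (CoordRing k ι))).inv (genericPt k ι i 0 0)) ↔ i ∈ S := by
    have h3 : P ∈ (Spec (CommRingCat.of (CoordRing k ι))).basicOpen
        ((Scheme.ΓSpecIso (CommRingCat.of (CoordRing k ι))).inv (genericPt k ι i 0 0)) ↔
        ¬ φ (genericPt k ι i 0 0) = 0 := by
      rw [basicOpen_eq_of_affine]
      exact Iff.rfl
    rw [h3, coordLift_genericPt]
    by_cases hi : i ∈ S <;> simp [g, hi]
  rw [h1]
  exact h2

lemma isReduced_redClosure (Y : KSch k) (s : Set Y.left) : IsReduced (redClosure Y s).left := by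
  let I := Scheme.IdealSheafData.vanishingIdeal (X := Y.left) ⟨closure s, isClosed_closure⟩
  change IsReduced I.subscheme
  refine isReduced_of_exists_isReduced fun y => ?_
  obtain ⟨U, hU⟩ := exists_affineOpen_mem (I.subschemeι y)
  refine ⟨⟨I.subschemeι ⁻¹ᵁ U.1, U.2.preimage _⟩, hU, ⟨fun x hx => ?_⟩⟩
  obtain ⟨b, rfl⟩ := I.subschemeι_app_surjective U x
  obtain ⟨n, hn⟩ := hx
  have h1 : b ^ n ∈ I.ideal U := by
    rw [← I.ker_subschemeι_app U, RingHom.mem_ker, map_pow]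
    exact hn
  have h2 : b ∈ I.ideal U := by
    rw [Scheme.IdealSheafData.vanishingIdeal_ideal, PrimeSpectrum.mem_vanishingIdeal] at h1 ⊢
    exact fun P hP => P.2.mem_of_pow_mem n (h1 P hP)
  rw [← I.ker_subschemeι_app U] at h2
  exact h2

lemma isReduced_GSch [Finite ι] : IsReduced (GSch k ι).left :=
  isReduced_of_exists_isDomain ((smoothCoordinates_mat (𝟙 (GSch k ι))
    (inferInstanceAs (Smooth (𝟙 (GSch k ι).left)))).exists_isDomain (isCut_univ _))

lemma mat_redClosureι_eq_zero (S : Finset ι) {i : ι} (hi : i ∉ S) :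
    mat (redClosureι (GSch k ι) (groupStratum k S)) i 0 0 = 0 := by
  have := isReduced_redClosure (GSch k ι) (groupStratum k S)
  change (mat (redClosureι (GSch k ι) (groupStratum k S)) i 0 0 :
    Γ((redClosure (GSch k ι) (groupStratum k S)).left, ⊤)) = 0
  rw [← basicOpen_eq_bot_iff, eq_bot_iff]
  intro y hy
  have h1 : mat (redClosureι (GSch k ι) (groupStratum k S)) i 0 0 =
      (redClosureι (GSch k ι) (groupStratum k S)).left.appTop (mat (𝟙 (GSch k ι)) i 0 0) := by
    rw [← Category.comp_id (redClosureι (GSch k ι) (groupStratum k S)), mat_comp, Category.comp_id]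
  rw [h1, ← Scheme.preimage_basicOpen_top] at hy
  have h2 : (redClosureι (GSch k ι) (groupStratum k S)).left y ∈ closure (groupStratum k S) := by
    rw [← range_redClosureι]
    exact ⟨y, rfl⟩
  obtain ⟨x, hx1, hx2⟩ := mem_closure_iff.1 h2 _ ((GSch k ι).left.basicOpen
    (mat (𝟙 (GSch k ι)) i 0 0 : Γ((GSch k ι).left, ⊤))).2 hy
  exact hi ((hx2 i).1 hx1)

variable [Fintype ι] {p : ℕ} {σ : Equiv.Perm ι} {R : KSch k}
  {rel : ∀ T : KSch k, zipGroup p σ (Fn T) → (T ⟶ R) → (T ⟶ R) → Prop}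

/-- Weights with coordinates that are non-negative on `S` lie in the cone. -/
lemma IsCompatible.mem_sectionCone [DecidableEq ι] {g : R ⟶ GSch k ι} (hg : IsCompatible rel g)
    (S : Finset ι) (hS : ∀ i ∉ S, mat g i 0 0 = 0) (y : R.left) (hy : y ∈ preStratum g S)
    {lam : ι → ℤ} {c : ι → ℚ} (hc : IsCoord p σ S lam c) (hc0 : ∀ i ∈ S, 0 ≤ c i) :
    lam ∈ sectionCone p σ R rel := by
  obtain ⟨N, hN, C, hC⟩ := exists_mul_eq_intCast c
  have hcC : IsCoord p σ S (N • lam) fun l => (C l : ℚ) := by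
    have := hc.zsmul N
    rw [natCast_zsmul] at this
    simpa [hC] using this
  obtain ⟨v, hv⟩ := hg.exists_isSection S hS hcC fun i hi => by
    have : (0 : ℚ) ≤ C i := by
      rw [hC]
      exact mul_nonneg (by positivity) (hc0 i hi)
    exact_mod_cast this
  -- The explicit section is invertible at `y`, since all its factors are.
  refine ⟨N, hN, _, fun h0 => ?_, hv⟩
  have hunit : ∀ a : Γ(R.left, ⊤), y ∈ R.left.basicOpen a ↔
      IsUnit (R.left.presheaf.germ ⊤ y trivial a) := fun a => Scheme.mem_basicOpen_top _ a y
  have h1 : y ∈ R.left.basicOpen ((v : Fn R) * ∏ i ∈ S, mat g i 0 0 ^ (C i).toNat : Γ(R.left, ⊤)) := by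
    rw [hunit, map_mul, map_prod]
    refine (v.isUnit.map _).mul (IsUnit.prod_iff.2 fun i hi => ?_)
    rw [map_pow]
    exact ((hunit _).1 ((hy i).2 hi)).pow _
  rw [h0] at h1
  simp at h1

/-- A surjective compatible morphism to a reduced scheme pulls back the cone into the cone. -/
lemma sectionCone_subset_of_surjective {J : KSch k}
    {rel' : ∀ T : KSch k, zipGroup p σ (Fn T) → (T ⟶ J) → (T ⟶ J) → Prop} (φ : J ⟶ R)
    [IsReduced R.left] (hφ : ∀ T e z z', rel' T e z z' → rel T e (z ≫ φ) (z' ≫ φ))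
    (hsurj : Function.Surjective φ.left) : sectionCone p σ R rel ⊆ sectionCone p σ J rel' := by
  rintro lam ⟨m, hm, f, hf, hsec⟩
  refine ⟨m, hm, pull φ f, fun h0 => hf ?_, hsec.pullback φ hφ⟩
  change φ.left.appTop f = 0 at h0
  rw [← basicOpen_eq_bot_iff, eq_bot_iff]
  intro y hy
  obtain ⟨x, rfl⟩ := hsurj y
  have h1 : x ∈ φ.left ⁻¹ᵁ R.left.basicOpen f := hy
  rw [Scheme.preimage_basicOpen_top, h0] at h1
  simp at h1

end Group

/-! ### Comparison of the cones -/

section Comparison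

variable {k : Type u} [Field k] {ι : Type} {p : ℕ} {σ : Equiv.Perm ι} {X : KSch k}

namespace ZipMorphism

variable {ζ : ZipMorphism p σ X}

lemma MapsOnto.mono {Z Z' : Set X.left} {V V' : Set (GSch k ι).left} (h : ζ.MapsOnto Z V)
    (hZ : Z ⊆ Z') (hV : V' ⊆ V) : ζ.MapsOnto Z' V' := fun g hg =>
  let ⟨z, hz, hzg⟩ := h g (hV hg)
  ⟨z, hZ hz, hzg⟩

lemma preStratum_empty : preStratum ζ.q ∅ = ζ.zeroSet ∅ := by
  ext y
  exact forall_congr' fun i => by simp [entry]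

lemma mem_zeroSet_empty_iff (y : ζ.I.left) : y ∈ ζ.zeroSet ∅ ↔ ζ.q.left y ∈ groupStratum k ∅ := by
  rw [← preStratum_empty, mem_preStratum_iff]

lemma IsSmooth.mapsTo_closure_groupStratum [Finite ι] (hζ : ζ.IsSmooth) (S : Finset ι) :
    Set.MapsTo ζ.q.left (ζ.zeroSet S) (closure (groupStratum k S)) := by
  rw [← hζ.closure_preStratum]
  exact Set.MapsTo.closure (fun y hy => (mem_preStratum_iff ζ.q S y).1 hy) ζ.q.left.continuous

/-- The image in `X` of a saturated open and closed subset contains the connected components of its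
points. -/
lemma connectedComponentIn_subset_image [Fintype ι] (hζ : ζ.IsSmooth) {S : Finset ι}
    {B : Set ζ.I.left} (hclosed : IsClosed B) (hopen : RelOpen (ζ.zeroSet S) B)
    (hsat : Saturated ζ.π.left B) {y : ζ.I.left} (hy : y ∈ B) :
    connectedComponentIn (closure (ζ.stratum S)) (ζ.π.left y) ⊆ ζ.π.left '' B := by
  have hZ := hζ.preimage_closure_stratum S
  have hquot : Topology.IsQuotientMap ζ.π.left :=
    isOpenMap_π.isQuotientMap ζ.π.left.continuous ζ.surjective.surj
  have hB : ζ.π.left ⁻¹' (ζ.π.left '' B) = B := by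
    refine Set.Subset.antisymm ?_ (Set.subset_preimage_image _ _)
    rintro z ⟨b, hb, hbz⟩
    exact hsat b z hbz hb
  have h1 : IsClosed (ζ.π.left '' B) := by
    rw [← hquot.isClosed_preimage, hB]
    exact hclosed
  have h2 : IsClosed (closure (ζ.stratum S) \ ζ.π.left '' B) := by
    rw [← hquot.isClosed_preimage, Set.preimage_sdiff, hB, hZ, ← isOpen_compl_iff,
      isOpen_iff_forall_mem_open]
    intro z hz
    by_cases hzB : z ∈ B
    · obtain ⟨V, hV, hzV, hsub⟩ := hopen.2 z hzB
      exact ⟨V, fun v hv hv' => hv'.2 (hsub ⟨hv, hv'.1⟩), hV, hzV⟩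
    · exact ⟨(ζ.zeroSet S)ᶜ, fun v hv hv' => hv hv'.1, (isClosed_zeroSet S).isOpen_compl,
        fun h => hz ⟨h, hzB⟩⟩
  have hyZ : ζ.π.left y ∈ closure (ζ.stratum S) := by
    rw [← Set.mem_preimage, hZ]
    exact hopen.1 hy
  -- Both the image of `B` and its complement in the stratum closure are closed, so a connected
  -- component lies in one of them.
  rcases isPreconnected_iff_subset_of_disjoint_closed.1
    (isPreconnected_connectedComponentIn (F := closure (ζ.stratum S)) (x := ζ.π.left y)) _ _ h1 h2
    (fun x hx => by
      by_cases hxB : x ∈ ζ.π.left '' B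
      · exact Or.inl hxB
      · exact Or.inr ⟨connectedComponentIn_subset _ _ hx, hxB⟩)
    (by ext x; simp +contextual) with h | h
  · exact h
  · exact absurd ⟨y, hy, rfl⟩ (h (mem_connectedComponentIn hyZ)).2

lemma isCutOn_top {S : Finset ι} {J : KSch k} {j : J ⟶ ζ.I} (hj : IsCut ζ.entry S j.left) :
    ζ.IsCutOn ⊤ S j := by
  have h := hj.restrict ⊤
  have hi : IsIso (j.left ⁻¹ᵁ ⊤).ι := J.left.topIso.isIso_hom
  have := h.isClosedImmersion
  refine ⟨inv (j.left ⁻¹ᵁ ⊤).ι ≫ (j.left ∣_ ⊤), ?_, inferInstance, ?_⟩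
  · rw [Category.assoc, morphismRestrict_ι, IsIso.inv_hom_id_assoc]
  · rw [← h.ker_eq]
    exact Scheme.Hom.ker_comp_of_isIso _ _

/-- If all connected components of the stratum closure meet the minimal stratum, then all sections
are detected on the good open. -/
lemma mem_cutWeights_of_isCut [Fintype ι] (hζ : ζ.IsSmooth) (S : Finset ι)
    (hne0 : (ζ.zeroSet ∅).Nonempty)
    (hcomp : ∀ x ∈ closure (ζ.stratum S), ζ.MapsOnto (connectedComponentIn (closure (ζ.stratum S)) x)
      (closure (groupStratum k S))) {J : KSch k} {j : J ⟶ ζ.I} (hj : IsCut ζ.entry S j.left)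
    {lam : ι → ℤ} {h : Γ(J.left, ⊤)} (hh : IsSection p σ J (ζ.actRel j) lam h) (hne : h ≠ 0) :
    lam ∈ ζ.cutWeights (ζ.goodOpen hζ) S := by
  obtain ⟨z0, hz0⟩ := hne0
  have hred : IsReduced J.left :=
    isReduced_of_exists_isDomain (hζ.smoothCoordinates_entry.exists_isDomain hj)
  have hcut : ζ.IsCutOn ⊤ S j := isCutOn_top hj
  have hA1 := hcut.relOpen_image_basicOpen (J.left.basicOpen h)
  have hA2 := hcut.saturated_image_basicOpen (O := ⊤) (fun _ _ _ _ => Set.mem_univ _) hh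
  have hZ := isClosed_zeroSet (ζ := ζ) S
  have hirr := hζ.locallyIrreducible_zeroSet S
  have hD : J.left.basicOpen h ≠ ⊥ := fun h0 => hne ((basicOpen_eq_bot_iff h).1 h0)
  obtain ⟨y, hy⟩ := (TopologicalSpace.Opens.ne_bot_iff_nonempty _).1 hD
  -- The closure of the non-vanishing locus is saturated, closed and relatively open, so its image
  -- contains a whole component. By `hcomp` that component reaches the minimal stratum, around which
  -- lies the good open.
  have hsub := connectedComponentIn_subset_image hζ isClosed_closure (hA1.closure hZ hirr)
    (hA2.closure isOpenMap_π ζ.π.left.continuous) (subset_closure ⟨y, hy, rfl⟩)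
  have hyZ : ζ.π.left (j.left y) ∈ closure (ζ.stratum S) := by
    rw [← Set.mem_preimage, hζ.preimage_closure_stratum]
    exact hA1.1 ⟨y, hy, rfl⟩
  obtain ⟨z, hz, hzq⟩ := hcomp _ hyZ (ζ.q.left z0)
    (hζ.mapsTo_closure_groupStratum S (zeroSet_mono (Finset.empty_subset S) hz0))
  obtain ⟨b, hb, hbz⟩ := hsub hz
  have hzcl : z ∈ closure (j.left '' (J.left.basicOpen h : Set J.left)) :=
    hA2.closure isOpenMap_π ζ.π.left.continuous b z hbz hb
  have hz0' : z ∈ ζ.zeroSet ∅ := by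
    rw [mem_zeroSet_empty_iff, hzq, ← mem_zeroSet_empty_iff]
    exact hz0
  obtain ⟨_, hxO, x, hxD, rfl⟩ := mem_closure_iff.1 hzcl _ (ζ.goodOpen hζ).2
    (zeroSet_empty_subset_goodOpen hζ hz0')
  let U := j.left ⁻¹ᵁ ζ.goodOpen hζ
  let a : (Over.mk (U.ι ≫ J.hom) : KSch k) ⟶ J := Over.homMk U.ι rfl
  refine ⟨_, a ≫ j, pull a h, ⟨j.left ∣_ ζ.goodOpen hζ, morphismRestrict_ι _ _,
    hj.restrict _⟩, fun h0 => ?_, isSection_pull_comp a hh⟩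
  change U.ι.appTop h = 0 at h0
  have h1 : (⟨x, hxO⟩ : U) ∈ U.ι ⁻¹ᵁ J.left.basicOpen h := hxD
  rw [Scheme.preimage_basicOpen_top, h0] at h1
  simp only [Scheme.basicOpen_zero] at h1
  exact h1

end ZipMorphism

end Comparison

/-! ### The two inclusions -/

section Inclusions

variable {k : Type u} [Field k] {ι : Type} [Fintype ι] {p : ℕ} {σ : Equiv.Perm ι} {X : KSch k}

namespace ZipMorphism

variable {ζ : ZipMorphism p σ X}

/-- The target `R` is left abstract so that it can be a stratum closure in the group or the group
itself. The point `y` in the open stratum keeps the explicit sections on `R` from vanishing. -/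
lemma sectionCone_subset_of_isCut [DecidableEq ι] (hp : 2 ≤ p) (hζ : ζ.IsSmooth)
    (hpc : ∀ i, PseudoComplete (ζ.stratumClosure {i})) (hne0 : (ζ.zeroSet ∅).Nonempty)
    {S : Finset ι} (hS : ∀ i ∈ S, ∃ κ, IsSignAdmissible σ S i κ)
    (hcomp : ∀ x ∈ closure (ζ.stratum S), ζ.MapsOnto (connectedComponentIn (closure (ζ.stratum S)) x)
      (closure (groupStratum k S))) {J : KSch k} {j : J ⟶ ζ.I} (hj : IsCut ζ.entry S j.left)
    {R : KSch k} {rel : ∀ T : KSch k, zipGroup p σ (Fn T) → (T ⟶ R) → (T ⟶ R) → Prop}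
    {g : R ⟶ GSch k ι} (hg : IsCompatible rel g) (hgS : ∀ i ∉ S, mat g i 0 0 = 0) (y : R.left)
    (hy : g.left y ∈ groupStratum k S) :
    sectionCone p σ J (ζ.actRel j) ⊆ sectionCone p σ R rel := by
  rintro lam ⟨m, hm, f, hf, hsec⟩
  obtain ⟨c, hc⟩ := exists_isCoord hp σ S lam
  refine hg.mem_sectionCone S hgS y ((mem_preStratum_iff g S y).2 hy) hc fun i hi => ?_
  obtain ⟨κ, hκ⟩ := hS i hi
  have hmc : IsCoord p σ S (m • lam) fun l => m * c l := by
    have := hc.zsmul m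
    rw [natCast_zsmul] at this
    exact_mod_cast this
  have h := coord_nonneg_of_isSignAdmissible hp σ (ζ.cutWeights (ζ.goodOpen hζ))
    (fun S _ => exists_sub_mem_cutWeights hζ S)
    (fun i _ hlam _ => coord_nonneg_of_mem_cutWeights_singleton hζ i (hpc i) hlam) S i κ hκ _
    (mem_cutWeights_of_isCut hζ S hne0 hcomp hj hsec hf) _ hmc
  have hm' : (0 : ℚ) < m := by exact_mod_cast hm
  exact (mul_nonneg_iff_of_pos_left hm').1 h

/-- The restricted torsor is a cut, hence reduced, so its map to the group factors through the
reduced closure; surjectivity onto that closure keeps pullbacks non-zero. -/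
lemma stackStratumCone_subset_stratumCone (hζ : ζ.IsSmooth) (S : Finset ι)
    (hred : IsReduced (ζ.stratumClosure S).left)
    (honto : ζ.MapsOnto (closure (ζ.stratum S)) (closure (groupStratum k S))) :
    stackStratumCone k p σ S ⊆ ζ.stratumCone S := by
  have hcut := hζ.isCut_torsorOverι S hred
  have hJ : IsReduced (ζ.torsorOver S).left :=
    isReduced_of_exists_isDomain (hζ.smoothCoordinates_entry.exists_isDomain hcut)
  have hι : IsClosedImmersion (redClosureι (GSch k ι) (groupStratum k S)).left :=
    inferInstanceAs (IsClosedImmersion (Scheme.IdealSheafData.subschemeι _))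
  have hR := isReduced_redClosure (GSch k ι) (groupStratum k S)
  have hker := ker_le_ker_of_isReduced (redClosureι (GSch k ι) (groupStratum k S)).left
    (ζ.torsorOverι S ≫ ζ.q).left (by
      rw [range_redClosureι]
      rintro _ ⟨y, rfl⟩
      refine hζ.mapsTo_closure_groupStratum S ?_
      rw [← hζ.range_torsorOverι]
      exact ⟨y, rfl⟩)
  let l := IsClosedImmersion.lift _ _ hker
  have hl : l ≫ (redClosureι (GSch k ι) (groupStratum k S)).left = (ζ.torsorOverι S ≫ ζ.q).left :=
    IsClosedImmersion.lift_fac _ _ _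
  let φ : ζ.torsorOver S ⟶ redClosure (GSch k ι) (groupStratum k S) := Over.homMk l (by
    rw [← Over.w (redClosureι (GSch k ι) (groupStratum k S)), reassoc_of% hl, Over.w])
  have hφ : φ ≫ redClosureι _ _ = ζ.torsorOverι S ≫ ζ.q := by
    ext1
    exact hl
  refine sectionCone_subset_of_surjective φ (fun T e z z' h => ?_) fun y => ?_
  · have := isCompatible_actRel (ζ.torsorOverι S) T e z z' h
    simpa only [Category.assoc, hφ] using this
  · obtain ⟨z, hz, hzy⟩ := honto ((redClosureι (GSch k ι) (groupStratum k S)).left y) (by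
      rw [← range_redClosureι]
      exact ⟨y, rfl⟩)
    rw [← Set.mem_preimage, hζ.preimage_closure_stratum, ← hζ.range_torsorOverι] at hz
    obtain ⟨x, rfl⟩ := hz
    refine ⟨x, (redClosureι (GSch k ι) (groupStratum k S)).left.injective ?_⟩
    rw [← hzy, ← Scheme.Hom.comp_apply, ← Over.comp_left, hφ]
    rfl

lemma stackCone_subset_cone (honto : ζ.MapsOnto Set.univ Set.univ) :
    stackCone k p σ ⊆ ζ.cone := by
  have := isReduced_GSch (k := k) (ι := ι)
  refine sectionCone_subset_of_surjective ζ.q (fun T e z z' h => ?_) fun y => ?_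
  · subst h
    exact ζ.act_q e z
  · obtain ⟨z, -, hz⟩ := honto y (Set.mem_univ y)
    exact ⟨z, hz⟩

end ZipMorphism

end Inclusions

end ZipCone

end

/-! ### The equality of the cones -/

theorem theorem4 (p : ℕ) [Fact p.Prime] {k : Type u} [Field k] [Algebra (ZMod p) k]
    [IsAlgClosure (ZMod p) k] {r : ℕ} (d : Fin r → ℕ) (hd : ∀ m, 1 ≤ d m)
    (X : ZipCone.KSch k) [Nonempty X.left] (ζ : ZipCone.ZipMorphism p (ZipCone.frobPerm d) X)
    (hsmooth : ζ.IsSmooth)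
    (hsurj : ∀ x : X.left, ζ.MapsOnto (connectedComponent x) Set.univ)
    (hpc : ∀ S : Finset (ZipCone.Idx d), ZipCone.PseudoComplete (ζ.stratumClosure S)) :
    (∀ S : Finset (ZipCone.Idx d), ZipCone.IsGAdmissible S →
      (∀ x ∈ closure (ζ.stratum S),
        ζ.MapsOnto (connectedComponentIn (closure (ζ.stratum S)) x)
          (closure (ZipCone.groupStratum k S))) →
      ζ.stratumCone S = ZipCone.stackStratumCone k p (ZipCone.frobPerm d) S) ∧
    ζ.cone = ZipCone.stackCone k p (ZipCone.frobPerm d) ∧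
    ((∀ m, d m = 1) → ∀ S : Finset (ZipCone.Idx d), ZipCone.IsGAdmissible S) := by
  have hp : 2 ≤ p := (Fact.out : p.Prime).two_le
  obtain ⟨x₀⟩ := ‹Nonempty X.left›
  obtain ⟨z₀, hz₀⟩ : (ζ.zeroSet ∅).Nonempty := by
    obtain ⟨g, hg⟩ := ZipCone.groupStratum_nonempty (k := k) (∅ : Finset (ZipCone.Idx d))
    obtain ⟨z, -, rfl⟩ := hsurj x₀ g (Set.mem_univ g)
    exact ⟨z, (ZipCone.ZipMorphism.mem_zeroSet_empty_iff z).2 hg⟩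
  refine ⟨fun S hS hcomp => Set.Subset.antisymm ?_ ?_, Set.Subset.antisymm ?_ ?_,
    fun h S => ZipCone.isGAdmissible_of_forall_eq_one h S⟩
  · obtain ⟨g, hg⟩ := ZipCone.groupStratum_nonempty (k := k) S
    obtain ⟨y, rfl⟩ : g ∈ Set.range (ZipCone.redClosureι (ZipCone.GSch k (ZipCone.Idx d))
        (ZipCone.groupStratum k S)).left := by
      rw [ZipCone.range_redClosureι]
      exact subset_closure hg
    exact ZipCone.ZipMorphism.sectionCone_subset_of_isCut hp hsmooth (fun i => hpc {i}) ⟨z₀, hz₀⟩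
      (fun i hi => (hS i hi).isSignAdmissible) hcomp
      (hsmooth.isCut_torsorOverι S (hpc S).1) (fun _ _ _ _ h => h)
      (fun i hi => ZipCone.mat_redClosureι_eq_zero S hi) y hg
  · refine ZipCone.ZipMorphism.stackStratumCone_subset_stratumCone hsmooth S (hpc S).1 ?_
    refine (hcomp (ζ.π.left z₀) ?_).mono (connectedComponentIn_subset _ _) subset_rfl
    rw [← Set.mem_preimage, hsmooth.preimage_closure_stratum]
    exact ZipCone.ZipMorphism.zeroSet_mono (Finset.empty_subset S) hz₀
  · obtain ⟨g, hg⟩ := ZipCone.groupStratum_nonempty (k := k) (Finset.univ : Finset (ZipCone.Idx d))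
    have huniv : closure (ζ.stratum Finset.univ) = Set.univ := by
      refine Set.eq_univ_of_forall fun x => ?_
      obtain ⟨z, rfl⟩ := ζ.surjective.surj x
      rw [← Set.mem_preimage, hsmooth.preimage_closure_stratum]
      exact fun i hi => absurd (Finset.mem_univ i) hi
    -- The second claim is the case of the full index set, which is always admissible; here the cut
    -- is the torsor itself and the target is the whole group.
    have h := ZipCone.ZipMorphism.sectionCone_subset_of_isCut hp hsmooth (fun i => hpc {i})
      ⟨z₀, hz₀⟩ (S := Finset.univ)
      (fun i hi => (ZipCone.isGAdmissible_univ d i hi).isSignAdmissible)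
      (by
        rw [huniv]
        intro x _
        rw [connectedComponentIn_univ]
        exact (hsurj x).mono subset_rfl (Set.subset_univ _)) (j := 𝟙 ζ.I)
      (by rw [Finset.coe_univ]; exact ZipCone.isCut_univ _)
      (R := ZipCone.GSch k (ZipCone.Idx d))
      (rel := fun _ e z z' => ZipCone.mat z' = e.1.1 * ZipCone.mat z * e.1.2⁻¹)
      (g := 𝟙 _) (fun T e z z' h => by rwa [Category.comp_id, Category.comp_id])
      (fun i hi => absurd (Finset.mem_univ i) hi) g hg
    refine subset_trans (subset_of_eq ?_) h
    have hrel : ζ.actRel (𝟙 ζ.I) = fun _ e z z' => ζ.act e z = z' := by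
      ext T e z z'
      simp [ZipCone.ZipMorphism.actRel]
    rw [hrel]
    rfl
  · exact ZipCone.ZipMorphism.stackCone_subset_cone
      ((hsurj x₀).mono (Set.subset_univ _) subset_rfl)
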